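/- Let $G$ be an undirected simple graph on $n$ vertices with at least one edge, accessed through uniform vertex queries, degree queries and neighbor queries. Let $d(v)$ denote the degree of $v$. Edges are oriented, so $m=\sum_v d(v)$, and $d_{avg}=m/n$. For a multiset $S$ of vertices let $m(S)=\sum_{v\in S}d(v)$, let $E(S)$ be the multiset of edges $(u,w)$ of $G$ with $u\in S$, and let $d_S(v)$ be the number of neighbors of $v$ in $S$ (all counted with the multiplicities of $S$). Call $d$ an $\epsilon$-good estimate of $d_{avg}$ if $d\in[(1-\epsilon)d_{avg},d_{avg}]$. For a threshold $\tau$, call $S$ $\epsilon$-good if every $v$ with $d(v)>\tau$ satisfies $d_S(v)\in(1\pm\epsilon)|S|\,d(v)/n$, and $m(S)/|S|\in[\tfrac14 d_{avg},12\,d_{avg}]$. Given a subroutine $A(n,\epsilon,\delta)$ that returns an estimate of the average degree, the procedure $\mathrm{Preprocessing}(n,\epsilon,\delta,x)$ does the following. 1. It runs $A(n,\epsilon,\delta/3)$ to obtain $\bar d_{avg}$, and sets $\bar x=\min\{x,\sqrt{n/\bar d_{avg}}\}$, $t=\lceil\log_3(3/\delta)\rceil$, $\tau=\bar x\,\bar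 d_{avg}/\epsilon$ and $s=\lceil\frac n\tau\cdot\frac{35\log(6nt/\delta)}{\epsilon^2}\rceil$. 2. It draws multisets $S_1,\dots,S_t$ of $s$ uniform vertices each, and queries the degrees of all their elements. 3. It lets $S$ be the first $S_i$ with $m(S_i)/s\in[\frac14\bar d_{avg},12\,\bar d_{avg}]$, and fails if there is none. 4. It sets up a data structure $D(S)$, consisting of the elements of $S$ and the partial sums of their degrees. 5. It returns $(\bar\gamma,\tau,\bar x,D(S))$ with $\bar\gamma=m(S)/(\bar d_{avg}|S|)$. **Lemma.** There are an algorithm $A$ in the above query model, and a constant $C>0$, such that for all $\epsilon\in(0,\frac12)$, $\delta\in(0,1)$ and all $G$ as above, $A(n,\epsilon,\delta)$ returns an $\epsilon$-good estimate of $d_{avg}$ with probability at least $1-\delta$, and such that for all $\epsilon\in(0,\tfrac12)$, $\delta\in(0,1)$, $x\ge1$ and all $G$ as above the following holds for $\mathrm{Preprocessing}(n,\epsilon,\delta,x)$ with subroutine $A$. * With probability at least $1-\delta$ it returns a tuple $(\bar\gamma,\tau,\bar x,D(S))$ such that * $S$ is an $\epsilon$-good multiset of size $s$, and $D(S)$ supports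 sampling a uniform edge of $E(S)$, with one query and at most $C|S|$ steps per sample; * $\bar x\in[1,\sqrt{n/\bar d_{avg}}]$, $\tau=\bar x\,\bar d_{avg}/\epsilon$ and $\bar\gamma=m(S)/(\bar d_{avg}|S|)$, where $\bar d_{avg}$ is an $\epsilon$-good estimate of $d_{avg}$. * Its expected number of queries and its expected running time (on a real-RAM with unit-cost arithmetic, including square roots, logarithms and rounding, and unit-cost uniform random integers and queries) are each at most $$C\cdot\max\Big\{\frac{n}{d_{avg}\,x},\sqrt{\frac{n}{d_{avg}}}\Big\}\cdot\frac{\log^2\big(n\log(3/\delta)/\delta\big)}{\epsilon^{2.5}} .$$ -/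

import Mathlib

/-- Adjacency-list query access to an undirected simple graph on the vertex set `Fin n`:
the graph together with an arbitrary enumeration of the neighbours of every vertex. The
equivalence `nbr v` forces `deg v` to be the degree of `v`. -/
structure AdjListGraph (n : ℕ) where
  graph : SimpleGraph (Fin n)
  deg : Fin n → ℕ
  nbr : (v : Fin n) → Fin (deg v) ≃ graph.neighborSet v

namespace AdjListGraph

variable {n : ℕ} (G : AdjListGraph n)

/-- The number of oriented edges. -/
def m : ℕ := ∑ v, G.deg v

/-- The average degree `m / n`. -/
noncomputable def davg : ℝ := (G.m : ℝ) / n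

open scoped Classical in
/-- `E(S)` for a multiset `S` of vertices: the oriented edges `(u, w)` with `u ∈ S`, each with
the multiplicity of `u` in `S`. -/
noncomputable def edgesFrom (S : Multiset (Fin n)) : Multiset (Fin n × Fin n) :=
  S.bind fun u => ((Finset.univ.filter fun w => G.graph.Adj u w).val.map fun w => (u, w))

/-- `m(S)`, the sum of the degrees over `S` (with multiplicity). -/
def degSum (S : Multiset (Fin n)) : ℕ := (S.map G.deg).sum

open scoped Classical in
/-- `d_S(v)`, the number of neighbours of `v` in `S` (with multiplicity). -/
noncomputable def degInto (S : Multiset (Fin n)) (v : Fin n) : ℕ :=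
  (S.filter fun u => G.graph.Adj v u).card

/-- `S` is an `ε`-good (multi)set with respect to the degree threshold `τ`. -/
def GoodSet (ε τ : ℝ) (S : Multiset (Fin n)) : Prop :=
  (∀ v, τ < G.deg v →
    (1 - ε) * (S.card * (G.deg v : ℝ) / n) ≤ G.degInto S v ∧
    (G.degInto S v : ℝ) ≤ (1 + ε) * (S.card * (G.deg v : ℝ) / n)) ∧
  (1 / 4) * G.davg ≤ (G.degSum S : ℝ) / S.card ∧
  (G.degSum S : ℝ) / S.card ≤ 12 * G.davg

/-- `d` is an `ε`-good estimate of the average degree. -/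
def GoodEstimate (ε d : ℝ) : Prop := (1 - ε) * G.davg ≤ d ∧ d ≤ G.davg

end AdjListGraph

namespace EdgeSampling

/-! A real-RAM with queries. A store consists of real-valued registers and arrays; a program is a
finite command built from unit-cost arithmetic, memory accesses, branching, bounded loops,
subroutine calls, uniform random integers and the three graph queries. -/

/-- Arithmetic expressions over registers (`var`) and array cells (`load`). -/
inductive Expr where
  | const (k : ℕ)
  | var (r : ℕ)
  | load (a : ℕ) (i : Expr)
  | add (e f : Expr)
  | sub (e f : Expr)
  | mul (e f : Expr)
  | div (e f : Expr)
  | sqrt (e : Expr)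
  | log (e : Expr)
  | ceil (e : Expr)

namespace Expr
instance (k : ℕ) : OfNat Expr k := ⟨.const k⟩
instance : Add Expr := ⟨.add⟩
instance : Sub Expr := ⟨.sub⟩
instance : Mul Expr := ⟨.mul⟩
instance : Div Expr := ⟨.div⟩
end Expr

/-- The commands of the query machine. -/
inductive Cmd where
  | skip
  /-- register assignment `r := e` -/
  | assign (r : ℕ) (e : Expr)
  /-- array assignment `a[i] := e` -/
  | store (a : ℕ) (i e : Expr)
  /-- `r :=` a uniform element of `{0, …, ⌊e⌋ - 1}` -/
  | random (r : ℕ) (e : Expr)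
  /-- uniform vertex query -/
  | uniformVertex (r : ℕ)
  /-- degree query `r := deg(v)` -/
  | degree (r : ℕ) (v : Expr)
  /-- neighbour query `r := nbr(v, i)`, with indices starting at `0` -/
  | neighbor (r : ℕ) (v i : Expr)
  | seq (c d : Cmd)
  /-- `if e ≤ f then c else d` -/
  | ifLe (e f : Expr) (c d : Cmd)
  /-- `for r = 0, …, ⌊e⌋ - 1 do c` -/
  | loop (r : ℕ) (e : Expr) (c : Cmd)
  /-- `r := c(args)`: run `c` on a fresh store with the arguments in registers `0, 1, …`; the
  value returned is the final content of register `0` of `c` -/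
  | call (r : ℕ) (c : Cmd) (args : List Expr)

/-- Sequential composition of a list of commands. -/
def block : List Cmd → Cmd
  | [] => .skip
  | [c] => c
  | c :: cs => .seq c (block cs)

/-- A store, together with the number of queries and of steps made so far. -/
structure State where
  reg : ℕ → ℝ
  mem : ℕ → ℕ → ℝ
  queries : ℕ
  time : ℕ

namespace State

/-- The initial state with the given arguments in registers `0, 1, …`. -/
def init (args : List ℝ) : State where
  reg := fun i => args.getD i 0
  mem := fun _ _ => 0
  queries := 0
  time := 0

/-- Write a register. -/
def setReg (σ : State) (r : ℕ) (y : ℝ) : State :=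
  { σ with reg := Function.update σ.reg r y }

/-- Write an array cell. -/
def setMem (σ : State) (a i : ℕ) (y : ℝ) : State :=
  { σ with mem := Function.update σ.mem a (Function.update (σ.mem a) i y) }

/-- Charge `k` steps. -/
def tick (σ : State) (k : ℕ) : State := { σ with time := σ.time + k }

/-- Charge one query. -/
def query (σ : State) : State := { σ with queries := σ.queries + 1 }

end State

namespace Expr

/-- The value of an expression. Array indices are rounded down to natural numbers. -/
noncomputable def eval (σ : State) : Expr → ℝ
  | const k => k
  | var r => σ.reg r
  | load a i => σ.mem a ⌊eval σ i⌋₊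
  | add e f => eval σ e + eval σ f
  | sub e f => eval σ e - eval σ f
  | mul e f => eval σ e * eval σ f
  | div e f => eval σ e / eval σ f
  | sqrt e => Real.sqrt (eval σ e)
  | log e => Real.log (eval σ e)
  | ceil e => (⌈eval σ e⌉ : ℝ)

/-- The number of steps needed to evaluate an expression: one per constant, memory access and
arithmetic operation. -/
def cost : Expr → ℕ
  | const _ => 1
  | var _ => 1
  | load _ i => i.cost + 1
  | add e f => e.cost + f.cost + 1
  | sub e f => e.cost + f.cost + 1
  | mul e f => e.cost + f.cost + 1
  | div e f => e.cost + f.cost + 1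
  | sqrt e => e.cost + 1
  | log e => e.cost + 1
  | ceil e => e.cost + 1

end Expr

/-- The answer to a degree query; `-1` if the argument does not name a vertex. -/
noncomputable def degAnswer {n : ℕ} (G : AdjListGraph n) (v : ℝ) : ℝ :=
  if h : ⌊v⌋₊ < n then (G.deg ⟨⌊v⌋₊, h⟩ : ℝ) else -1

/-- The answer to a neighbour query; `-1` stands for `⊥` (no such neighbour). -/
noncomputable def nbrAnswer {n : ℕ} (G : AdjListGraph n) (v i : ℝ) : ℝ :=
  if h : ⌊v⌋₊ < n then
    if h' : ⌊i⌋₊ < G.deg ⟨⌊v⌋₊, h⟩ then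
      (((G.nbr ⟨⌊v⌋₊, h⟩ ⟨⌊i⌋₊, h'⟩ : Fin n) : ℕ) : ℝ)
    else -1
  else -1

/-- Run the random steps `f 0, …, f (k - 1)` one after the other. -/
noncomputable def iter (f : ℕ → State → PMF State) : ℕ → State → PMF State
  | 0, σ => PMF.pure σ
  | k + 1, σ => (iter f k σ).bind (f k)

/-- The distribution of the final state of a command. Every command costs one step, plus the
steps for its expressions and (for a loop) one step per iteration. -/
noncomputable def Cmd.run {n : ℕ} [NeZero n] (G : AdjListGraph n) : Cmd → State → PMF State
  | .skip, σ => PMF.pure (σ.tick 1)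
  | .assign r e, σ => PMF.pure ((σ.setReg r (e.eval σ)).tick (e.cost + 1))
  | .store a i e, σ =>
      PMF.pure ((σ.setMem a ⌊i.eval σ⌋₊ (e.eval σ)).tick (i.cost + e.cost + 1))
  | .random r e, σ =>
      (PMF.uniformOfFintype (Fin (⌊e.eval σ⌋₊ - 1 + 1))).map fun k =>
        (σ.setReg r ((k : ℕ) : ℝ)).tick (e.cost + 1)
  | .uniformVertex r, σ =>
      (PMF.uniformOfFintype (Fin n)).map fun v => ((σ.setReg r ((v : ℕ) : ℝ)).query).tick 1
  | .degree r v, σ =>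
      PMF.pure (((σ.setReg r (degAnswer G (v.eval σ))).query).tick (v.cost + 1))
  | .neighbor r v i, σ =>
      PMF.pure (((σ.setReg r (nbrAnswer G (v.eval σ) (i.eval σ))).query).tick
        (v.cost + i.cost + 1))
  | .seq c d, σ => (c.run G σ).bind fun σ' => d.run G σ'
  | .ifLe e f c d, σ =>
      open scoped Classical in
      if e.eval σ ≤ f.eval σ then c.run G (σ.tick (e.cost + f.cost + 1))
      else d.run G (σ.tick (e.cost + f.cost + 1))
  | .loop r e c, σ =>
      iter (fun k σ' => c.run G ((σ'.setReg r (k : ℝ)).tick 1)) ⌊e.eval σ⌋₊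
        (σ.tick (e.cost + 1))
  | .call r c args, σ =>
      (c.run G (State.init (args.map (Expr.eval σ)))).map fun σ' =>
        { (σ.setReg r (σ'.reg 0)) with
          queries := σ.queries + σ'.queries
          time := σ.time + σ'.time + (args.map Expr.cost).sum + 1 }

/-- The expectation of a natural-number-valued quantity of the final state. -/
noncomputable def expect (p : PMF State) (f : State → ℕ) : ENNReal :=
  ∑' σ, p σ * (f σ : ENNReal)

/-- `A(n, ε, δ)` returns, with probability at least `1 - δ`, an `ε`-good estimate of the average
degree of every graph on `n` vertices with at least one edge. -/
def EstimatesAverageDegree (A : Cmd) : Prop :=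
  ∀ (n : ℕ) [NeZero n] (G : AdjListGraph n) (ε δ : ℝ), 0 < G.m →
    0 < ε → ε < 1 / 2 → 0 < δ → δ < 1 →
    ENNReal.ofReal (1 - δ) ≤
      (A.run G (State.init [(n : ℝ), ε, δ])).toOuterMeasure
        {σ | G.GoodEstimate ε (σ.reg 0)}

/-! Registers of the preprocessing procedure; the first four hold its input. -/

abbrev vN : ℕ := 0
abbrev vEps : ℕ := 1
abbrev vDelta : ℕ := 2
abbrev vX : ℕ := 3
/-- the estimate of the average degree -/
abbrev vDbar : ℕ := 4
abbrev vXbar : ℕ := 5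
abbrev vT : ℕ := 6
abbrev vTau : ℕ := 7
/-- the sample size `s` -/
abbrev vS : ℕ := 8
abbrev vI : ℕ := 9
abbrev vJ : ℕ := 10
/-- running value of `m(S_i)` -/
abbrev vM : ℕ := 11
abbrev vFound : ℕ := 12
/-- index of the chosen sample -/
abbrev vK : ℕ := 13
abbrev vGamma : ℕ := 14
/-- first endpoint of a sampled edge, or a sampled vertex -/
abbrev vU : ℕ := 15
abbrev vD : ℕ := 16
/-- running degree sum, finally `m(S)` -/
abbrev vC : ℕ := 17
/-- `1` if a tuple is returned, `0` if the procedure fails -/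
abbrev vOk : ℕ := 18
abbrev vR : ℕ := 19
abbrev vHit : ℕ := 20
abbrev vPrev : ℕ := 21
abbrev vIdx : ℕ := 22
/-- second endpoint of a sampled edge -/
abbrev vW : ℕ := 23

/-! Arrays: `S_i` occupies the cells `i * s, …, i * s + s - 1` of `aSample`, the degrees of its
elements the same cells of `aDeg`; `aSum[i] = m(S_i)`. The data structure `D(S)` consists of the
list `dsVert` of the elements of `S`, the array `dsCum` of partial sums of their degrees, and the
registers `vS` (the size of `S`) and `vC` (its degree sum). -/

abbrev aSample : ℕ := 0
abbrev aDeg : ℕ := 1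
abbrev aSum : ℕ := 2
abbrev dsVert : ℕ := 3
abbrev dsCum : ℕ := 4

open _root_.EdgeSampling.Expr _root_.EdgeSampling.Cmd

/-- Sample the multisets `S_0, …, S_{t-1}`, query all degrees and compute all `m(S_i)`. -/
def sampleSets : Cmd :=
  loop vI (var vT) (block [
    loop vJ (var vS) (block [
      uniformVertex vU,
      store aSample (var vI * var vS + var vJ) (var vU)]),
    assign vM 0,
    loop vJ (var vS) (block [
      degree vD (load aSample (var vI * var vS + var vJ)),
      store aDeg (var vI * var vS + var vJ) (var vD),
      assign vM (var vM + var vD)]),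
    store aSum (var vI) (var vM)])

/-- Find the first `i` with `m(S_i) / s ∈ [dbar / 4, 12 dbar]`. -/
def chooseSet : Cmd := block [
  assign vFound 0,
  loop vI (var vT)
    (ifLe (var vFound) 0
      (ifLe (1 / 4 * var vDbar) (load aSum (var vI) / var vS)
        (ifLe (load aSum (var vI) / var vS) (12 * var vDbar)
          (block [assign vFound 1, assign vK (var vI)])
          skip)
        skip)
      skip)]

/-- Set up the data structure `D(S)` for the chosen sample `S`. -/
def buildDS : Cmd := block [
  assign vC 0,
  loop vJ (var vS) (block [
    store dsVert (var vJ) (load aSample (var vK * var vS + var vJ)),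
    assign vC (var vC + load aDeg (var vK * var vS + var vJ)),
    store dsCum (var vJ) (var vC)])]

/-- The preprocessing procedure on input `(n, ε, δ, x)`, with `A` as the subroutine that
estimates the average degree. -/
def preprocessing (A : Cmd) : Cmd := block [
  call vDbar A [var vN, var vEps, var vDelta / 3],
  assign vXbar (sqrt (var vN / var vDbar)),
  ifLe (var vX) (var vXbar) (assign vXbar (var vX)) skip,
  assign vT (ceil (log (3 / var vDelta) / log 3)),
  assign vTau (var vXbar * var vDbar / var vEps),
  assign vS (ceil (var vN / var vTau *
    (35 * log (6 * var vN * var vT / var vDelta) / (var vEps * var vEps)))),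
  sampleSets,
  chooseSet,
  ifLe (var vFound) 0
    (assign vOk 0)
    (block [
      buildDS,
      assign vGamma (load aSum (var vK) / (var vDbar * var vS)),
      assign vOk 1])]

/-- The sampling operation supported by `D(S)`: draw `r ∈ {0, …, m(S) - 1}` uniformly, locate the
element of `S` to which the `r`-th edge of `E(S)` belongs by scanning the partial sums, and query
the corresponding neighbour. The edge is returned in the registers `vU`, `vW`. -/
def sampleEdge : Cmd := block [
  random vR (var vC),
  assign vHit 0,
  assign vPrev 0,
  loop vJ (var vS)
    (ifLe (var vHit) 0
      (ifLe (load dsCum (var vJ)) (var vR)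
        (assign vPrev (load dsCum (var vJ)))
        (block [
          assign vHit 1,
          assign vU (load dsVert (var vJ)),
          assign vIdx (var vR - var vPrev)]))
      skip),
  neighbor vW (var vU) (var vIdx)]

/-- The state `σ` holds a data structure that supports sampling a uniform edge of `E(S)`: running
`sampleEdge` from `σ` returns every edge with probability proportional to its multiplicity in
`E(S)`, making one query and at most `C * |S|` steps. -/
def SupportsUniformEdge {n : ℕ} [NeZero n] (G : AdjListGraph n) (C : ℝ)
    (S : Multiset (Fin n)) (σ : State) : Prop :=
  open scoped Classical in
  G.edgesFrom S ≠ 0 ∧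
  (∀ u w : Fin n,
    (sampleEdge.run G σ).toOuterMeasure
        {σ' | σ'.reg vU = ((u : ℕ) : ℝ) ∧ σ'.reg vW = ((w : ℕ) : ℝ)} =
      ((G.edgesFrom S).count (u, w) : ENNReal) / ((G.edgesFrom S).card : ENNReal)) ∧
  ∀ σ' ∈ (sampleEdge.run G σ).support,
    σ'.queries = σ.queries + 1 ∧ (σ'.time : ℝ) ≤ σ.time + C * S.card

/-- The number of vertices in each sample, for the threshold `τ`:
`s = ⌈(n / τ) · 35 log(6 n t / δ) / ε²⌉` with `t = ⌈log₃(3 / δ)⌉`. -/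
noncomputable def sampleSize (n : ℕ) (ε δ τ : ℝ) : ℕ :=
  ⌈(n : ℝ) / τ * (35 * Real.log (6 * n * ⌈Real.logb 3 (3 / δ)⌉ / δ) / ε ^ 2)⌉₊

/-- The preprocessing procedure ended in state `σ` and was successful: it returned a tuple
`(γbar, τ, xbar, D(S))` with the required properties. -/
def Successful {n : ℕ} [NeZero n] (G : AdjListGraph n) (ε δ C : ℝ) (σ : State) : Prop :=
  σ.reg vOk = 1 ∧
  (∃ S : Multiset (Fin n),
    S.card = sampleSize n ε δ (σ.reg vTau) ∧
    G.GoodSet ε (σ.reg vTau) S ∧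
    SupportsUniformEdge G C S σ ∧
    σ.reg vGamma = (G.degSum S : ℝ) / (σ.reg vDbar * S.card)) ∧
  1 ≤ σ.reg vXbar ∧ σ.reg vXbar ≤ Real.sqrt ((n : ℝ) / σ.reg vDbar) ∧
  σ.reg vTau = σ.reg vXbar * σ.reg vDbar / ε ∧
  G.GoodEstimate ε (σ.reg vDbar)

/-- `max {n / (d x), √(n / d)} · log²(n log(3/δ) / δ) / ε^{2.5}`, where `d` is the average
degree. -/
noncomputable def complexityBound {n : ℕ} (G : AdjListGraph n) (ε δ x : ℝ) : ℝ :=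
  max ((n : ℝ) / (G.davg * x)) (Real.sqrt ((n : ℝ) / G.davg)) *
    (Real.log (n * Real.log (3 / δ) / δ) ^ 2 / ε ^ (5 / 2 : ℝ))

end EdgeSampling

/-! The subroutine `estimateDegree` is a geometric search for the average degree d. For a guess g,
call a vertex heavy if its degree exceeds θ = 4√(ng/ε). One sample draws a uniform vertex u and
contributes 0 if u is heavy; otherwise it contributes deg u, or 2 deg u if a uniform neighbour of u
is heavy. The doubling makes up for the discarded oriented edges from heavy to light vertices, so
only edges between two heavy vertices are lost (`sum_lightWeight`). There are at most m/θ heavy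
vertices, hence at most (m/θ)² such edges, and this is at most εm/4 as long as g ≥ d/4. A
contribution is at most 2θ, so O(√(n/g) log(n/δ)/ε^2.5) samples determine the mean up to εg/16
(`searchRound_prob`). If the empirical mean is at least g, then it yields a good estimate after
scaling by 1 - ε/2; otherwise g > d/2, so halving g preserves g ≥ d/4. Since d ≥ 1/n,
logarithmically many rounds suffice, and the costs of the rounds grow geometrically, so the total is
governed by √(n/d).

Given a good estimate, one drawn sample S can be bad in three ways. A Chernoff bound and a union
bound over the vertices control d_S(v) for deg v > τ (`degInto_tail_le`). The lower bound for m(S)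
is a Chernoff bound for the degrees capped at √(m/2), which still carry half of m
(`half_m_le_sum_min`, `degSum_lower_tail_le`). The upper bound is only Markov's inequality
(`heavySample_le`), with failure probability 1/6 per sample. The first two bounds are required of
all t samples, because the choice depends on them. The third need only hold for one of them, which
fails with probability 6^(-t); the filter then guarantees the upper bound for whichever sample it
selects. An edge of E(S) is drawn by inverting the partial sums of the degrees
(`supportsUniformEdge_of_holdsDS`).

For the expected time, a failed search may return a tiny estimate and hence cause huge samples. In
every run the cost is at most the intended one with the repetition count replaced by 16n³, and the
search, called with δ/3, fails with probability at most δ/(3n⁴), so this contributes only a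
lower-order term. The query bound follows because every query costs a step.

All probabilistic statements about programs come from one rule: a potential whose expectation never
increases over an iteration bounds its own final expectation (`mean_loop_le`). Exponential
potentials give tail bounds, and potentials of the form "failed already, plus rounds left times p"
give union bounds. -/

open scoped ENNReal

namespace EdgeSampling

/-! ### Expectations and probabilities of discrete distributions. -/

section Expectation

variable {α β : Type*}

/-- The expectation of a nonnegative function under a discrete distribution. -/
noncomputable def mean (p : PMF α) (f : α → ℝ≥0∞) : ℝ≥0∞ := ∑' a, p a * f a

theorem mean_pure (a : α) (f : α → ℝ≥0∞) : mean (PMF.pure a) f = f a := by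
  classical
  unfold mean
  rw [tsum_eq_single a]
  · simp
  · intro b hb
    simp [PMF.pure_apply, hb]

theorem mean_bind (p : PMF α) (q : α → PMF β) (f : β → ℝ≥0∞) :
    mean (p.bind q) f = mean p fun a => mean (q a) f := by
  unfold mean
  simp only [PMF.bind_apply, ← ENNReal.tsum_mul_right, ← ENNReal.tsum_mul_left]
  rw [ENNReal.tsum_comm]
  simp only [mul_assoc]

theorem mean_map (p : PMF α) (g : α → β) (f : β → ℝ≥0∞) :
    mean (p.map g) f = mean p fun a => f (g a) := by
  unfold PMF.map
  rw [mean_bind]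
  simp [mean_pure]

theorem mean_mono {p : PMF α} {f g : α → ℝ≥0∞} (h : ∀ a ∈ p.support, f a ≤ g a) :
    mean p f ≤ mean p g := by
  refine ENNReal.tsum_le_tsum fun a => ?_
  by_cases ha : a ∈ p.support
  · exact mul_le_mul_right (h a ha) _
  · rw [PMF.mem_support_iff, not_not] at ha
    simp [ha]

theorem mean_const (p : PMF α) (c : ℝ≥0∞) : mean p (fun _ => c) = c := by
  simp [mean, ENNReal.tsum_mul_right]

theorem mean_le_of_forall_le {p : PMF α} {f : α → ℝ≥0∞} {c : ℝ≥0∞}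
    (h : ∀ a ∈ p.support, f a ≤ c) : mean p f ≤ c :=
  (mean_mono h).trans (mean_const p c).le

theorem mean_add (p : PMF α) (f g : α → ℝ≥0∞) :
    mean p (fun a => f a + g a) = mean p f + mean p g := by
  simp [mean, mul_add, ENNReal.tsum_add]

theorem mean_mul_const (p : PMF α) (f : α → ℝ≥0∞) (c : ℝ≥0∞) :
    mean p (fun a => f a * c) = mean p f * c := by
  simp [mean, ← mul_assoc, ENNReal.tsum_mul_right]

theorem mean_bind_le {p : PMF α} {q : α → PMF β} {f : β → ℝ≥0∞} {g : α → ℝ≥0∞} {c : ℝ≥0∞}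
    (hq : ∀ a ∈ p.support, mean (q a) f ≤ g a) (hp : mean p g ≤ c) : mean (p.bind q) f ≤ c := by
  rw [mean_bind]
  exact (mean_mono hq).trans hp

theorem mean_uniform [Fintype α] [Nonempty α] (f : α → ℝ≥0∞) :
    mean (PMF.uniformOfFintype α) f = (∑ a, f a) / Fintype.card α := by
  simp only [mean, PMF.uniformOfFintype_apply, tsum_fintype]
  rw [← Finset.mul_sum, ENNReal.div_eq_inv_mul]

theorem toOuterMeasure_eq_mean (p : PMF α) (s : Set α) :
    p.toOuterMeasure s = mean p (s.indicator 1) := by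
  rw [PMF.toOuterMeasure_apply]
  refine tsum_congr fun a => ?_
  by_cases h : a ∈ s <;> simp [h]

theorem toOuterMeasure_le_mean {p : PMF α} {s : Set α} {f : α → ℝ≥0∞}
    (h : ∀ a ∈ p.support, a ∈ s → 1 ≤ f a) : p.toOuterMeasure s ≤ mean p f := by
  rw [toOuterMeasure_eq_mean]
  refine mean_mono fun a ha => ?_
  by_cases hs : a ∈ s
  · simpa [hs] using h a ha hs
  · simp [hs]

theorem toOuterMeasure_add_compl (p : PMF α) (s : Set α) :
    p.toOuterMeasure s + p.toOuterMeasure sᶜ = 1 := by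
  rw [toOuterMeasure_eq_mean, toOuterMeasure_eq_mean, ← mean_add]
  rw [← mean_const p 1]
  congr 1
  funext a
  by_cases h : a ∈ s <;> simp [h]

theorem ofReal_one_sub_le_toOuterMeasure {p : PMF α} {s : Set α} {δ : ℝ} (hδ : 0 ≤ δ)
    (h : p.toOuterMeasure sᶜ ≤ ENNReal.ofReal δ) :
    ENNReal.ofReal (1 - δ) ≤ p.toOuterMeasure s := by
  rw [ENNReal.ofReal_sub _ hδ, ENNReal.ofReal_one, tsub_le_iff_right,
    ← toOuterMeasure_add_compl p s]
  exact add_le_add le_rfl h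

theorem toOuterMeasure_mono_support {p : PMF α} {s t : Set α}
    (h : ∀ a ∈ p.support, a ∈ s → a ∈ t) : p.toOuterMeasure s ≤ p.toOuterMeasure t :=
  PMF.toOuterMeasure_mono p fun a ha => h a ha.2 ha.1

theorem toOuterMeasure_union_le (p : PMF α) (s t : Set α) :
    p.toOuterMeasure (s ∪ t) ≤ p.toOuterMeasure s + p.toOuterMeasure t :=
  MeasureTheory.measure_union_le s t

theorem expect_eq_mean (p : PMF State) (f : State → ℕ) :
    expect p f = mean p fun σ => (f σ : ℝ≥0∞) := rfl

end Expectation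

/-! ### Invariants and supermartingales for iterated random steps. -/

section Iter

variable {f : ℕ → State → PMF State} {I : ℕ → State → Prop} {N : ℕ} {σ : State}

theorem iter_invariant (h0 : I 0 σ)
    (hs : ∀ k < N, ∀ σ, I k σ → ∀ σ' ∈ (f k σ).support, I (k + 1) σ') :
    ∀ σ' ∈ (iter f N σ).support, I N σ' := by
  induction N with
  | zero =>
    intro σ' h
    simp only [iter, PMF.mem_support_pure_iff] at h
    rwa [h]
  | succ N ih =>
    intro σ' h
    simp only [iter, PMF.mem_support_bind_iff] at h
    obtain ⟨τ, hτ, h⟩ := h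
    exact hs N N.lt_succ_self τ (ih (fun k hk => hs k (hk.trans N.lt_succ_self)) τ hτ) σ' h

/-- A supermartingale bound: the expected potential cannot grow in a step, so by induction it cannot
grow over the loop. The invariant `I` restricts the states in which the one-step inequality has to
be checked. -/
theorem mean_iter_le (Φ : ℕ → State → ℝ≥0∞) (h0 : I 0 σ)
    (hs : ∀ k < N, ∀ σ, I k σ → ∀ σ' ∈ (f k σ).support, I (k + 1) σ')
    (hΦ : ∀ k < N, ∀ σ, I k σ → mean (f k σ) (Φ (k + 1)) ≤ Φ k σ) :
    mean (iter f N σ) (Φ N) ≤ Φ 0 σ := by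
  induction N with
  | zero => simp [iter, mean_pure]
  | succ N ih =>
    refine mean_bind_le (g := Φ N) (fun τ hτ => hΦ N N.lt_succ_self τ ?_) ?_
    · exact iter_invariant h0 (fun k hk => hs k (hk.trans N.lt_succ_self)) τ hτ
    · exact ih (fun k hk => hs k (hk.trans N.lt_succ_self))
        (fun k hk => hΦ k (hk.trans N.lt_succ_self))

end Iter

/-- Every query takes at least one step. -/
theorem queries_le_time {n : ℕ} [NeZero n] (G : AdjListGraph n) (c : Cmd) :
    ∀ σ, ∀ σ' ∈ (c.run G σ).support, σ'.queries + σ.time ≤ σ'.time + σ.queries := by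
  induction c with
  | skip =>
    intro σ σ' h
    simp only [Cmd.run, PMF.mem_support_pure_iff] at h
    subst h; simp only [State.tick]; omega
  | assign r e =>
    intro σ σ' h
    simp only [Cmd.run, PMF.mem_support_pure_iff] at h
    subst h; simp only [State.tick, State.setReg]; omega
  | store a i e =>
    intro σ σ' h
    simp only [Cmd.run, PMF.mem_support_pure_iff] at h
    subst h; simp only [State.tick, State.setMem]; omega
  | random r e =>
    intro σ σ' h
    simp only [Cmd.run, PMF.support_map, Set.mem_image] at h
    obtain ⟨k, -, rfl⟩ := h; simp only [State.tick, State.setReg]; omega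
  | uniformVertex r =>
    intro σ σ' h
    simp only [Cmd.run, PMF.support_map, Set.mem_image] at h
    obtain ⟨k, -, rfl⟩ := h; simp only [State.tick, State.setReg, State.query]; omega
  | degree r v =>
    intro σ σ' h
    simp only [Cmd.run, PMF.mem_support_pure_iff] at h
    subst h; simp only [State.tick, State.setReg, State.query]; omega
  | neighbor r v i =>
    intro σ σ' h
    simp only [Cmd.run, PMF.mem_support_pure_iff] at h
    subst h; simp only [State.tick, State.setReg, State.query]; omega
  | seq c d hc hd =>
    intro σ σ' h
    simp only [Cmd.run, PMF.mem_support_bind_iff] at h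
    obtain ⟨τ, hτ, h⟩ := h
    have := hc _ _ hτ
    have := hd _ _ h
    omega
  | ifLe e f c d hc hd =>
    intro σ σ' h
    simp only [Cmd.run] at h
    split_ifs at h
    · have := hc _ _ h
      simp only [State.tick] at this; omega
    · have := hd _ _ h
      simp only [State.tick] at this; omega
  | loop r e c hc =>
    intro σ σ' h
    refine iter_invariant (I := fun _ τ => τ.queries + σ.time ≤ τ.time + σ.queries) ?_ ?_ σ' h
    · simp only [State.tick]; omega
    · intro k _ τ hτ τ' h'
      have := hc _ _ h'
      simp only [State.tick, State.setReg] at this; omega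
  | call r c args hc =>
    intro σ σ' h
    simp only [Cmd.run, PMF.support_map, Set.mem_image] at h
    obtain ⟨τ, hτ, rfl⟩ := h
    have := hc _ _ hτ
    simp only [State.init] at this ⊢; omega

end EdgeSampling

/-! ### Degrees as adjacency sums. -/

namespace AdjListGraph

variable {n : ℕ} (G : AdjListGraph n)

open scoped Classical in
/-- The adjacency indicator. -/
noncomputable def adj (u w : Fin n) : ℝ := if G.graph.Adj u w then 1 else 0

theorem adj_comm (u w : Fin n) : G.adj u w = G.adj w u := by
  unfold adj; rw [G.graph.adj_comm]

theorem adj_nonneg (u w : Fin n) : 0 ≤ G.adj u w := by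
  unfold adj; split_ifs <;> norm_num

theorem adj_le_one (u w : Fin n) : G.adj u w ≤ 1 := by
  unfold adj; split_ifs <;> norm_num

-- The enumeration `nbr v` is a bijection onto the neighbour set, so a uniform neighbour index gives
-- a uniform neighbour. This turns sums over query answers into sums over vertex pairs, where
-- symmetry of adjacency can be used.
open scoped Classical in
theorem sum_nbr {M : Type*} [AddCommMonoid M] (v : Fin n) (F : Fin n → M) :
    ∑ i, F (G.nbr v i) = ∑ w, if G.graph.Adj v w then F w else 0 := by
  rw [Equiv.sum_comp (G.nbr v) (fun w => F w), ← Finset.sum_filter]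
  refine Finset.sum_bij' (fun w _ => w.1) (fun w hw => ⟨w, (Finset.mem_filter.1 hw).2⟩) ?_ ?_ ?_ ?_ ?_
  · intro w _; exact Finset.mem_filter.2 ⟨Finset.mem_univ _, w.2⟩
  · simp
  · simp
  · simp
  · simp

theorem sum_nbr_eq_sum_adj (v : Fin n) (F : Fin n → ℝ) :
    ∑ i, F (G.nbr v i) = ∑ w, G.adj v w * F w := by
  rw [sum_nbr]
  exact Finset.sum_congr rfl fun w _ => by unfold adj; split_ifs <;> simp

theorem deg_eq_sum_adj (v : Fin n) : (G.deg v : ℝ) = ∑ w, G.adj v w := by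
  simpa using G.sum_nbr_eq_sum_adj v fun _ => 1

theorem deg_le (v : Fin n) : G.deg v ≤ n := by
  have : (G.deg v : ℝ) ≤ n := by
    rw [deg_eq_sum_adj]
    exact (Finset.sum_le_sum fun w _ => G.adj_le_one v w).trans (by simp)
  exact_mod_cast this

theorem m_le : G.m ≤ n * n :=
  (Finset.sum_le_sum fun v _ => G.deg_le v).trans (by simp)

theorem cast_m : (G.m : ℝ) = ∑ v, (G.deg v : ℝ) := by simp [m]

theorem two_le_of_m_pos (h : 0 < G.m) : 2 ≤ n := by
  by_contra hn
  have : Subsingleton (Fin n) := Fin.subsingleton_iff_le_one.2 (by omega)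
  obtain ⟨v, -, hv⟩ := Finset.exists_ne_zero_of_sum_ne_zero h.ne'
  have i : Fin (G.deg v) := ⟨0, Nat.pos_of_ne_zero hv⟩
  have : G.graph.Adj v (G.nbr v i) := (G.nbr v i).2
  exact this.ne (Subsingleton.elim _ _)

theorem davg_pos (h : 0 < G.m) : 0 < G.davg := by
  have := G.two_le_of_m_pos h
  unfold davg
  positivity

theorem davg_le [NeZero n] : G.davg ≤ n := by
  have hn : (0 : ℝ) < n := by exact_mod_cast NeZero.pos n
  unfold davg
  rw [div_le_iff₀ hn]
  exact_mod_cast G.m_le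

theorem inv_le_davg [NeZero n] (h : 0 < G.m) : (1 : ℝ) / n ≤ G.davg := by
  unfold davg
  gcongr
  exact_mod_cast h

theorem cast_mul_davg [NeZero n] : n * G.davg = G.m := by
  have hn : (n : ℝ) ≠ 0 := by exact_mod_cast NeZero.ne n
  unfold davg
  field_simp

/-! ### Heavy vertices, and how much of m is seen from the light ones. -/

section Heavy

variable (θ : ℝ)

/-- Indicator of the vertices of degree more than `θ`. -/
noncomputable def heavy (u : Fin n) : ℝ := if (G.deg u : ℝ) ≤ θ then 0 else 1

theorem heavy_nonneg (u : Fin n) : 0 ≤ G.heavy θ u := by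
  unfold heavy; split_ifs <;> norm_num

theorem heavy_le_one (u : Fin n) : G.heavy θ u ≤ 1 := by
  unfold heavy; split_ifs <;> norm_num

theorem sum_heavy_mul_le : (∑ u, G.heavy θ u) * θ ≤ G.m := by
  rw [cast_m, Finset.sum_mul]
  refine Finset.sum_le_sum fun u _ => ?_
  unfold heavy
  split_ifs with h
  · simp
  · simp only [one_mul]; exact (not_le.1 h).le

theorem sum_adj_heavy_heavy_le :
    ∑ u, ∑ w, G.adj u w * (G.heavy θ u * G.heavy θ w) ≤ (∑ u, G.heavy θ u) ^ 2 := by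
  rw [sq, Finset.sum_mul_sum]
  refine Finset.sum_le_sum fun u _ => Finset.sum_le_sum fun w _ => ?_
  exact mul_le_of_le_one_left (mul_nonneg (G.heavy_nonneg θ u) (G.heavy_nonneg θ w))
    (G.adj_le_one u w)

theorem cast_m_eq_sum_adj : (G.m : ℝ) = ∑ u, ∑ w, G.adj u w := by
  simp only [cast_m, deg_eq_sum_adj]

/-- The weight of the edges from a light vertex `u`; those to heavy vertices count twice. -/
noncomputable def lightWeight (u : Fin n) : ℝ :=
  if (G.deg u : ℝ) ≤ θ then ∑ i, (1 + G.heavy θ (G.nbr u i)) else 0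

theorem lightWeight_eq (u : Fin n) :
    G.lightWeight θ u = ∑ w, G.adj u w * ((1 - G.heavy θ u) * (1 + G.heavy θ w)) := by
  rw [lightWeight, G.sum_nbr_eq_sum_adj u fun w => 1 + G.heavy θ w]
  by_cases h : (G.deg u : ℝ) ≤ θ
  · simp [h, heavy]
  · simp [h, heavy]

theorem lightWeight_nonneg (u : Fin n) : 0 ≤ G.lightWeight θ u := by
  unfold lightWeight
  split_ifs
  · exact Finset.sum_nonneg fun i _ => add_nonneg zero_le_one (G.heavy_nonneg θ _)
  · exact le_rfl

theorem lightWeight_le {θ : ℝ} (hθ : 0 ≤ θ) (u : Fin n) : G.lightWeight θ u ≤ 2 * θ := by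
  unfold lightWeight
  split_ifs with h
  · have : ∑ i, (1 + G.heavy θ (G.nbr u i)) ≤ ∑ _i : Fin (G.deg u), (2 : ℝ) :=
      Finset.sum_le_sum fun i _ => by linarith [G.heavy_le_one θ (G.nbr u i)]
    simp only [Finset.sum_const, Finset.card_univ, Fintype.card_fin, nsmul_eq_mul] at this
    linarith
  · positivity

/-- With a and b the heaviness indicators of the two ends, symmetrising the weight over both
orientations gives (1 - a)(1 + b) + (1 - b)(1 + a) = 2(1 - ab). So exactly the edges between two
heavy vertices are lost. -/
theorem sum_lightWeight :
    ∑ u, G.lightWeight θ u = G.m - ∑ u, ∑ w, G.adj u w * (G.heavy θ u * G.heavy θ w) := by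
  have h1 : ∑ u, G.lightWeight θ u =
      ∑ u, ∑ w, G.adj u w * ((1 - G.heavy θ u) * (1 + G.heavy θ w)) :=
    Finset.sum_congr rfl fun u _ => G.lightWeight_eq θ u
  have h2 : ∑ u, G.lightWeight θ u =
      ∑ u, ∑ w, G.adj u w * ((1 - G.heavy θ w) * (1 + G.heavy θ u)) := by
    rw [h1, Finset.sum_comm]
    simp only [G.adj_comm]
  have h3 : ∑ u, G.lightWeight θ u + ∑ u, G.lightWeight θ u =
      2 * (G.m - ∑ u, ∑ w, G.adj u w * (G.heavy θ u * G.heavy θ w)) := by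
    nth_rewrite 1 [h1]
    rw [h2, cast_m_eq_sum_adj, ← Finset.sum_add_distrib, ← Finset.sum_sub_distrib, Finset.mul_sum]
    refine Finset.sum_congr rfl fun u _ => ?_
    rw [← Finset.sum_add_distrib, ← Finset.sum_sub_distrib, Finset.mul_sum]
    exact Finset.sum_congr rfl fun w _ => by ring
  linarith

theorem sum_lightWeight_le : ∑ u, G.lightWeight θ u ≤ G.m := by
  rw [sum_lightWeight, sub_le_self_iff]
  exact Finset.sum_nonneg fun u _ => Finset.sum_nonneg fun w _ =>
    mul_nonneg (G.adj_nonneg u w) (mul_nonneg (G.heavy_nonneg θ u) (G.heavy_nonneg θ w))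

theorem le_sum_lightWeight (hθ : 0 < θ) : G.m - (G.m / θ) ^ 2 ≤ ∑ u, G.lightWeight θ u := by
  rw [sum_lightWeight]
  have h : ∑ u, G.heavy θ u ≤ G.m / θ := (le_div_iff₀ hθ).2 (G.sum_heavy_mul_le θ)
  have h0 : 0 ≤ ∑ u, G.heavy θ u := Finset.sum_nonneg fun u _ => G.heavy_nonneg θ u
  have := G.sum_adj_heavy_heavy_le θ
  have := pow_le_pow_left₀ h0 h 2
  linarith

/-- Capping the degrees at `√(m / 2)` keeps at least half of their sum. -/
theorem half_m_le_sum_min (hθ : 0 < θ) (hm : (G.m : ℝ) ≤ 2 * θ ^ 2) :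
    (G.m : ℝ) / 2 ≤ ∑ u, min (G.deg u : ℝ) θ := by
  set H := ∑ u, G.heavy θ u with hH
  have hmin : ∑ u, min (G.deg u : ℝ) θ = ∑ u, G.deg u * (1 - G.heavy θ u) + H * θ := by
    rw [hH, Finset.sum_mul, ← Finset.sum_add_distrib]
    refine Finset.sum_congr rfl fun u _ => ?_
    unfold heavy
    split_ifs with h
    · simp [h]
    · simp [(not_le.1 h).le]
  have hL : ∑ u, G.deg u * (1 - G.heavy θ u) = ∑ u, ∑ w, G.adj u w * (1 - G.heavy θ u) :=
    Finset.sum_congr rfl fun u _ => by rw [deg_eq_sum_adj, Finset.sum_mul]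
  have hL' : ∑ u, G.deg u * (1 - G.heavy θ u) = ∑ u, ∑ w, G.adj u w * (1 - G.heavy θ w) := by
    rw [hL, Finset.sum_comm]; simp only [G.adj_comm]
  -- Every edge has a light start, a light end, or two heavy ends; pointwise this is (1 - a)(1 - b)
  -- ≥ 0. With D the degree sum of the light vertices and H the number of heavy ones, m ≤ 2D + H².
  -- Since H ≤ 2θ, the capped sum D + Hθ is at least D + H²/2 ≥ m/2.
  have hsplit : (G.m : ℝ) ≤ 2 * ∑ u, G.deg u * (1 - G.heavy θ u) +
      ∑ u, ∑ w, G.adj u w * (G.heavy θ u * G.heavy θ w) := by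
    rw [two_mul]
    nth_rewrite 1 [hL]
    rw [hL', cast_m_eq_sum_adj, ← Finset.sum_add_distrib, ← Finset.sum_add_distrib]
    refine Finset.sum_le_sum fun u _ => ?_
    rw [← Finset.sum_add_distrib, ← Finset.sum_add_distrib]
    refine Finset.sum_le_sum fun w _ => ?_
    have := mul_nonneg (G.adj_nonneg u w) (mul_nonneg (sub_nonneg.2 (G.heavy_le_one θ u))
      (sub_nonneg.2 (G.heavy_le_one θ w)))
    nlinarith
  have h2 : H ≤ 2 * θ := by
    have := G.sum_heavy_mul_le θ
    nlinarith
  have h0 : 0 ≤ H := Finset.sum_nonneg fun u _ => G.heavy_nonneg θ u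
  have := G.sum_adj_heavy_heavy_le θ
  rw [hmin]
  nlinarith

end Heavy

end AdjListGraph

/-! ### Syntactic frame rules, cost bounds, and proof rules for loops and queries. -/

namespace EdgeSampling

/-- The registers a command may write. -/
def Cmd.writes : Cmd → List ℕ
  | .skip => []
  | .assign r _ => [r]
  | .store _ _ _ => []
  | .random r _ => [r]
  | .uniformVertex r => [r]
  | .degree r _ => [r]
  | .neighbor r _ _ => [r]
  | .seq c d => c.writes ++ d.writes
  | .ifLe _ _ c d => c.writes ++ d.writes
  | .loop r _ c => r :: c.writes
  | .call r _ _ => [r]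

/-- The arrays a command may write. -/
def Cmd.stores : Cmd → List ℕ
  | .store a _ _ => [a]
  | .seq c d => c.stores ++ d.stores
  | .ifLe _ _ c d => c.stores ++ d.stores
  | .loop _ _ c => c.stores
  | _ => []

/-- Commands without loops and subroutine calls. -/
def Cmd.loopFree : Cmd → Bool
  | .seq c d => c.loopFree && d.loopFree
  | .ifLe _ _ c d => c.loopFree && d.loopFree
  | .loop _ _ _ => false
  | .call _ _ _ => false
  | _ => true

/-- A bound for the number of steps of a loop-free command. -/
def Cmd.maxCost : Cmd → ℕ
  | .skip => 1
  | .assign _ e => e.cost + 1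
  | .store _ i e => i.cost + e.cost + 1
  | .random _ e => e.cost + 1
  | .uniformVertex _ => 1
  | .degree _ v => v.cost + 1
  | .neighbor _ v i => v.cost + i.cost + 1
  | .seq c d => c.maxCost + d.maxCost
  | .ifLe e f c d => e.cost + f.cost + 1 + max c.maxCost d.maxCost
  | .loop _ _ _ => 0
  | .call _ _ _ => 0

variable {n : ℕ} [NeZero n] (G : AdjListGraph n)

/-- The frame rule for registers. As the list of written registers is computable, its side condition
can be settled by `decide` for concrete programs. -/
theorem reg_eq_of_notMem_writes (c : Cmd) : ∀ σ, ∀ σ' ∈ (c.run G σ).support, ∀ r ∉ c.writes,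
    σ'.reg r = σ.reg r := by
  induction c with
  | skip =>
    intro σ σ' h r hr
    simp only [Cmd.run, PMF.mem_support_pure_iff] at h
    subst h; rfl
  | assign r e =>
    intro σ σ' h r hr
    simp only [Cmd.run, PMF.mem_support_pure_iff] at h
    subst h
    exact Function.update_of_ne (by simpa [Cmd.writes] using hr) _ _
  | store a i e =>
    intro σ σ' h r hr
    simp only [Cmd.run, PMF.mem_support_pure_iff] at h
    subst h; rfl
  | random r e =>
    intro σ σ' h r hr
    simp only [Cmd.run, PMF.support_map, Set.mem_image] at h
    obtain ⟨k, -, rfl⟩ := h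
    exact Function.update_of_ne (by simpa [Cmd.writes] using hr) _ _
  | uniformVertex r =>
    intro σ σ' h r hr
    simp only [Cmd.run, PMF.support_map, Set.mem_image] at h
    obtain ⟨k, -, rfl⟩ := h
    exact Function.update_of_ne (by simpa [Cmd.writes] using hr) _ _
  | degree r v =>
    intro σ σ' h r hr
    simp only [Cmd.run, PMF.mem_support_pure_iff] at h
    subst h
    exact Function.update_of_ne (by simpa [Cmd.writes] using hr) _ _
  | neighbor r v i =>
    intro σ σ' h r hr
    simp only [Cmd.run, PMF.mem_support_pure_iff] at h
    subst h
    exact Function.update_of_ne (by simpa [Cmd.writes] using hr) _ _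
  | seq c d hc hd =>
    intro σ σ' h r hr
    simp only [Cmd.run, PMF.mem_support_bind_iff] at h
    simp only [Cmd.writes, List.mem_append, not_or] at hr
    obtain ⟨τ, hτ, h⟩ := h
    rw [hd _ _ h r hr.2, hc _ _ hτ r hr.1]
  | ifLe e f c d hc hd =>
    intro σ σ' h r hr
    simp only [Cmd.run] at h
    simp only [Cmd.writes, List.mem_append, not_or] at hr
    split_ifs at h
    · exact hc _ _ h r hr.1
    · exact hd _ _ h r hr.2
  | loop r e c hc =>
    intro σ σ' h q hq
    simp only [Cmd.run] at h
    simp only [Cmd.writes, List.mem_cons, not_or] at hq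
    refine iter_invariant (I := fun _ τ => τ.reg q = σ.reg q) ?_ ?_ σ' h
    · rfl
    intro k _ τ hτ τ' h'
    rw [hc _ _ h' q hq.2, ← hτ]
    exact Function.update_of_ne hq.1 _ _
  | call r c args hc =>
    intro σ σ' h q hq
    simp only [Cmd.run, PMF.support_map, Set.mem_image] at h
    obtain ⟨τ, hτ, rfl⟩ := h
    exact Function.update_of_ne (by simpa [Cmd.writes] using hq) _ _

theorem mem_eq_of_notMem_stores (c : Cmd) : ∀ σ, ∀ σ' ∈ (c.run G σ).support, ∀ a ∉ c.stores,
    σ'.mem a = σ.mem a := by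
  induction c with
  | skip =>
    intro σ σ' h r hr
    simp only [Cmd.run, PMF.mem_support_pure_iff] at h
    subst h; rfl
  | assign r e =>
    intro σ σ' h r hr
    simp only [Cmd.run, PMF.mem_support_pure_iff] at h
    subst h; rfl
  | store a i e =>
    intro σ σ' h r hr
    simp only [Cmd.run, PMF.mem_support_pure_iff] at h
    subst h
    exact Function.update_of_ne (by simpa [Cmd.stores] using hr) _ _
  | random r e =>
    intro σ σ' h r hr
    simp only [Cmd.run, PMF.support_map, Set.mem_image] at h
    obtain ⟨k, -, rfl⟩ := h; rfl
  | uniformVertex r =>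
    intro σ σ' h r hr
    simp only [Cmd.run, PMF.support_map, Set.mem_image] at h
    obtain ⟨k, -, rfl⟩ := h; rfl
  | degree r v =>
    intro σ σ' h r hr
    simp only [Cmd.run, PMF.mem_support_pure_iff] at h
    subst h; rfl
  | neighbor r v i =>
    intro σ σ' h r hr
    simp only [Cmd.run, PMF.mem_support_pure_iff] at h
    subst h; rfl
  | seq c d hc hd =>
    intro σ σ' h r hr
    simp only [Cmd.run, PMF.mem_support_bind_iff] at h
    simp only [Cmd.stores, List.mem_append, not_or] at hr
    obtain ⟨τ, hτ, h⟩ := h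
    rw [hd _ _ h r hr.2, hc _ _ hτ r hr.1]
  | ifLe e f c d hc hd =>
    intro σ σ' h r hr
    simp only [Cmd.run] at h
    simp only [Cmd.stores, List.mem_append, not_or] at hr
    split_ifs at h
    · exact hc _ _ h r hr.1
    · exact hd _ _ h r hr.2
  | loop r e c hc =>
    intro σ σ' h q hq
    simp only [Cmd.run] at h
    refine iter_invariant (I := fun _ τ => τ.mem q = σ.mem q) ?_ ?_ σ' h
    · rfl
    intro k _ τ hτ τ' h'
    rw [hc _ _ h' q hq, ← hτ]
    rfl
  | call r c args hc =>
    intro σ σ' h q hq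
    simp only [Cmd.run, PMF.support_map, Set.mem_image] at h
    obtain ⟨τ, hτ, rfl⟩ := h; rfl

theorem time_le_maxCost (c : Cmd) (hl : c.loopFree = true) : ∀ σ, ∀ σ' ∈ (c.run G σ).support,
    σ'.time ≤ σ.time + c.maxCost := by
  induction c with
  | skip =>
    intro σ σ' h
    simp only [Cmd.run, PMF.mem_support_pure_iff] at h
    subst h; exact le_rfl
  | assign r e =>
    intro σ σ' h
    simp only [Cmd.run, PMF.mem_support_pure_iff] at h
    subst h; exact le_rfl
  | store a i e =>
    intro σ σ' h
    simp only [Cmd.run, PMF.mem_support_pure_iff] at h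
    subst h; exact le_rfl
  | random r e =>
    intro σ σ' h
    simp only [Cmd.run, PMF.support_map, Set.mem_image] at h
    obtain ⟨k, -, rfl⟩ := h; exact le_rfl
  | uniformVertex r =>
    intro σ σ' h
    simp only [Cmd.run, PMF.support_map, Set.mem_image] at h
    obtain ⟨k, -, rfl⟩ := h; exact le_rfl
  | degree r v =>
    intro σ σ' h
    simp only [Cmd.run, PMF.mem_support_pure_iff] at h
    subst h; exact le_rfl
  | neighbor r v i =>
    intro σ σ' h
    simp only [Cmd.run, PMF.mem_support_pure_iff] at h
    subst h; exact le_rfl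
  | seq c d hc hd =>
    intro σ σ' h
    simp only [Cmd.run, PMF.mem_support_bind_iff] at h
    simp only [Cmd.loopFree, Bool.and_eq_true] at hl
    obtain ⟨τ, hτ, h⟩ := h
    have := hc hl.1 _ _ hτ
    have := hd hl.2 _ _ h
    simp only [Cmd.maxCost]; omega
  | ifLe e f c d hc hd =>
    intro σ σ' h
    simp only [Cmd.run] at h
    simp only [Cmd.loopFree, Bool.and_eq_true] at hl
    simp only [Cmd.maxCost]
    split_ifs at h
    · have := hc hl.1 _ _ h
      simp only [State.tick] at this; omega
    · have := hd hl.2 _ _ h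
      simp only [State.tick] at this; omega
  | loop r e c hc => simp [Cmd.loopFree] at hl
  | call r c args hc => simp [Cmd.loopFree] at hl

variable {G}

theorem mem_support_seq {c d : Cmd} {σ σ' : State} :
    σ' ∈ ((Cmd.seq c d).run G σ).support ↔
      ∃ τ ∈ (c.run G σ).support, σ' ∈ (d.run G τ).support := by
  simp only [Cmd.run, PMF.mem_support_bind_iff]

/-- The invariant rule for loops. -/
theorem loop_invariant {r N : ℕ} {e : Expr} {c : Cmd} {σ : State} (I : ℕ → State → Prop)
    (hN : ⌊e.eval σ⌋₊ = N) (h0 : I 0 (σ.tick (e.cost + 1)))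
    (hs : ∀ k < N, ∀ τ, I k τ → ∀ τ' ∈ (c.run G ((τ.setReg r k).tick 1)).support, I (k + 1) τ') :
    ∀ σ' ∈ ((Cmd.loop r e c).run G σ).support, I N σ' := by
  intro σ' h
  simp only [Cmd.run, hN] at h
  exact iter_invariant h0 hs σ' h

/-- The supermartingale rule for loops. -/
theorem mean_loop_le {r N : ℕ} {e : Expr} {c : Cmd} {σ : State} (I : ℕ → State → Prop)
    (Φ : ℕ → State → ℝ≥0∞) (hN : ⌊e.eval σ⌋₊ = N) (h0 : I 0 (σ.tick (e.cost + 1)))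
    (hs : ∀ k < N, ∀ τ, I k τ → ∀ τ' ∈ (c.run G ((τ.setReg r k).tick 1)).support, I (k + 1) τ')
    (hΦ : ∀ k < N, ∀ τ, I k τ →
      mean (c.run G ((τ.setReg r k).tick 1)) (Φ (k + 1)) ≤ Φ k τ) :
    mean ((Cmd.loop r e c).run G σ) (Φ N) ≤ Φ 0 (σ.tick (e.cost + 1)) := by
  simp only [Cmd.run, hN]
  exact mean_iter_le Φ h0 hs hΦ

theorem time_loop_le {r N b : ℕ} {e : Expr} {c : Cmd} {σ : State}
    (hl : c.loopFree = true) (hb : c.maxCost + 1 ≤ b) (hN : ⌊e.eval σ⌋₊ = N) :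
    ∀ σ' ∈ ((Cmd.loop r e c).run G σ).support, σ'.time ≤ σ.time + (e.cost + 1) + N * b := by
  refine loop_invariant (fun k τ => τ.time ≤ σ.time + (e.cost + 1) + k * b) hN ?_ ?_
  · simp only [State.tick]; omega
  · intro k _ τ hτ τ' h'
    have := time_le_maxCost G c hl _ _ h'
    simp only [State.tick, State.setReg] at this
    rw [add_mul]; omega

/-- The semantics of `random` and `uniformVertex` applies a function of a natural number to a
distribution on `Fin k`. This coerced distribution is what appears after unfolding. -/
theorem mean_natCast {k : ℕ} (p : PMF (Fin k)) (f : ℕ → ℝ≥0∞) :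
    mean (do let a ← p; pure (a : ℕ)) f = mean p fun a => f a := by
  change mean (p.bind fun a => PMF.pure (a : ℕ)) f = _
  rw [mean_bind]
  simp [mean_pure]

/-- Positivity of `N` is essential: the command draws from `Fin (N - 1 + 1)`, which for `N = 0` is a
one-point set. -/
theorem mean_random {r N : ℕ} {e : Expr} {σ : State} (hN : ⌊e.eval σ⌋₊ = N) (hpos : 0 < N)
    (f : State → ℝ≥0∞) :
    mean ((Cmd.random r e).run G σ) f =
      (∑ i : Fin N, f ((σ.setReg r ((i : ℕ) : ℝ)).tick (e.cost + 1))) / N := by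
  simp only [Cmd.run, mean_map, mean_natCast]
  have : ⌊e.eval σ⌋₊ - 1 + 1 = N := by omega
  simp only [mean_uniform, Fintype.card_fin]
  rw [this]

theorem mean_uniformVertex {r : ℕ} {σ : State} (f : State → ℝ≥0∞) :
    mean ((Cmd.uniformVertex r).run G σ) f =
      (∑ v : Fin n, f ((σ.setReg r ((v : ℕ) : ℝ)).query.tick 1)) / n := by
  simp only [Cmd.run, mean_map, mean_natCast, mean_uniform, Fintype.card_fin]

omit [NeZero n] in
theorem degAnswer_natCast (v : Fin n) : degAnswer G ((v : ℕ) : ℝ) = G.deg v := by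
  simp [degAnswer]

omit [NeZero n] in
theorem nbrAnswer_natCast (v : Fin n) (i : Fin (G.deg v)) :
    nbrAnswer G ((v : ℕ) : ℝ) ((i : ℕ) : ℝ) = ((G.nbr v i : Fin n) : ℕ) := by
  -- The type of the neighbour index depends on the vertex, so the vertex cannot be rewritten in
  -- place; equality of vertices and of index values is generalised first.
  have key : ∀ (u : Fin n) (j : Fin (G.deg u)), u = v → j.1 = i.1 →
      ((G.nbr u j : Fin n) : ℕ) = (G.nbr v i : Fin n) := by
    rintro u j rfl h
    rw [Fin.ext h]
  unfold nbrAnswer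
  have h1 : ⌊((v : ℕ) : ℝ)⌋₊ < n := by simp
  have h2 : (⟨⌊((v : ℕ) : ℝ)⌋₊, h1⟩ : Fin n) = v := by simp
  have h3 : ⌊((i : ℕ) : ℝ)⌋₊ < G.deg ⟨⌊((v : ℕ) : ℝ)⌋₊, h1⟩ := by rw [h2]; simp
  rw [dif_pos h1, dif_pos h3, key _ _ h2 (by simp)]

/-- A quadratic bound for the exponential. -/
theorem exp_le_one_add_add_sq {y : ℝ} (h : |y| ≤ 1) : Real.exp y ≤ 1 + y + y ^ 2 := by
  have := Real.abs_exp_sub_one_sub_id_le h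
  have := (abs_le.1 this).2
  linarith

end EdgeSampling

/-! ### Evaluation and expectation rules for single commands, and one sample of the degree
estimator. -/

namespace EdgeSampling

section Eval

variable (σ : State) (e f : Expr) (k : ℕ)

theorem eval_add : (e + f).eval σ = e.eval σ + f.eval σ := rfl
theorem eval_sub : (e - f).eval σ = e.eval σ - f.eval σ := rfl
theorem eval_mul : (e * f).eval σ = e.eval σ * f.eval σ := rfl
theorem eval_div : (e / f).eval σ = e.eval σ / f.eval σ := rfl
theorem eval_ofNat : (no_index (OfNat.ofNat k) : Expr).eval σ = (k : ℝ) := rfl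
theorem eval_var : (Expr.var k).eval σ = σ.reg k := rfl
theorem eval_load : (Expr.load k e).eval σ = σ.mem k ⌊e.eval σ⌋₊ := rfl
theorem eval_sqrt : e.sqrt.eval σ = Real.sqrt (e.eval σ) := rfl
theorem eval_log : e.log.eval σ = Real.log (e.eval σ) := rfl
theorem eval_ceil : e.ceil.eval σ = (⌈e.eval σ⌉ : ℝ) := rfl
theorem cost_div : (e / f).cost = e.cost + f.cost + 1 := rfl
theorem tick_reg : (σ.tick k).reg = σ.reg := rfl
theorem tick_mem : (σ.tick k).mem = σ.mem := rfl
theorem query_reg : σ.query.reg = σ.reg := rfl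
theorem query_mem : σ.query.mem = σ.mem := rfl
theorem setReg_mem (r : ℕ) (y : ℝ) : (σ.setReg r y).mem = σ.mem := rfl
theorem setReg_reg (r : ℕ) (y : ℝ) : (σ.setReg r y).reg = Function.update σ.reg r y := rfl
theorem setMem_reg (a i : ℕ) (y : ℝ) : (σ.setMem a i y).reg = σ.reg := rfl
theorem setMem_mem (a i : ℕ) (y : ℝ) :
    (σ.setMem a i y).mem = Function.update σ.mem a (Function.update (σ.mem a) i y) := rfl

variable {n : ℕ} [NeZero n] {G : AdjListGraph n}

theorem mean_skip (F : State → ℝ≥0∞) : mean (Cmd.skip.run G σ) F = F (σ.tick 1) := by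
  simp only [Cmd.run, mean_pure]

theorem mean_assign (r : ℕ) (F : State → ℝ≥0∞) :
    mean ((Cmd.assign r e).run G σ) F = F ((σ.setReg r (e.eval σ)).tick (e.cost + 1)) := by
  simp only [Cmd.run, mean_pure]

theorem mean_store (a : ℕ) (F : State → ℝ≥0∞) :
    mean ((Cmd.store a e f).run G σ) F =
      F ((σ.setMem a ⌊e.eval σ⌋₊ (f.eval σ)).tick (e.cost + f.cost + 1)) := by
  simp only [Cmd.run, mean_pure]

theorem mean_degree (r : ℕ) (F : State → ℝ≥0∞) :
    mean ((Cmd.degree r e).run G σ) F =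
      F (((σ.setReg r (degAnswer G (e.eval σ))).query).tick (e.cost + 1)) := by
  simp only [Cmd.run, mean_pure]

theorem mean_neighbor (r : ℕ) (F : State → ℝ≥0∞) :
    mean ((Cmd.neighbor r e f).run G σ) F =
      F (((σ.setReg r (nbrAnswer G (e.eval σ) (f.eval σ))).query).tick
        (e.cost + f.cost + 1)) := by
  simp only [Cmd.run, mean_pure]

theorem mean_seq (c d : Cmd) (F : State → ℝ≥0∞) :
    mean ((Cmd.seq c d).run G σ) F = mean (c.run G σ) fun τ => mean (d.run G τ) F := by
  simp only [Cmd.run, mean_bind]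

theorem mean_ifLe_pos {σ : State} {e f : Expr} (c d : Cmd) (F : State → ℝ≥0∞)
    (h : e.eval σ ≤ f.eval σ) :
    mean ((Cmd.ifLe e f c d).run G σ) F = mean (c.run G (σ.tick (e.cost + f.cost + 1))) F := by
  simp only [Cmd.run, if_pos h]

theorem mean_ifLe_neg {σ : State} {e f : Expr} (c d : Cmd) (F : State → ℝ≥0∞)
    (h : ¬ e.eval σ ≤ f.eval σ) :
    mean ((Cmd.ifLe e f c d).run G σ) F = mean (d.run G (σ.tick (e.cost + f.cost + 1))) F := by
  simp only [Cmd.run, if_neg h]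

end Eval

open _root_.EdgeSampling.Expr _root_.EdgeSampling.Cmd

/-- Sample a vertex `u` and, if its degree is at most the threshold in register `7`, a random
neighbour `w` of `u`. Add `deg u` to register `9`, twice if `deg w` exceeds the threshold. -/
def sampleLight : Cmd := block [
  uniformVertex 10,
  degree 11 (var 10),
  ifLe (var 11) (var 7)
    (block [
      random 14 (var 11),
      neighbor 15 (var 10) (var 14),
      degree 16 (var 15),
      ifLe (var 16) (var 7) (assign 9 (var 9 + var 11)) (assign 9 (var 9 + 2 * var 11))])
    skip]

section SampleLight

variable {n : ℕ} [NeZero n] {G : AdjListGraph n}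

/-- For X = D(1 + h) in [0, 2θ] the quadratic term of the exponential satisfies l²X² ≤ 2θl²X. The
bound thus becomes linear in X, and averaging it needs only the mean of X. -/
theorem exp_weight_le {l θ D h : ℝ} (hl : |l| * (2 * θ) ≤ 1) (hD0 : 0 ≤ D)
    (hD : D ≤ θ) (h0 : 0 ≤ h) (h1 : h ≤ 1) :
    Real.exp (l * (D * (1 + h))) ≤ 1 + (l + 2 * θ * l ^ 2) * (D * (1 + h)) := by
  have hX : D * (1 + h) ≤ 2 * θ := by nlinarith
  have hX0 : 0 ≤ D * (1 + h) := by positivity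
  have hy : |l * (D * (1 + h))| ≤ 1 := by
    rw [abs_mul, abs_of_nonneg hX0]
    exact (mul_le_mul_of_nonneg_left hX (abs_nonneg l)).trans hl
  have := exp_le_one_add_add_sq hy
  nlinarith [mul_nonneg (sq_nonneg l) (mul_nonneg hX0 (sub_nonneg.2 hX))]

theorem mean_addWeight (σ : State) (F : ℝ → ℝ≥0∞) :
    mean ((ifLe (var 16) (var 7) (assign 9 (var 9 + var 11))
      (assign 9 (var 9 + 2 * var 11))).run G σ) (fun τ => F (τ.reg 9)) =
      F (σ.reg 9 + σ.reg 11 * (1 + if σ.reg 16 ≤ σ.reg 7 then 0 else 1)) := by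
  by_cases h : σ.reg 16 ≤ σ.reg 7
  · rw [mean_ifLe_pos _ _ _ (by simpa [eval_var] using h)]
    simp [mean_assign, tick_reg, setReg_reg, eval_add, eval_var, h]
  · rw [mean_ifLe_neg _ _ _ (by simpa [eval_var] using h)]
    simp only [mean_assign, tick_reg, setReg_reg, eval_add, eval_var, eval_mul, eval_ofNat, h,
      Function.update_self, if_false]
    congr 1; push_cast; ring

/-- The moment generating function of one contribution: average the linear bound `exp_weight_le`
over the neighbour and the vertex, then use 1 + y ≤ exp y. Allowing both signs of l serves both
tails. -/
theorem mean_sampleLight_le {l θ : ℝ} {σ : State} (hθ : 0 ≤ θ) (h7 : σ.reg 7 = θ)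
    (hl : |l| * (2 * θ) ≤ 1) :
    mean (sampleLight.run G σ) (fun τ => ENNReal.ofReal (Real.exp (l * τ.reg 9))) ≤
      ENNReal.ofReal (Real.exp (l * σ.reg 9) *
        Real.exp ((l + 2 * θ * l ^ 2) * ((∑ u, G.lightWeight θ u) / n))) := by
  have hn : (0 : ℝ) < n := by exact_mod_cast NeZero.pos n
  set c := l + 2 * θ * l ^ 2 with hc
  have hu : ∀ u : Fin n, mean ((block [degree 11 (var 10), ifLe (var 11) (var 7)
    (block [
      random 14 (var 11),
      neighbor 15 (var 10) (var 14),
      degree 16 (var 15),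
      ifLe (var 16) (var 7) (assign 9 (var 9 + var 11)) (assign 9 (var 9 + 2 * var 11))])
    skip]).run G ((σ.setReg 10 ((u : ℕ) : ℝ)).query.tick 1))
      (fun τ => ENNReal.ofReal (Real.exp (l * τ.reg 9))) ≤
      ENNReal.ofReal (Real.exp (l * σ.reg 9) * (1 + c * G.lightWeight θ u)) := by
    intro u
    simp only [block, mean_seq, mean_degree, eval_var, tick_reg, query_reg, setReg_reg,
      Function.update_self, degAnswer_natCast]
    by_cases hθu : (G.deg u : ℝ) ≤ θ
    · rw [mean_ifLe_pos _ _ _ (by simpa [eval_var, tick_reg, query_reg, setReg_reg, h7] using hθu)]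
      simp only [mean_seq, mean_addWeight _ fun y => ENNReal.ofReal (Real.exp (l * y))]
      -- For an isolated vertex the neighbour query has no meaningful answer, but the added weight
      -- is a multiple of the degree 0, whatever is returned.
      rcases Nat.eq_zero_or_pos (G.deg u) with hd | hd
      · refine mean_le_of_forall_le fun τ hτ => ?_
        have h9 := reg_eq_of_notMem_writes G _ _ τ hτ 9 (by simp [Cmd.writes])
        have h11 := reg_eq_of_notMem_writes G _ _ τ hτ 11 (by simp [Cmd.writes])
        simp [tick_reg, query_reg, setReg_reg] at h9 h11
        have h0 : ∑ i, (1 + G.heavy θ (G.nbr u i)) = 0 := by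
          have : IsEmpty (Fin (G.deg u)) := by rw [hd]; infer_instance
          simp
        simp [mean_neighbor, mean_degree, tick_reg, query_reg, setReg_reg, h9, h11, hd,
          AdjListGraph.lightWeight, h0]
      · have hd' : (0 : ℝ) < G.deg u := by exact_mod_cast hd
        rw [mean_random (N := G.deg u) (by simp [eval_var, tick_reg, query_reg, setReg_reg]) hd]
        simp only [mean_neighbor, mean_degree, eval_var, tick_reg, query_reg, setReg_reg]
        simp only [ne_eq, Nat.reduceEqDiff, not_false_eq_true,
          Function.update_of_ne, Function.update_self, nbrAnswer_natCast, degAnswer_natCast, h7]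
        rw [← ENNReal.ofReal_sum_of_nonneg (fun _ _ => (Real.exp_pos _).le),
          ← ENNReal.ofReal_natCast, ← ENNReal.ofReal_div_of_pos hd']
        refine ENNReal.ofReal_le_ofReal ?_
        rw [div_le_iff₀ hd']
        have : ∀ i : Fin (G.deg u), Real.exp (l * (σ.reg 9 + G.deg u *
            (1 + if (G.deg (G.nbr u i) : ℝ) ≤ θ then 0 else 1))) ≤ Real.exp (l * σ.reg 9) *
            (1 + c * (G.deg u * (1 + G.heavy θ (G.nbr u i)))) := by
          intro i
          rw [mul_add, Real.exp_add]
          exact mul_le_mul_of_nonneg_left (exp_weight_le hl hd'.le hθu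
            (G.heavy_nonneg θ _) (G.heavy_le_one θ _)) (Real.exp_pos _).le
        refine (Finset.sum_le_sum fun i _ => this i).trans_eq ?_
        rw [← Finset.mul_sum, Finset.sum_add_distrib, ← Finset.mul_sum, ← Finset.mul_sum,
          AdjListGraph.lightWeight, if_pos hθu]
        simp only [Finset.sum_const, Finset.card_univ, Fintype.card_fin, nsmul_eq_mul, mul_one]
        ring
    · rw [mean_ifLe_neg _ _ _ (by simpa [eval_var, tick_reg, query_reg, setReg_reg, h7] using hθu)]
      simp [mean_skip, tick_reg, query_reg, setReg_reg, AdjListGraph.lightWeight, hθu]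
  have h1 : ∀ u : Fin n, 0 ≤ Real.exp (l * σ.reg 9) * (1 + c * G.lightWeight θ u) := by
    intro u
    refine mul_nonneg (Real.exp_pos _).le ?_
    have h2 := G.lightWeight_le hθ u
    have h3 := G.lightWeight_nonneg θ u
    have h4 : -|l| ≤ c := by
      have := neg_abs_le l
      have := mul_nonneg hθ (sq_nonneg l)
      linarith
    have := mul_le_mul_of_nonneg_left h2 (abs_nonneg l)
    have := mul_le_mul_of_nonneg_right h4 h3
    linarith
  rw [sampleLight, block, mean_seq, mean_uniformVertex]
  swap
  · simp
  refine (ENNReal.div_le_div_right (Finset.sum_le_sum fun u _ => hu u) _).trans ?_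
  rw [← ENNReal.ofReal_sum_of_nonneg (fun u _ => h1 u),
    ← ENNReal.ofReal_natCast, ← ENNReal.ofReal_div_of_pos hn]
  refine ENNReal.ofReal_le_ofReal ?_
  rw [← Finset.mul_sum, mul_div_assoc, Finset.sum_add_distrib, ← Finset.mul_sum]
  refine mul_le_mul_of_nonneg_left ?_ (Real.exp_pos _).le
  refine le_trans (le_of_eq ?_) (Real.add_one_le_exp _)
  simp
  field_simp
  ring

end SampleLight
end EdgeSampling

/-! ### One round of the search for the average degree. -/

namespace EdgeSampling
open _root_.EdgeSampling.Expr _root_.EdgeSampling.Cmd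

section

variable {n : ℕ} [NeZero n] {G : AdjListGraph n}

theorem support_assign {r : ℕ} {e : Expr} {σ σ' : State}
    (h : σ' ∈ ((Cmd.assign r e).run G σ).support) :
    σ' = (σ.setReg r (e.eval σ)).tick (e.cost + 1) := by
  simpa only [Cmd.run, PMF.mem_support_pure_iff] using h

theorem support_ifLe {e f : Expr} {c d : Cmd} {σ σ' : State}
    (h : σ' ∈ ((Cmd.ifLe e f c d).run G σ).support) :
    (e.eval σ ≤ f.eval σ ∧ σ' ∈ (c.run G (σ.tick (e.cost + f.cost + 1))).support) ∨
    (f.eval σ < e.eval σ ∧ σ' ∈ (d.run G (σ.tick (e.cost + f.cost + 1))).support) := by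
  simp only [Cmd.run] at h
  split_ifs at h with h'
  · exact Or.inl ⟨h', h⟩
  · exact Or.inr ⟨not_le.1 h', h⟩

/-- Independence enters through the potential exp(l · sum + (remaining samples) · c), where exp(c)
bounds the moment generating function of one sample in every reachable state. -/
theorem mean_loop_sampleLight_le {l θ : ℝ} {N : ℕ} {σ : State} (hθ : 0 ≤ θ) (h7 : σ.reg 7 = θ)
    (h8 : σ.reg 8 = N) (hl : |l| * (2 * θ) ≤ 1) :
    mean ((loop 13 (var 8) sampleLight).run G σ)
      (fun τ => ENNReal.ofReal (Real.exp (l * τ.reg 9))) ≤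
      ENNReal.ofReal (Real.exp (l * σ.reg 9 +
        N * ((l + 2 * θ * l ^ 2) * ((∑ u, G.lightWeight θ u) / n)))) := by
  set c := (l + 2 * θ * l ^ 2) * ((∑ u, G.lightWeight θ u) / n) with hc
  have := mean_loop_le (G := G) (r := 13) (e := var 8) (c := sampleLight) (σ := σ) (N := N)
    (fun _ τ => τ.reg 7 = θ)
    (fun k τ => ENNReal.ofReal (Real.exp (l * τ.reg 9 + (N - k) * c))) (by simp [eval_var, h8])
    (by simpa [tick_reg] using h7) ?_ ?_
  · simpa [tick_reg] using this
  · intro k hk τ h7 τ' hτ'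
    rw [reg_eq_of_notMem_writes G _ _ τ' hτ' 7 (by decide)]
    exact h7
  · intro k hk τ h7
    simp only [Real.exp_add, ENNReal.ofReal_mul (Real.exp_pos _).le]
    rw [mean_mul_const]
    refine (mul_le_mul_left (mean_sampleLight_le hθ (σ := (τ.setReg 13 k).tick 1) ?_ hl) _).trans
      (le_of_eq ?_)
    · exact h7
    · simp only [tick_reg, setReg_reg]
      rw [← hc, ← ENNReal.ofReal_mul (by positivity), ← ENNReal.ofReal_mul (by positivity),
        mul_assoc, ← Real.exp_add]
      congr 3
      push_cast; ring_nf

end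

/-- One round of the search for the average degree, with the guess in register `5`. The mean of
the weights of random light edges is compared with the guess; either an estimate is stored in
register `3` and the flag in register `4` is set, or the guess is halved. -/
def searchRound : Cmd := block [
  assign 7 (4 * var 5 * sqrt (var 0 / var 5) / sqrt (var 1)),
  assign 8 (ceil (var 6 * sqrt (var 0 / var 5))),
  assign 9 0,
  loop 13 (var 8) sampleLight,
  ifLe (var 5 * var 8) (var 9)
    (block [assign 3 ((1 - var 1 / 2) * (var 9 / var 8)), assign 4 1])
    (assign 5 (var 5 / 2))]

section

variable {n : ℕ} [NeZero n] {G : AdjListGraph n}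

/-- The state in which the sampling loop of a round starts. -/
noncomputable def roundStart (σ : State) : State :=
  (((σ.setReg 7 (4 * σ.reg 5 * Real.sqrt (σ.reg 0 / σ.reg 5) / Real.sqrt (σ.reg 1))).setReg 8
    (⌈σ.reg 6 * Real.sqrt (σ.reg 0 / σ.reg 5)⌉ : ℝ)).setReg 9 0).tick 22

theorem run_searchRound (σ : State) : searchRound.run G σ =
    (Cmd.seq (loop 13 (var 8) sampleLight) (ifLe (var 5 * var 8) (var 9)
      (block [assign 3 ((1 - var 1 / 2) * (var 9 / var 8)), assign 4 1])
      (assign 5 (var 5 / 2)))).run G (roundStart σ) := by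
  simp only [searchRound, block, Cmd.run, PMF.pure_bind]
  congr 2
  simp [roundStart, eval_mul, eval_div, eval_var, eval_sqrt, eval_ceil, eval_ofNat, State.tick, State.setReg, Expr.cost,
    cost_div]

/-- These facts hold in every run, not only with high probability. They are needed for the
worst-case bounds on time and estimate when the search goes wrong. -/
theorem searchRound_support {σ σ' : State} (h5 : 0 < σ.reg 5)
    (h6 : 0 < σ.reg 6) (h00 : 0 < σ.reg 0) (hε : σ.reg 1 ≤ 2)
    (h : σ' ∈ (searchRound.run G σ).support) :
    (σ'.time : ℝ) ≤ σ.time + 140 + 40 * (σ.reg 6 * Real.sqrt (σ.reg 0 / σ.reg 5)) ∧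
    ((σ'.reg 4 = 1 ∧ σ'.reg 5 = σ.reg 5 ∧ (1 - σ.reg 1 / 2) * σ.reg 5 ≤ σ'.reg 3) ∨
      (σ'.reg 4 = σ.reg 4 ∧ σ'.reg 5 = σ.reg 5 / 2 ∧ σ'.reg 3 = σ.reg 3)) := by
  rw [run_searchRound, mem_support_seq] at h
  obtain ⟨τ, hτ, h⟩ := h
  set X := σ.reg 6 * Real.sqrt (σ.reg 0 / σ.reg 5) with hX
  have hX0 : 0 < X := mul_pos h6 (Real.sqrt_pos.2 (div_pos h00 h5))
  have hN : ⌊(var 8).eval (roundStart σ)⌋₊ = ⌈X⌉₊ := by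
    have : (⌈X⌉ : ℝ) = (⌈X⌉₊ : ℝ) := (natCast_ceil_eq_intCast_ceil hX0.le).symm
    simp [eval_var, roundStart, tick_reg, setReg_reg, ← hX, this]
  have hframe : ∀ r ∈ [0, 1, 3, 4, 5, 6, 8], τ.reg r = (roundStart σ).reg r := by
    intro r hr
    refine reg_eq_of_notMem_writes G _ _ τ hτ r ?_
    revert r; decide
  have h1 : τ.reg 1 = σ.reg 1 := hframe 1 (by decide)
  have h3 : τ.reg 3 = σ.reg 3 := hframe 3 (by decide)
  have h4 : τ.reg 4 = σ.reg 4 := hframe 4 (by decide)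
  have h5' : τ.reg 5 = σ.reg 5 := hframe 5 (by decide)
  have h8 : τ.reg 8 = ⌈X⌉₊ := by
    rw [hframe 8 (by decide), natCast_ceil_eq_intCast_ceil hX0.le]
    simp [roundStart, tick_reg, setReg_reg, ← hX]
  have ht := time_loop_le (b := 40) (by decide) (by decide) hN τ hτ
  have ht2 := time_le_maxCost G _ (by decide) _ _ h
  have hk : (0 : ℝ) < ⌈X⌉₊ := hX0.trans_le (Nat.le_ceil X)
  constructor
  · have : σ'.time ≤ σ.time + 100 + ⌈X⌉₊ * 40 := by
      refine ht2.trans ?_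
      have e1 : (var 8).cost = 1 := rfl
      have e2 : (roundStart σ).time = σ.time + 22 := rfl
      rw [e1, e2] at ht
      have e3 : (ifLe (var 5 * var 8) (var 9)
        (block [assign 3 ((1 - var 1 / 2) * (var 9 / var 8)), assign 4 1])
        (assign 5 (var 5 / 2))).maxCost ≤ 40 := by decide
      omega
    have h2 : (σ'.time : ℝ) ≤ σ.time + 100 + ⌈X⌉₊ * 40 := by exact_mod_cast this
    have := (Nat.ceil_lt_add_one hX0.le).le
    linarith
  · rcases support_ifLe h with ⟨hle, h⟩ | ⟨hlt, h⟩
    · left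
      simp only [block, mem_support_seq] at h
      obtain ⟨τ', hτ', h⟩ := h
      rw [support_assign h, support_assign hτ']
      simp [tick_reg, setReg_reg, eval_sub, eval_mul, eval_div, eval_ofNat, eval_var, h1, h5', h8]
      rw [eval_mul, eval_var, eval_var, eval_var, h5', h8] at hle
      refine mul_le_mul_of_nonneg_left ((le_div_iff₀ hk).2 hle) (by linarith)
    · right
      rw [support_assign h]
      simp [tick_reg, setReg_reg, eval_div, eval_ofNat, eval_var, h3, h4, h5']

end
end EdgeSampling

/-! ### Concentration and correctness of a round. -/

namespace EdgeSampling
open _root_.EdgeSampling.Expr _root_.EdgeSampling.Cmd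

/-- From g ≤ M ≤ d + g/32 follows g ≤ (32/31)d, so the deviation εg/16 is at most εd/15. Hence M
lies between (1 - ε/4 - ε/15)d and (1 + ε/15)d, and the factor 1 - ε/2 moves this range into [(1 -
ε)d, d]. -/
theorem estimate_of_close {ε d g μ M : ℝ} (hε : 0 < ε) (hε2 : ε < 1 / 2) (hd : 0 < d) (hg : 0 < g)
    (hμ : μ ≤ d) (hμ' : (1 - ε / 4) * d ≤ μ) (hM : |M - μ| ≤ ε * g / 16) (hgM : g ≤ M) :
    (1 - ε) * d ≤ (1 - ε / 2) * M ∧ (1 - ε / 2) * M ≤ d := by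
  obtain ⟨h1, h2⟩ := abs_le.1 hM
  have hεg : ε * g ≤ 1 / 2 * g := by nlinarith
  have hgd : g ≤ 32 / 31 * d := by linarith
  have hεgd : ε * g ≤ ε * (32 / 31 * d) := by gcongr
  have hεd : 0 < ε * d := by positivity
  have hεd2 : 0 < ε * (ε * d) := by positivity
  constructor
  · have : (1 - ε / 4) * d - ε * d / 15 ≤ M := by nlinarith
    have := mul_le_mul_of_nonneg_left this (by linarith : 0 ≤ 1 - ε / 2)
    nlinarith
  · have : M ≤ d + ε * d / 15 := by nlinarith
    have := mul_le_mul_of_nonneg_left this (by linarith : 0 ≤ 1 - ε / 2)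
    nlinarith

/-- A mean below the guess certifies that the guess was not too small, so that the halved guess
still exceeds d/4. -/
theorem half_lt_of_close {ε d g μ M : ℝ} (hε2 : ε < 1 / 2) (hd : 0 < d) (hg : 0 < g)
    (hμ' : (1 - ε / 4) * d ≤ μ) (hM : |M - μ| ≤ ε * g / 16) (hgM : M < g) : d / 2 < g := by
  obtain ⟨h1, h2⟩ := abs_le.1 hM
  have hεg : ε * g ≤ 1 / 2 * g := by nlinarith
  have hεd : ε * d ≤ 1 / 2 * d := by nlinarith
  nlinarith

/-- The exponent in the concentration bound for a round. -/
theorem round_exponent_le {ε r g q θ k L l μ : ℝ} (hε : 0 < ε) (hr : 0 < r)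
    (hg : 0 < g) (hq : 0 < q) (hθ : θ = 4 * g * q / r)
    (hk : 2 ^ 15 * L / (ε * ε * r) * q ≤ k) (hl : l = ε * r / (1024 * g * q)) (hμ4 : μ ≤ 4 * g) (hk0 : 0 ≤ k) :
    k * (2 * θ * l ^ 2 * μ - l * (ε * g / 16)) ≤ -L := by
  have hl0 : 0 < l := by rw [hl]; positivity
  -- The choice of l makes 2θl = ε/128. With μ ≤ 4g the second-order term is then at most lεg/32,
  -- half of the gain lεg/16, and the sample size turns the other half into L.
  have h1 : 2 * θ * l ^ 2 * μ = ε / 128 * l * μ := by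
    have : 2 * θ * l = ε / 128 := by rw [hθ, hl]; field_simp; norm_num
    rw [← this]; ring
  have h2 : ε / 128 * l * μ ≤ ε / 128 * l * (4 * g) := by gcongr
  have h3 : k * (2 * θ * l ^ 2 * μ - l * (ε * g / 16)) ≤ k * (-(l * (ε * g / 32))) := by
    refine mul_le_mul_of_nonneg_left ?_ hk0
    rw [h1]; linarith
  have h4 : l * (ε * g / 32) = ε * ε * r / (2 ^ 15 * q) := by
    rw [hl]; field_simp; norm_num
  have h5 : L ≤ k * (ε * ε * r / (2 ^ 15 * q)) := by
    have := mul_le_mul_of_nonneg_right hk (by positivity : 0 ≤ ε * ε * r / (2 ^ 15 * q))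
    refine le_trans (le_of_eq ?_) this
    field_simp
  rw [h4] at h3
  linarith

variable {n : ℕ} [NeZero n] {G : AdjListGraph n}

/-- The lost edges number at most (m/θ)² = (εm/4) · (d/4)/g, which is at most εm/4 because g ≥ d/4.
-/
theorem mean_lightWeight_bounds {ε g θ : ℝ} (hε : 0 < ε) (hg : 0 < g) (hdg : G.davg / 4 ≤ g)
    (hm : 0 < G.m) (hθ : 0 < θ) (hθ2 : θ ^ 2 = 16 * n * g / ε) :
    (∑ u, G.lightWeight θ u) / n ≤ G.davg ∧
      (1 - ε / 4) * G.davg ≤ (∑ u, G.lightWeight θ u) / n := by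
  have hn : (0 : ℝ) < n := by exact_mod_cast NeZero.pos n
  have hd := G.davg_pos hm
  constructor
  · unfold AdjListGraph.davg
    gcongr
    exact G.sum_lightWeight_le θ
  · rw [le_div_iff₀ hn]
    refine le_trans ?_ (G.le_sum_lightWeight θ hθ)
    rw [div_pow, hθ2, ← G.cast_mul_davg]
    have : (n * G.davg) ^ 2 / (16 * n * g / ε) = n * G.davg * ε / 4 * (G.davg / 4 / g) := by
      field_simp; norm_num
    rw [this]
    have h1 : G.davg / 4 / g ≤ 1 := (div_le_one hg).2 hdg
    have := mul_le_mul_of_nonneg_left h1 (by positivity : 0 ≤ n * G.davg * ε / 4)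
    linarith

variable (G) in
/-- The outcome of a round with guess `g` is as intended. -/
def RoundGood (ε g : ℝ) : Set State :=
  {σ | (σ.reg 4 = 1 ∧ σ.reg 5 = g ∧ G.GoodEstimate ε (σ.reg 3)) ∨
    (σ.reg 4 = 0 ∧ σ.reg 5 = g / 2 ∧ G.davg / 2 < g)}

/-- Exponential Markov for both tails of the total weight. The hypothesis g ≥ d/4 is used twice: for
the bias ε/4, and for μ ≤ d ≤ 4g, which controls the second-order term of the exponent. -/
theorem searchRound_prob {ε g L : ℝ} {σ : State} (hm : 0 < G.m) (hε : 0 < ε) (hε2 : ε < 1 / 2)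
    (hg : 0 < g) (hdg : G.davg / 4 ≤ g) (hL : 0 < L) (h0 : σ.reg 0 = n) (h1 : σ.reg 1 = ε)
    (h4 : σ.reg 4 = 0) (h5 : σ.reg 5 = g)
    (h6 : σ.reg 6 = 2 ^ 15 * L / (ε * ε * Real.sqrt ε)) :
    (searchRound.run G σ).toOuterMeasure (RoundGood G ε g)ᶜ ≤
      ENNReal.ofReal (2 * Real.exp (-L)) := by
  have hn : (0 : ℝ) < n := by exact_mod_cast NeZero.pos n
  have hd := G.davg_pos hm
  have hr : 0 < Real.sqrt ε := Real.sqrt_pos.2 hε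
  set q := Real.sqrt (n / g) with hq
  have hq0 : 0 < q := Real.sqrt_pos.2 (by positivity)
  have hq2 : q ^ 2 = n / g := Real.sq_sqrt (by positivity)
  set θ := 4 * g * q / Real.sqrt ε with hθ
  have hθ0 : 0 < θ := by positivity
  have hθ2 : θ ^ 2 = 16 * n * g / ε := by
    rw [hθ, div_pow, mul_pow, hq2, Real.sq_sqrt hε.le]; field_simp; norm_num
  obtain ⟨hμ, hμ'⟩ := mean_lightWeight_bounds hε hg hdg hm hθ0 hθ2
  set μ := (∑ u, G.lightWeight θ u) / n with hμd
  set X := 2 ^ 15 * L / (ε * ε * Real.sqrt ε) * q with hX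
  have hX0 : 0 < X := by positivity
  set k := ⌈X⌉₊ with hk
  have hXk : X ≤ k := Nat.le_ceil X
  have hk0 : (0 : ℝ) < k := hX0.trans_le hXk
  set l := ε * Real.sqrt ε / (1024 * g * q) with hl
  have hl0 : 0 < l := by positivity
  have hlθ : l * (2 * θ) ≤ 1 := by
    have : l * (2 * θ) = ε / 128 := by rw [hθ, hl]; field_simp; norm_num
    rw [this]; linarith
  have hexp := round_exponent_le hε hr hg hq0 hθ hXk hl (by linarith : μ ≤ 4 * g) hk0.le
  have hs8 : (roundStart σ).reg 8 = k := by
    rw [hk, natCast_ceil_eq_intCast_ceil hX0.le]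
    simp [roundStart, tick_reg, setReg_reg, h0, h5, h6, ← hq, ← hX]
  have hs7 : (roundStart σ).reg 7 = θ := by
    simp [roundStart, tick_reg, setReg_reg, h0, h5, h1, ← hq, ← hθ]
  have hs9 : (roundStart σ).reg 9 = 0 := by
    simp [roundStart, tick_reg, setReg_reg]
  have hup := mean_loop_sampleLight_le (G := G) (l := l) hθ0.le hs7 hs8
    (by rwa [abs_of_pos hl0])
  have hlo := mean_loop_sampleLight_le (G := G) (l := -l) hθ0.le hs7 hs8
    (by rwa [abs_neg, abs_of_pos hl0])
  rw [hs9, ← hμd] at hup hlo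
  rw [run_searchRound, toOuterMeasure_eq_mean, mean_seq]
  set b := k * (ε * g / 16) with hb
  have hbound : ∀ τ ∈ ((loop 13 (var 8) sampleLight).run G (roundStart σ)).support,
      mean ((ifLe (var 5 * var 8) (var 9)
        (block [assign 3 ((1 - var 1 / 2) * (var 9 / var 8)), assign 4 1])
        (assign 5 (var 5 / 2))).run G τ) ((RoundGood G ε g)ᶜ.indicator 1) ≤
      ENNReal.ofReal (Real.exp (l * τ.reg 9)) * ENNReal.ofReal (Real.exp (-(l * (k * μ + b)))) +
      ENNReal.ofReal (Real.exp (-l * τ.reg 9)) *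
        ENNReal.ofReal (Real.exp (l * (k * μ - b))) := by
    intro τ hτ
    have hframe : ∀ r ∈ [0, 1, 3, 4, 5, 6, 8], τ.reg r = (roundStart σ).reg r := by
      intro r hr
      refine reg_eq_of_notMem_writes G _ _ τ hτ r ?_
      revert r; decide
    have f1 : τ.reg 1 = ε := (hframe 1 (by decide)).trans h1
    have f4 : τ.reg 4 = 0 := (hframe 4 (by decide)).trans h4
    have f5 : τ.reg 5 = g := (hframe 5 (by decide)).trans h5
    have f8 : τ.reg 8 = k := (hframe 8 (by decide)).trans hs8
    rw [← ENNReal.ofReal_mul (Real.exp_pos _).le, ← ENNReal.ofReal_mul (Real.exp_pos _).le,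
      ← Real.exp_add, ← Real.exp_add]
    -- If the total weight deviates by at most b, the outcome is certainly as intended. Otherwise
    -- one of the two exponential terms on the right is at least 1.
    by_cases hclose : |τ.reg 9 - k * μ| ≤ b
    · have hM : |τ.reg 9 / k - μ| ≤ ε * g / 16 := by
        have : τ.reg 9 / k - μ = (τ.reg 9 - k * μ) / k := by field_simp
        rw [this, abs_div, abs_of_pos hk0, div_le_iff₀ hk0]
        linarith
      refine (le_of_eq ?_).trans zero_le
      by_cases hle : g * k ≤ τ.reg 9
      · have := estimate_of_close hε hε2 hd hg hμ hμ' hM ((le_div_iff₀ hk0).2 hle)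
        rw [mean_ifLe_pos _ _ _ (by simpa [eval_mul, eval_var, f5, f8] using hle)]
        simp only [block, mean_seq, mean_assign]
        rw [Set.indicator_of_notMem]
        simp only [Set.mem_compl_iff, not_not]
        left
        simp [tick_reg, setReg_reg, eval_sub, eval_mul, eval_div, eval_ofNat, eval_var, f1, f5, f8]
        exact this
      · have := half_lt_of_close hε2 hd hg hμ' hM ((div_lt_iff₀ hk0).2 (not_le.1 hle))
        rw [mean_ifLe_neg _ _ _ (by simpa [eval_mul, eval_var, f5, f8] using hle)]
        simp only [mean_assign]
        rw [Set.indicator_of_notMem]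
        simp only [Set.mem_compl_iff, not_not]
        right
        simpa [tick_reg, setReg_reg, eval_div, eval_ofNat, eval_var, f4, f5] using this
    · refine (mean_le_of_forall_le (c := 1) fun a _ => ?_).trans ?_
      · by_cases ha : a ∈ RoundGood G ε g <;> simp [ha]
      · rw [abs_le, not_and_or, not_le, not_le] at hclose
        rcases hclose with h | h
        · refine le_trans ?_ (le_add_left le_rfl)
          rw [ENNReal.one_le_ofReal]
          refine Real.one_le_exp ?_
          have := mul_nonneg hl0.le (by linarith : 0 ≤ k * μ - b - τ.reg 9)
          linarith
        · refine le_trans ?_ (le_add_right le_rfl)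
          rw [ENNReal.one_le_ofReal]
          refine Real.one_le_exp ?_
          have := mul_nonneg hl0.le (by linarith : 0 ≤ τ.reg 9 - k * μ - b)
          linarith
  refine (mean_mono hbound).trans ?_
  rw [mean_add, mean_mul_const, mean_mul_const, two_mul,
    ENNReal.ofReal_add (Real.exp_pos _).le (Real.exp_pos _).le]
  refine add_le_add ?_ ?_
  · refine (mul_le_mul_left hup _).trans ?_
    rw [← ENNReal.ofReal_mul (Real.exp_pos _).le, ← Real.exp_add]
    refine ENNReal.ofReal_le_ofReal (Real.exp_le_exp.2 ?_)
    refine le_trans (le_of_eq ?_) hexp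
    rw [hb]; ring
  · refine (mul_le_mul_left hlo _).trans ?_
    rw [← ENNReal.ofReal_mul (Real.exp_pos _).le, ← Real.exp_add]
    refine ENNReal.ofReal_le_ofReal (Real.exp_le_exp.2 ?_)
    refine le_trans (le_of_eq ?_) hexp
    rw [hb]; ring

end EdgeSampling

/-! ### The geometric search over the guesses. -/

namespace EdgeSampling
open _root_.EdgeSampling.Expr _root_.EdgeSampling.Cmd

/-- Estimate the average degree on input `(n, ε, δ)` by a geometric search. -/
def estimateDegree : Cmd := block [
  assign 3 (1 / var 0),
  assign 4 0,
  assign 5 (var 0),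
  assign 6 (32768 * (8 * log (var 0 / var 2)) / (var 1 * var 1 * sqrt (var 1))),
  loop 12 (ceil (3 * log (var 0)) + 3) (ifLe (var 4) 0 searchRound skip),
  assign 0 (var 3)]

/-- The number of rounds of the search. -/
noncomputable def numRounds (n : ℕ) : ℕ := ⌈3 * Real.log n⌉₊ + 3

/-- The number of samples of a round is this quantity times `√(n / g)` for the guess `g`. -/
noncomputable def roundFactor (n : ℕ) (ε δ : ℝ) : ℝ :=
  2 ^ 15 * (8 * Real.log (n / δ)) / (ε * ε * Real.sqrt ε)

section Numeric

variable {n : ℕ}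

theorem numRounds_le (n : ℕ) : (numRounds n : ℝ) ≤ 3 * Real.log n + 4 := by
  have : (0 : ℝ) ≤ 3 * Real.log n := by positivity
  have := (Nat.ceil_lt_add_one this).le
  unfold numRounds
  push_cast
  linarith

/-- Keeps the last guess polynomially large, at least 1/(16n²), which bounds the worst case of the
search. -/
theorem two_pow_numRounds_le (hn : 1 ≤ n) : (2 : ℝ) ^ numRounds n ≤ 16 * (n : ℝ) ^ 3 := by
  have hn0 : (0 : ℝ) < n := by exact_mod_cast hn
  have hlog : 0 ≤ Real.log n := Real.log_natCast_nonneg n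
  have h1 := numRounds_le n
  have h2 : Real.log 2 ≤ 1 := by linarith [Real.log_two_lt_d9]
  have h3 : 0 < Real.log 2 := Real.log_pos (by norm_num)
  rw [← Real.log_le_log_iff (by positivity) (by positivity), Real.log_pow,
    Real.log_mul (by norm_num) (by positivity), Real.log_pow,
    show (16 : ℝ) = 2 ^ 4 by norm_num, Real.log_pow]
  push_cast
  nlinarith

/-- Enough rounds for the guess to fall below 1/(4n) ≤ d/4; the factor 3 in front of log n suffices
because 3 log 2 > 2. -/
theorem le_two_pow_numRounds (hn : 1 ≤ n) : 8 * (n : ℝ) ^ 2 ≤ (2 : ℝ) ^ numRounds n := by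
  have hn0 : (0 : ℝ) < n := by exact_mod_cast hn
  have hlog : 0 ≤ Real.log n := Real.log_natCast_nonneg n
  have h1 : 3 * Real.log n + 3 ≤ numRounds n := by
    have := Nat.le_ceil (3 * Real.log n)
    unfold numRounds
    push_cast
    linarith
  have h3 : 0.69 < Real.log 2 := by linarith [Real.log_two_gt_d9]
  rw [← Real.log_le_log_iff (by positivity) (by positivity), Real.log_pow,
    Real.log_mul (by norm_num) (by positivity), Real.log_pow,
    show (8 : ℝ) = 2 ^ 3 by norm_num, Real.log_pow]
  push_cast
  nlinarith

/-- The factor 8 in the exponent gives a decay of n⁻⁸. Four powers absorb the number of rounds, and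
the other four are kept to pay for the n³ in the worst-case running time. -/
theorem numRounds_mul_exp_le {δ : ℝ} (hn : 2 ≤ n) (hδ : 0 < δ) (hδ1 : δ ≤ 1) :
    numRounds n * (2 * Real.exp (-(8 * Real.log (n / δ)))) ≤ δ / n ^ 4 := by
  have hn2 : (2 : ℝ) ≤ n := by exact_mod_cast hn
  have hn0 : (0 : ℝ) < n := by linarith
  have h1 : (numRounds n : ℝ) ≤ 3 * n + 1 := by
    have := numRounds_le n
    have := Real.log_le_sub_one_of_pos hn0
    linarith
  have h2 : Real.exp (-(8 * Real.log (n / δ))) = δ ^ 8 / n ^ 8 := by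
    rw [show -(8 * Real.log (n / δ)) = Real.log (((n : ℝ) / δ)⁻¹ ^ 8) by
      rw [Real.log_pow, Real.log_inv]; push_cast; ring, Real.exp_log (by positivity)]
    rw [inv_div, div_pow]
  have h3 : δ ^ 8 ≤ δ := pow_le_of_le_one hδ.le hδ1 (by norm_num)
  have h4 : 2 * (3 * (n : ℝ) + 1) ≤ n ^ 4 := by
    have : (8 : ℝ) ≤ n ^ 3 := by
      calc (8 : ℝ) = 2 ^ 3 := by norm_num
        _ ≤ n ^ 3 := by gcongr
    nlinarith
  rw [h2]
  calc numRounds n * (2 * (δ ^ 8 / (n : ℝ) ^ 8)) ≤ (3 * n + 1) * (2 * (δ / (n : ℝ) ^ 8)) := by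
        gcongr
    _ = 2 * (3 * n + 1) * (δ / (n : ℝ) ^ 8) := by ring
    _ ≤ n ^ 4 * (δ / (n : ℝ) ^ 8) := by gcongr
    _ = δ / n ^ 4 := by field_simp

end Numeric

section

variable {n : ℕ} [NeZero n] {G : AdjListGraph n}

/-- The state in which the search loop starts. -/
noncomputable def searchStart (σ : State) : State :=
  ((((σ.setReg 3 (1 / σ.reg 0)).setReg 4 0).setReg 5 (σ.reg 0)).setReg 6
    (32768 * (8 * Real.log (σ.reg 0 / σ.reg 2)) /
      (σ.reg 1 * σ.reg 1 * Real.sqrt (σ.reg 1)))).tick 24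

theorem run_estimateDegree (σ : State) : estimateDegree.run G σ =
    (Cmd.seq (loop 12 (ceil (3 * log (var 0)) + 3) (ifLe (var 4) 0 searchRound skip))
      (assign 0 (var 3))).run G (searchStart σ) := by
  simp only [estimateDegree, block, Cmd.run, PMF.pure_bind]
  congr 2
  simp [searchStart, eval_mul, eval_div, eval_var, eval_sqrt, eval_log, eval_ofNat,
    State.tick, State.setReg, Expr.cost, cost_div]

/-- The invariant of the search after `j` rounds. -/
def SearchInv (n : ℕ) (ε K T : ℝ) (j : ℕ) (τ : State) : Prop :=
  τ.reg 0 = n ∧ τ.reg 1 = ε ∧ τ.reg 6 = K ∧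
    ((τ.reg 4 = 0 ∧ τ.reg 5 = n / 2 ^ j ∧ τ.reg 3 = 1 / n ∧
      τ.time ≤ T + 160 * j + 120 * (K * Real.sqrt (n / τ.reg 5))) ∨
    (τ.reg 4 = 1 ∧ 3 / 4 * τ.reg 5 ≤ τ.reg 3 ∧ n / 2 ^ j ≤ τ.reg 5 ∧
      τ.time ≤ T + 160 * j + 160 * (K * Real.sqrt (n / τ.reg 5))))

/-- While the search runs, its cost so far is at most 120K√(n/g) plus a constant per round. A round
costs 40K√(n/g) more, giving 160K√(n/g), which is either final or charged to the next guess. -/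
theorem searchInv_step {ε K T : ℝ} {j : ℕ} {τ τ' : State} (hε : ε ≤ 1 / 2) (hK : 0 < K)
    (h : SearchInv n ε K T j τ)
    (hτ' : τ' ∈ ((ifLe (var 4) 0 searchRound skip).run G ((τ.setReg 12 j).tick 1)).support) :
    SearchInv n ε K T (j + 1) τ' := by
  have hn : (0 : ℝ) < n := by exact_mod_cast NeZero.pos n
  obtain ⟨h0, h1, h6, h⟩ := h
  have hf := reg_eq_of_notMem_writes G _ _ τ' hτ'
  have f0 : τ'.reg 0 = n := (hf 0 (by decide)).trans h0
  have f1 : τ'.reg 1 = ε := (hf 1 (by decide)).trans h1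
  have f6 : τ'.reg 6 = K := (hf 6 (by decide)).trans h6
  refine ⟨f0, f1, f6, ?_⟩
  rcases h with ⟨h4, h5, h3, ht⟩ | ⟨h4, h3, h5, ht⟩
  · rcases support_ifLe hτ' with ⟨-, hτ'⟩ | ⟨hlt, -⟩
    · have hg : 0 < τ.reg 5 := by rw [h5]; positivity
      have hs := searchRound_support (by simpa [tick_reg, setReg_reg] using hg)
        (by simpa [tick_reg, setReg_reg, h6] using hK)
        (by simpa [tick_reg, setReg_reg, h0] using hn)
        (by simp [tick_reg, setReg_reg, h1]; linarith) hτ'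
      obtain ⟨ht', hs⟩ := hs
      have e : ((((τ.setReg 12 j).tick 1).tick ((var 4).cost + cost 0 + 1)).time : ℝ) =
        τ.time + 4 := by
        have : (((τ.setReg 12 j).tick 1).tick ((var 4).cost + cost 0 + 1)).time = τ.time + 4 := rfl
        rw [this]; push_cast; rfl
      rw [e] at ht'
      simp only [tick_reg, setReg_reg, ne_eq, OfNat.one_ne_ofNat, Nat.reduceEqDiff,
        not_false_eq_true, Function.update_of_ne, OfNat.zero_ne_ofNat, h0, h1, h6] at ht' hs
      have hq : 0 < K * Real.sqrt (n / τ.reg 5) :=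
        mul_pos hK (Real.sqrt_pos.2 (div_pos hn hg))
      rcases hs with ⟨s4, s5, s3⟩ | ⟨s4, s5, s3⟩
      · right
        refine ⟨s4, ?_, ?_, ?_⟩
        · rw [s5]
          exact le_trans (mul_le_mul_of_nonneg_right (by linarith) hg.le) s3
        · rw [s5, h5]
          exact div_le_div_of_nonneg_left hn.le (by positivity)
            (pow_le_pow_right₀ (by norm_num) (Nat.le_succ j))
        · rw [s5]; push_cast; linarith
      · left
        refine ⟨s4.trans h4, ?_, s3.trans h3, ?_⟩
        · rw [s5, h5, pow_succ]; field_simp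
        -- Halving the guess multiplies the root by √2 ≥ 4/3, and 120 · 4/3 = 160: the geometric
        -- series in potential form.
        · have : 4 / 3 * Real.sqrt (n / τ.reg 5) ≤ Real.sqrt (n / τ'.reg 5) := by
            refine Real.le_sqrt_of_sq_le ?_
            rw [mul_pow, Real.sq_sqrt (by positivity), s5]
            have : n / (τ.reg 5 / 2) = 2 * (n / τ.reg 5) := by field_simp
            rw [this]
            have : 0 < n / τ.reg 5 := by positivity
            linarith
          have := mul_le_mul_of_nonneg_left this hK.le
          push_cast; linarith
    · simp [eval_var, tick_reg, setReg_reg, eval_ofNat, h4] at hlt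
  · rcases support_ifLe hτ' with ⟨hle, -⟩ | ⟨-, hτ'⟩
    · simp [eval_var, tick_reg, setReg_reg, eval_ofNat, h4] at hle
      norm_num at hle
    · right
      simp only [Cmd.run, PMF.mem_support_pure_iff] at hτ'
      have e : (τ'.time : ℝ) = τ.time + 5 := by
        have : τ'.time = τ.time + 5 := by rw [hτ']; rfl
        rw [this]; push_cast; rfl
      have e5 : τ'.reg 5 = τ.reg 5 := by rw [hτ']; simp [tick_reg, setReg_reg]
      refine ⟨?_, ?_, ?_, ?_⟩
      · rw [hτ']; simpa [tick_reg, setReg_reg] using h4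
      · rw [hτ']; simpa [tick_reg, setReg_reg] using h3
      · rw [e5]
        refine le_trans ?_ h5
        exact div_le_div_of_nonneg_left hn.le (by positivity)
          (pow_le_pow_right₀ (by norm_num) (Nat.le_succ j))
      · rw [e, e5]; push_cast; linarith

variable (G) in
/-- The states of the search that are as intended. -/
def SearchGood (ε : ℝ) : Set State :=
  {τ | G.davg / 4 ≤ τ.reg 5 ∧ (τ.reg 4 = 1 → G.GoodEstimate ε (τ.reg 3))}

/-- A good outcome of a round preserves `SearchGood`: either a good estimate is fixed with the guess
unchanged, or g > d/2 and the new guess g/2 is above d/4. Once the flag is set nothing changes any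
more. -/
theorem searchGood_step {ε L T : ℝ} {j : ℕ} {τ : State} (hm : 0 < G.m) (hε : 0 < ε)
    (hε2 : ε < 1 / 2) (hL : 0 < L)
    (h : SearchInv n ε (2 ^ 15 * L / (ε * ε * Real.sqrt ε)) T j τ) (hg : τ ∈ SearchGood G ε) :
    ((ifLe (var 4) 0 searchRound skip).run G ((τ.setReg 12 j).tick 1)).toOuterMeasure
      (SearchGood G ε)ᶜ ≤ ENNReal.ofReal (2 * Real.exp (-L)) := by
  have hn : (0 : ℝ) < n := by exact_mod_cast NeZero.pos n
  have hd := G.davg_pos hm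
  obtain ⟨h0, h1, h6, h⟩ := h
  rw [toOuterMeasure_eq_mean]
  rcases h with ⟨h4, h5, -, -⟩ | ⟨h4, -, -, -⟩
  · rw [mean_ifLe_pos _ _ _ (by simp [eval_var, tick_reg, setReg_reg, eval_ofNat, h4]),
      ← toOuterMeasure_eq_mean]
    have hg5 : 0 < τ.reg 5 := by rw [h5]; positivity
    refine le_trans ?_ (searchRound_prob (g := τ.reg 5)
      (σ := ((τ.setReg 12 j).tick 1).tick ((var 4).cost + cost 0 + 1)) hm hε hε2 hg5 hg.1 hL ?_ ?_ ?_ ?_ ?_)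
    · refine PMF.toOuterMeasure_mono _ fun τ' hτ' => ?_
      rintro (⟨s4, s5, s3⟩ | ⟨s4, s5, s3⟩) <;> refine hτ'.1 ⟨?_, ?_⟩
      · rw [s5]; exact hg.1
      · intro _; exact s3
      · rw [s5]; linarith
      · intro h; rw [s4] at h; norm_num at h
    all_goals simp [tick_reg, setReg_reg, h0, h1, h4, h6]
  · rw [mean_ifLe_neg _ _ _ (by simp [eval_var, tick_reg, setReg_reg, eval_ofNat, h4]),
      mean_skip, Set.indicator_of_notMem]
    · exact zero_le
    · simp only [Set.mem_compl_iff, not_not]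
      exact ⟨by simpa [tick_reg, setReg_reg] using hg.1, by
        simpa [tick_reg, setReg_reg] using hg.2⟩

omit [NeZero n] in
theorem searchInv_start {ε δ : ℝ} (hK : 0 ≤ roundFactor n ε δ) : SearchInv n ε (roundFactor n ε δ) 60 0
    ((searchStart (State.init [(n : ℝ), ε, δ])).tick
      ((ceil (3 * log (var 0)) + 3).cost + 1)) ∧
    ⌊(ceil (3 * log (var 0)) + 3).eval (searchStart (State.init [(n : ℝ), ε, δ]))⌋₊ =
      numRounds n := by
  constructor
  · refine ⟨?_, ?_, ?_, Or.inl ⟨?_, ?_, ?_, ?_⟩⟩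
    · simp [searchStart, tick_reg, setReg_reg, State.init]
    · simp [searchStart, tick_reg, setReg_reg, State.init]
    · simp [searchStart, tick_reg, setReg_reg, State.init, roundFactor]; norm_num
    · simp [searchStart, tick_reg, setReg_reg, State.init]
    · simp [searchStart, tick_reg, setReg_reg, State.init]
    · simp [searchStart, tick_reg, setReg_reg, State.init]
    · have e : ((searchStart (State.init [(n : ℝ), ε, δ])).tick
          ((ceil (3 * log (var 0)) + 3).cost + 1)).time = 32 := rfl
      rw [e]
      have := mul_nonneg hK (Real.sqrt_nonneg (n / ((searchStart (State.init [(n : ℝ), ε, δ])).tick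
          ((ceil (3 * log (var 0)) + 3).cost + 1)).reg 5))
      push_cast
      linarith
  · have h : (0 : ℝ) ≤ 3 * Real.log n := by positivity
    have e : (ceil (3 * log (var 0)) + 3).eval (searchStart (State.init [(n : ℝ), ε, δ])) =
        ((numRounds n : ℕ) : ℝ) := by
      unfold numRounds
      rw [eval_add, eval_ceil, eval_mul, eval_log, eval_var, Nat.cast_add,
        natCast_ceil_eq_intCast_ceil h]
      simp [searchStart, tick_reg, setReg_reg, State.init, eval_ofNat]
    rw [e, Nat.floor_natCast]

theorem roundFactor_pos {ε δ : ℝ} (hε : 0 < ε) (hδ : 0 < δ) (hδ1 : δ < 1) :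
    0 < roundFactor n ε δ := by
  have hn : (1 : ℝ) ≤ n := by exact_mod_cast NeZero.pos n
  have hr := Real.sqrt_pos.2 hε
  have : 0 < Real.log (n / δ) := Real.log_pos ((one_lt_div hδ).2 (by linarith))
  unfold roundFactor
  positivity

theorem searchInv_of_mem_support {ε δ : ℝ} (hε : 0 < ε) (hε2 : ε < 1 / 2)
    (hδ : 0 < δ) (hδ1 : δ < 1) {τ : State}
    (h : τ ∈ ((loop 12 (ceil (3 * log (var 0)) + 3) (ifLe (var 4) 0 searchRound skip)).run G
      (searchStart (State.init [(n : ℝ), ε, δ]))).support) :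
    SearchInv n ε (roundFactor n ε δ) 60 (numRounds n) τ := by
  have hK := roundFactor_pos (n := n) hε hδ hδ1
  obtain ⟨h0, hN⟩ := searchInv_start (n := n) hK.le
  exact loop_invariant (SearchInv n ε (roundFactor n ε δ) 60) hN h0
    (fun k _ τ hτ τ' hτ' => searchInv_step hε2.le hK hτ hτ') τ h

/-- The deterministic counterpart of `estimateDegree_prob`. Even a wrong estimate is at least of
order n⁻², because no guess falls below n / 2 ^ `numRounds n`, so all later costs stay polynomial in
n. -/
theorem estimateDegree_support {ε δ : ℝ} (hε : 0 < ε) (hε2 : ε < 1 / 2)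
    (hδ : 0 < δ) (hδ1 : δ < 1) {σ' : State}
    (h : σ' ∈ (estimateDegree.run G (State.init [(n : ℝ), ε, δ])).support) :
    1 / (32 * (n : ℝ) ^ 2) ≤ σ'.reg 0 ∧
      σ'.time ≤ 62 + 160 * (numRounds n : ℝ) + 160 * (roundFactor n ε δ * (4 * (n : ℝ) ^ 2)) := by
  have hn1 : 1 ≤ n := NeZero.pos n
  have hn : (1 : ℝ) ≤ n := by exact_mod_cast hn1
  have hK := roundFactor_pos (n := n) hε hδ hδ1
  rw [run_estimateDegree, mem_support_seq] at h
  obtain ⟨τ, hτ, h⟩ := h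
  obtain ⟨-, -, -, hI⟩ := searchInv_of_mem_support hε hε2 hδ hδ1 hτ
  have e0 : σ'.reg 0 = τ.reg 3 := by
    rw [support_assign h]; simp [tick_reg, setReg_reg, eval_var]
  have et : (σ'.time : ℝ) = τ.time + 2 := by
    have : σ'.time = τ.time + 2 := by rw [support_assign h]; rfl
    rw [this]; push_cast; rfl
  have hg : 1 / (16 * (n : ℝ) ^ 2) ≤ n / 2 ^ numRounds n := by
    have := two_pow_numRounds_le (n := n) hn1
    rw [div_le_div_iff₀ (by positivity) (by positivity)]
    nlinarith
  have hg5 : 1 / (16 * (n : ℝ) ^ 2) ≤ τ.reg 5 := by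
    rcases hI with ⟨-, h5, -, -⟩ | ⟨-, -, h5, -⟩
    · rwa [h5]
    · exact hg.trans h5
  have hsq : Real.sqrt (n / τ.reg 5) ≤ 4 * (n : ℝ) ^ 2 := by
    refine Real.sqrt_le_iff.2 ⟨by positivity, ?_⟩
    have h5 : 0 < τ.reg 5 := lt_of_lt_of_le (by positivity) hg5
    rw [div_le_iff₀ h5]
    have h1 : (4 * (n : ℝ) ^ 2) ^ 2 * (1 / (16 * (n : ℝ) ^ 2)) ≤ (4 * (n : ℝ) ^ 2) ^ 2 * τ.reg 5 := by
      gcongr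
    have h2 : (4 * (n : ℝ) ^ 2) ^ 2 * (1 / (16 * (n : ℝ) ^ 2)) = n ^ 2 := by field_simp; norm_num
    nlinarith
  have hKs := mul_le_mul_of_nonneg_left hsq hK.le
  have hKs0 := mul_nonneg hK.le (Real.sqrt_nonneg (n / τ.reg 5))
  rw [e0, et]
  rcases hI with ⟨-, h5, h3, ht⟩ | ⟨-, h3, h5, ht⟩
  · refine ⟨?_, by linarith⟩
    rw [h3]
    refine one_div_le_one_div_of_le (by linarith) ?_
    nlinarith
  · refine ⟨?_, by linarith⟩
    have : 1 / (32 * (n : ℝ) ^ 2) = 1 / 2 * (1 / (16 * (n : ℝ) ^ 2)) := by field_simp; norm_num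
    have : 0 < 1 / (16 * (n : ℝ) ^ 2) := by positivity
    linarith

/-- The union bound over the rounds, with potential "no longer good" plus p times the number of
rounds left. -/
theorem mean_searchGood_le {ε δ : ℝ} (hm : 0 < G.m) (hε : 0 < ε) (hε2 : ε < 1 / 2)
    (hδ : 0 < δ) (hδ1 : δ < 1) :
    ((loop 12 (ceil (3 * log (var 0)) + 3) (ifLe (var 4) 0 searchRound skip)).run G
      (searchStart (State.init [(n : ℝ), ε, δ]))).toOuterMeasure (SearchGood G ε)ᶜ ≤
      ENNReal.ofReal (δ / n ^ 4) := by
  have hn2 := G.two_le_of_m_pos hm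
  have hn : (1 : ℝ) ≤ n := by exact_mod_cast NeZero.pos n
  have hK := roundFactor_pos (n := n) hε hδ hδ1
  obtain ⟨h0, hN⟩ := searchInv_start (n := n) hK.le
  set p := ENNReal.ofReal (2 * Real.exp (-(8 * Real.log (n / δ)))) with hp
  have hL : 0 < 8 * Real.log (n / δ) :=
    mul_pos (by norm_num) (Real.log_pos ((one_lt_div hδ).2 (by linarith)))
  have key := mean_loop_le (G := G) (SearchInv n ε (roundFactor n ε δ) 60)
    (fun j τ => (SearchGood G ε)ᶜ.indicator 1 τ + ((numRounds n - j : ℕ) : ℝ≥0∞) * p) hN h0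
    (fun k _ τ hτ τ' hτ' => searchInv_step hε2.le hK hτ hτ') ?_
  · simp only [Nat.sub_self, Nat.cast_zero, zero_mul, add_zero] at key
    rw [toOuterMeasure_eq_mean]
    refine key.trans ?_
    rw [Set.indicator_of_notMem, zero_add, hp, Nat.sub_zero, ← ENNReal.ofReal_natCast,
      ← ENNReal.ofReal_mul (Nat.cast_nonneg _)]
    · exact ENNReal.ofReal_le_ofReal (numRounds_mul_exp_le hn2 hδ hδ1.le)
    · simp only [Set.mem_compl_iff, not_not]
      constructor
      · have e5 : ((searchStart (State.init [(n : ℝ), ε, δ])).tick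
          ((ceil (3 * log (var 0)) + 3).cost + 1)).reg 5 = n := by
          simp [searchStart, tick_reg, setReg_reg, State.init]
        rw [e5]
        have := G.davg_le
        linarith
      · intro h
        simp [searchStart, tick_reg, setReg_reg, State.init] at h
  · intro k hk τ hτ
    rw [mean_add, mean_const]
    have hsplit : ((numRounds n - k : ℕ) : ℝ≥0∞) = ((numRounds n - (k + 1) : ℕ) : ℝ≥0∞) + 1 := by
      rw [show numRounds n - k = numRounds n - (k + 1) + 1 by omega]; push_cast; rfl
    rw [hsplit, add_mul, one_mul]
    by_cases hg : τ ∈ SearchGood G ε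
    · have := searchGood_step hm hε hε2 hL hτ hg
      rw [toOuterMeasure_eq_mean] at this
      rw [Set.indicator_of_notMem (by simpa using hg), zero_add, add_comm]
      exact add_le_add le_rfl this
    · rw [Set.indicator_of_mem (by simpa using hg), ← add_assoc]
      refine le_trans ?_ (le_add_right le_rfl)
      refine add_le_add (mean_le_of_forall_le fun a _ => ?_) le_rfl
      by_cases ha : a ∈ SearchGood G ε <;> simp [ha]

/-- The estimate is good and was found fast, except with small probability. -/
theorem estimateDegree_prob {ε δ : ℝ} (hm : 0 < G.m) (hε : 0 < ε) (hε2 : ε < 1 / 2)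
    (hδ : 0 < δ) (hδ1 : δ < 1) :
    (estimateDegree.run G (State.init [(n : ℝ), ε, δ])).toOuterMeasure
      {σ | G.GoodEstimate ε (σ.reg 0) ∧ σ.time ≤ 62 + 160 * (numRounds n : ℝ) +
        320 * (roundFactor n ε δ * Real.sqrt (n / G.davg))}ᶜ ≤ ENNReal.ofReal (δ / n ^ 4) := by
  have hn1 : 1 ≤ n := NeZero.pos n
  have hn : (1 : ℝ) ≤ n := by exact_mod_cast hn1
  have hd := G.davg_pos hm
  have hK := roundFactor_pos (n := n) hε hδ hδ1
  refine le_trans ?_ (mean_searchGood_le hm hε hε2 hδ hδ1)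
  rw [run_estimateDegree, toOuterMeasure_eq_mean, mean_seq, toOuterMeasure_eq_mean]
  refine mean_mono fun τ hτ => ?_
  rw [mean_assign]
  by_cases hg : τ ∈ SearchGood G ε
  swap
  · rw [Set.indicator_of_mem (a := τ) (by simpa using hg)]
    exact Set.indicator_le_self _ _ _
  rw [Set.indicator_of_notMem]
  · exact zero_le
  obtain ⟨-, -, -, hI⟩ := searchInv_of_mem_support hε hε2 hδ hδ1 hτ
  have hg5 := hg.1
  rcases hI with ⟨-, h5, h3, ht⟩ | ⟨h4, h3, h5, ht⟩
  -- Running out of rounds is impossible in a good state: the guess would be n / 2^N with 2^N ≥ 8n²,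
  -- hence below d/4, because d ≥ 1/n.
  · exfalso
    have h1 := le_two_pow_numRounds hn1
    have h2 := G.inv_le_davg hm
    rw [h5, le_div_iff₀ (by positivity)] at hg5
    have h3 : 1 / (n : ℝ) / 4 * (8 * n ^ 2) ≤ G.davg / 4 * 2 ^ numRounds n := by gcongr
    have h4 : 1 / (n : ℝ) / 4 * (8 * n ^ 2) = 2 * n := by field_simp; norm_num
    linarith
  · simp only [Set.mem_compl_iff, not_not]
    constructor
    · simpa [tick_reg, setReg_reg, eval_var] using hg.2 h4
    · have e : (((τ.setReg 0 ((var 3).eval τ)).tick ((var 3).cost + 1)).time : ℝ) = τ.time + 2 := by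
        have : ((τ.setReg 0 ((var 3).eval τ)).tick ((var 3).cost + 1)).time = τ.time + 2 := rfl
        rw [this]; push_cast; rfl
      rw [e]
      have hs : Real.sqrt (n / τ.reg 5) ≤ 2 * Real.sqrt (n / G.davg) := by
        refine Real.sqrt_le_iff.2 ⟨by positivity, ?_⟩
        have h5 : 0 < τ.reg 5 := by linarith
        rw [mul_pow, Real.sq_sqrt (by positivity)]
        have : (2 : ℝ) ^ 2 * (n / G.davg) = n / (G.davg / 4) := by field_simp; norm_num
        rw [this]
        gcongr
      have := mul_le_mul_of_nonneg_left hs hK.le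
      linarith

theorem estimatesAverageDegree_estimateDegree : EstimatesAverageDegree estimateDegree := by
  intro n _ G ε δ hm hε hε2 hδ hδ1
  refine ofReal_one_sub_le_toOuterMeasure hδ.le ?_
  refine (PMF.toOuterMeasure_mono _ fun σ hσ => ?_).trans
    ((estimateDegree_prob hm hε hε2 hδ hδ1).trans (ENNReal.ofReal_le_ofReal ?_))
  · exact fun h => hσ.1 h.1
  · have : (1 : ℝ) ≤ n := by exact_mod_cast NeZero.pos n
    exact div_le_self hδ.le (one_le_pow₀ this)

end
end EdgeSampling

/-! ### Drawing the vertices of one sample. -/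

namespace EdgeSampling
open _root_.EdgeSampling.Expr _root_.EdgeSampling.Cmd

/-- Draw the vertices of one sample. -/
def drawSample : Cmd := loop vJ (var vS) (block [
  uniformVertex vU,
  store aSample (var vI * var vS + var vJ) (var vU)])

/-- Query the degrees of one sample. -/
def queryDegrees : Cmd := loop vJ (var vS) (block [
  degree vD (load aSample (var vI * var vS + var vJ)),
  store aDeg (var vI * var vS + var vJ) (var vD),
  assign vM (var vM + var vD)])

/-- Draw one sample, query its degrees and store their sum. -/
def sampleSet : Cmd := block [drawSample, assign vM 0, queryDegrees, store aSum (var vI) (var vM)]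

theorem sampleSets_eq : sampleSets = loop vI (var vT) sampleSet := rfl

variable {n : ℕ} [NeZero n] {G : AdjListGraph n}

/-- The vertex named by a real number. -/
noncomputable def vertexOf (n : ℕ) [NeZero n] (r : ℝ) : Fin n :=
  if h : ⌊r⌋₊ < n then ⟨⌊r⌋₊, h⟩ else 0

theorem vertexOf_natCast (v : Fin n) : vertexOf n ((v : ℕ) : ℝ) = v := by
  simp [vertexOf]

/-- The vertex in a cell of the array of sampled vertices. -/
noncomputable def cellVertex (n : ℕ) [NeZero n] (σ : State) (c : ℕ) : Fin n :=
  vertexOf n (σ.mem aSample c)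

/-- The `i`-th sample, of size `s`. -/
noncomputable def sampleAt (n : ℕ) [NeZero n] (s : ℕ) (σ : State) (i : ℕ) : Multiset (Fin n) :=
  (Multiset.range s).map fun j => cellVertex n σ (i * s + j)

theorem card_sampleAt (s : ℕ) (σ : State) (i : ℕ) : (sampleAt n s σ i).card = s := by
  simp [sampleAt]

theorem degSum_sampleAt (s : ℕ) (σ : State) (i : ℕ) :
    G.degSum (sampleAt n s σ i) = ∑ j ∈ Finset.range s, G.deg (cellVertex n σ (i * s + j)) := by
  simp only [AdjListGraph.degSum, sampleAt, Multiset.map_map]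
  rfl

omit [NeZero n] in
theorem degInto_eq_sum (S : Multiset (Fin n)) (v : Fin n) :
    (G.degInto S v : ℝ) = (S.map fun u => G.adj v u).sum := by
  classical
  induction S using Multiset.induction_on with
  | empty => simp [AdjListGraph.degInto]
  | cons a S ih =>
    rw [Multiset.map_cons, Multiset.sum_cons, ← ih]
    unfold AdjListGraph.degInto AdjListGraph.adj
    by_cases h : G.graph.Adj v a
    · simp [h, add_comm]
    · simp [h]

theorem degInto_sampleAt (s : ℕ) (σ : State) (i : ℕ) (v : Fin n) :
    (G.degInto (sampleAt n s σ i) v : ℝ) =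
      ∑ j ∈ Finset.range s, G.adj v (cellVertex n σ (i * s + j)) := by
  rw [degInto_eq_sum]
  simp only [sampleAt, Multiset.map_map]
  rfl

theorem sampleAt_congr {s : ℕ} {σ τ : State} {i : ℕ}
    (h : ∀ j < s, τ.mem aSample (i * s + j) = σ.mem aSample (i * s + j)) :
    sampleAt n s τ i = sampleAt n s σ i := by
  unfold sampleAt cellVertex
  exact Multiset.map_congr rfl fun j hj => by rw [h j (Multiset.mem_range.1 hj)]

theorem eval_cell {σ : State} {i s j : ℕ} (hI : σ.reg vI = i) (hS : σ.reg vS = s)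
    (hJ : σ.reg vJ = j) : ⌊(var vI * var vS + var vJ).eval σ⌋₊ = i * s + j := by
  rw [eval_add, eval_mul, eval_var, eval_var, eval_var, hI, hS, hJ]
  exact_mod_cast Nat.floor_natCast (R := ℝ) (i * s + j)

section Draw

variable {i s : ℕ}

/-- The state after one iteration of `drawSample`. -/
noncomputable def drawn (τ : State) (i s j : ℕ) (v : Fin n) : State :=
  (((((τ.setReg vJ j).tick 1).setReg vU ((v : ℕ) : ℝ)).query.tick 1).setMem aSample (i * s + j)
    ((v : ℕ) : ℝ)).tick 7

theorem mean_drawBody {τ : State} (hI : τ.reg vI = i) (hS : τ.reg vS = s) (j : ℕ)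
    (F : State → ℝ≥0∞) :
    mean ((block [uniformVertex vU,
      store aSample (var vI * var vS + var vJ) (var vU)]).run G ((τ.setReg vJ j).tick 1)) F =
      (∑ v : Fin n, F (drawn τ i s j v)) / n := by
  simp only [block, mean_seq, mean_uniformVertex, mean_store]
  congr 1
  refine Finset.sum_congr rfl fun v _ => ?_
  rw [eval_cell (i := i) (s := s) (j := j) (by simpa [tick_reg, query_reg, setReg_reg] using hI)
    (by simpa [tick_reg, query_reg, setReg_reg] using hS)
    (by simp [tick_reg, query_reg, setReg_reg])]
  congr 1

theorem support_drawBody {τ τ' : State} (hI : τ.reg vI = i) (hS : τ.reg vS = s) {j : ℕ}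
    (h : τ' ∈ ((block [uniformVertex vU,
      store aSample (var vI * var vS + var vJ) (var vU)]).run G
        ((τ.setReg vJ j).tick 1)).support) : ∃ v : Fin n, τ' = drawn τ i s j v := by
  -- By `mean_drawBody`, a state that is not of the form `drawn` has probability zero, so it cannot
  -- lie in the support.
  by_contra hne
  push Not at hne
  have h1 : ((block [uniformVertex vU,
      store aSample (var vI * var vS + var vJ) (var vU)]).run G
        ((τ.setReg vJ j).tick 1)).toOuterMeasure {τ'} = 0 := by
    rw [toOuterMeasure_eq_mean, mean_drawBody hI hS]
    simp [fun v => (hne v).symm]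
  rw [PMF.toOuterMeasure_apply_singleton] at h1
  exact h h1

omit [NeZero n] in
theorem drawn_mem_self (τ : State) (j : ℕ) (v : Fin n) :
    (drawn τ i s j v).mem aSample (i * s + j) = ((v : ℕ) : ℝ) := by
  simp [drawn, setReg_mem, setMem_mem, tick_mem, query_mem]

omit [NeZero n] in
theorem drawn_mem_of_ne (τ : State) (j : ℕ) (v : Fin n) {c : ℕ} (hc : c ≠ i * s + j) :
    (drawn τ i s j v).mem aSample c = τ.mem aSample c := by
  simp [drawn, setReg_mem, setMem_mem, tick_mem, query_mem, hc]

omit [NeZero n] in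
theorem drawn_reg (τ : State) (j : ℕ) (v : Fin n) {r : ℕ} (h : r ≠ vJ) (h' : r ≠ vU) :
    (drawn τ i s j v).reg r = τ.reg r := by
  simp [drawn, setReg_reg, setMem_reg, tick_reg, query_reg, h, h']

/-- The rule for a potential of the sampled vertices. -/
theorem mean_drawSample_le {σ : State} (hI : σ.reg vI = i) (hS : σ.reg vS = s)
    (Φ : ℕ → (ℕ → Fin n) → ℝ≥0∞)
    (hΦ : ∀ j < s, ∀ f : ℕ → Fin n,
      (∑ v : Fin n, Φ (j + 1) (Function.update f j v)) / n ≤ Φ j f) :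
    mean (drawSample.run G σ) (fun τ => Φ s fun j => cellVertex n τ (i * s + j)) ≤
      Φ 0 fun j => cellVertex n σ (i * s + j) := by
  refine mean_loop_le (G := G) (fun _ τ => τ.reg vI = i ∧ τ.reg vS = s)
    (fun j τ => Φ j fun j => cellVertex n τ (i * s + j)) (by simp [eval_var, hS])
    ⟨by simpa [tick_reg] using hI, by simpa [tick_reg] using hS⟩ ?_ ?_
  · intro k _ τ hτ τ' hτ'
    obtain ⟨v, rfl⟩ := support_drawBody hτ.1 hτ.2 hτ'
    exact ⟨by rw [drawn_reg _ _ _ (by decide) (by decide), hτ.1],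
      by rw [drawn_reg _ _ _ (by decide) (by decide), hτ.2]⟩
  · intro k hk τ hτ
    rw [mean_drawBody hτ.1 hτ.2]
    refine le_trans (le_of_eq ?_) (hΦ k hk _)
    congr 1
    refine Finset.sum_congr rfl fun v _ => ?_
    congr 1
    funext j
    by_cases hj : j = k
    · subst hj
      simp [cellVertex, drawn_mem_self, vertexOf_natCast]
    · rw [Function.update_of_ne hj, cellVertex, drawn_mem_of_ne _ _ _ (by omega), cellVertex]

/-- Independence of the draws: each new cell contributes a factor with mean at most b, whatever the
earlier cells contain. Applied to exponentials it yields the Chernoff bounds. -/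
theorem mean_drawSample_prod_le {σ : State} (hI : σ.reg vI = i) (hS : σ.reg vS = s)
    (h : Fin n → ℝ≥0∞) {b : ℝ≥0∞} (hb : (∑ v, h v) / n ≤ b) :
    mean (drawSample.run G σ) (fun τ => ∏ j ∈ Finset.range s, h (cellVertex n τ (i * s + j))) ≤
      b ^ s := by
  have := mean_drawSample_le (G := G) hI hS
    (fun k f => (∏ j ∈ Finset.range k, h (f j)) * b ^ (s - k)) ?_
  · simpa using this
  · intro j hj f
    have h1 : ∀ v, ∏ k ∈ Finset.range j, h (Function.update f j v k) =
        ∏ k ∈ Finset.range j, h (f k) := fun v => Finset.prod_congr rfl fun k hk => by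
      rw [Function.update_of_ne (Finset.mem_range.1 hk).ne]
    simp only [Finset.prod_range_succ, h1, Function.update_self]
    rw [← Finset.sum_mul, ← Finset.mul_sum, show s - j = s - (j + 1) + 1 by omega, pow_succ,
      ENNReal.div_eq_inv_mul]
    rw [ENNReal.div_eq_inv_mul] at hb
    calc _ = (∏ k ∈ Finset.range j, h (f k)) * b ^ (s - (j + 1)) * ((n : ℝ≥0∞)⁻¹ * ∑ v, h v) := by
          ring
      _ ≤ (∏ k ∈ Finset.range j, h (f k)) * b ^ (s - (j + 1)) * b := by gcongr
      _ = _ := by ring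

/-- Linearity of expectation, the input for Markov's inequality in `heavySample_le`. -/
theorem mean_drawSample_sum_le {σ : State} (hI : σ.reg vI = i) (hS : σ.reg vS = s)
    (h : Fin n → ℝ≥0∞) {b : ℝ≥0∞} (hb : (∑ v, h v) / n ≤ b) :
    mean (drawSample.run G σ) (fun τ => ∑ j ∈ Finset.range s, h (cellVertex n τ (i * s + j))) ≤
      s * b := by
  have hn : (n : ℝ≥0∞) ≠ 0 := by exact_mod_cast NeZero.ne n
  have := mean_drawSample_le (G := G) hI hS
    (fun k f => (∑ j ∈ Finset.range k, h (f j)) + ((s - k : ℕ) : ℝ≥0∞) * b) ?_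
  · simpa using this
  · intro j hj f
    have h1 : ∀ v, ∑ k ∈ Finset.range j, h (Function.update f j v k) =
        ∑ k ∈ Finset.range j, h (f k) := fun v => Finset.sum_congr rfl fun k hk => by
      rw [Function.update_of_ne (Finset.mem_range.1 hk).ne]
    simp only [Finset.sum_range_succ, h1, Function.update_self, Finset.sum_add_distrib,
      Finset.sum_const, Finset.card_univ, Fintype.card_fin, nsmul_eq_mul]
    rw [show s - j = s - (j + 1) + 1 by omega, ENNReal.add_div, ENNReal.add_div,
      ENNReal.mul_div_right_comm, ENNReal.mul_div_right_comm,
      ENNReal.div_self hn (ENNReal.natCast_ne_top n), one_mul, one_mul, Nat.cast_succ,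
      add_mul, one_mul, add_assoc, add_comm (_ * b) b]
    gcongr

end Draw

end EdgeSampling

/-! ### The effect of drawing one sample on the memory. -/

namespace EdgeSampling
open _root_.EdgeSampling.Expr _root_.EdgeSampling.Cmd

variable {n : ℕ} [NeZero n] {G : AdjListGraph n} {i s : ℕ}

theorem drawSample_support {σ σ' : State} (hI : σ.reg vI = i) (hS : σ.reg vS = s)
    (h : σ' ∈ (drawSample.run G σ).support) :
    (∀ c < i * s, σ'.mem aSample c = σ.mem aSample c) ∧
      (∀ j < s, σ'.mem aSample (i * s + j) = ((cellVertex n σ' (i * s + j) : ℕ) : ℝ)) ∧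
      σ'.time ≤ σ.time + 2 + s * 10 := by
  refine ⟨?_, ?_, time_loop_le (by decide) (by decide) (by simp [eval_var, hS]) σ' h⟩
  all_goals
    have key := loop_invariant (G := G) (N := s)
      (fun j τ => τ.reg vI = i ∧ τ.reg vS = s ∧ (∀ c < i * s, τ.mem aSample c = σ.mem aSample c) ∧
        ∀ k < j, τ.mem aSample (i * s + k) = ((cellVertex n τ (i * s + k) : ℕ) : ℝ))
      (by simp [eval_var, hS]) ⟨hI, hS, fun c _ => rfl, fun k hk => absurd hk (Nat.not_lt_zero k)⟩
      (fun k hk τ hτ τ' hτ' => by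
        obtain ⟨h1, h2, h3, h4⟩ := hτ
        obtain ⟨v, rfl⟩ := support_drawBody h1 h2 hτ'
        refine ⟨by rw [drawn_reg _ _ _ (by decide) (by decide), h1],
          by rw [drawn_reg _ _ _ (by decide) (by decide), h2], fun c hc => ?_, fun j hj => ?_⟩
        · rw [drawn_mem_of_ne _ _ _ (by omega), h3 c hc]
        · rcases Nat.lt_succ_iff_lt_or_eq.1 hj with hj | rfl
          · rw [cellVertex, drawn_mem_of_ne _ _ _ (by omega)]
            exact h4 j hj
          · rw [cellVertex, drawn_mem_self, vertexOf_natCast]) σ' h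
  · exact key.2.2.1
  · exact key.2.2.2

theorem queryDegrees_support {σ σ' : State} (hI : σ.reg vI = i) (hS : σ.reg vS = s)
    (hM : σ.reg vM = 0)
    (hv : ∀ j < s, σ.mem aSample (i * s + j) = ((cellVertex n σ (i * s + j) : ℕ) : ℝ))
    (h : σ' ∈ (queryDegrees.run G σ).support) :
    (∀ c < i * s, σ'.mem aDeg c = σ.mem aDeg c) ∧
      (∀ j < s, σ'.mem aDeg (i * s + j) = G.deg (cellVertex n σ (i * s + j))) ∧
      σ'.reg vM = ((∑ j ∈ Finset.range s, G.deg (cellVertex n σ (i * s + j)) : ℕ) : ℝ) ∧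
      σ'.time ≤ σ.time + 2 + s * 30 := by
  have key := loop_invariant (G := G) (N := s)
    (fun j τ => τ.reg vI = i ∧ τ.reg vS = s ∧ τ.mem aSample = σ.mem aSample ∧
      (∀ c < i * s, τ.mem aDeg c = σ.mem aDeg c) ∧
      (∀ k < j, τ.mem aDeg (i * s + k) = G.deg (cellVertex n σ (i * s + k))) ∧
      τ.reg vM = ((∑ k ∈ Finset.range j, G.deg (cellVertex n σ (i * s + k)) : ℕ) : ℝ))
    (by simp [eval_var, hS])
    ⟨hI, hS, rfl, fun c _ => rfl, fun k hk => absurd hk (Nat.not_lt_zero k), by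
      simpa [tick_reg] using hM⟩
    (fun k hk τ hτ τ' hτ' => by
      obtain ⟨h1, h2, h3, h4, h5, h6⟩ := hτ
      simp only [block, Cmd.run, PMF.pure_bind, PMF.mem_support_pure_iff] at hτ'
      have c1 : ⌊(var vI * var vS + var vJ).eval ((τ.setReg vJ k).tick 1)⌋₊ = i * s + k :=
        eval_cell (by simpa [tick_reg, setReg_reg] using h1)
          (by simpa [tick_reg, setReg_reg] using h2) (by simp [tick_reg, setReg_reg])
      have hd : degAnswer G ((load aSample (var vI * var vS + var vJ)).eval
          ((τ.setReg vJ k).tick 1)) = G.deg (cellVertex n σ (i * s + k)) := by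
        rw [eval_load, c1, tick_mem, setReg_mem, h3, hv k hk, degAnswer_natCast]
      rw [hd] at hτ'
      have c2 : ⌊(var vI * var vS + var vJ).eval ((((τ.setReg vJ k).tick 1).setReg vD
          (G.deg (cellVertex n σ (i * s + k)))).query.tick
            ((load aSample (var vI * var vS + var vJ)).cost + 1))⌋₊ = i * s + k :=
        eval_cell (by simpa [tick_reg, query_reg, setReg_reg] using h1)
          (by simpa [tick_reg, query_reg, setReg_reg] using h2)
          (by simp [tick_reg, query_reg, setReg_reg])
      rw [c2] at hτ'
      subst hτ'
      refine ⟨?_, ?_, ?_, ?_, ?_, ?_⟩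
      · simpa [tick_reg, query_reg, setReg_reg, setMem_reg] using h1
      · simpa [tick_reg, query_reg, setReg_reg, setMem_reg] using h2
      · simpa [tick_mem, query_mem, setReg_mem, setMem_mem] using h3
      · intro c hc
        have : c ≠ i * s + k := by omega
        simpa [tick_mem, query_mem, setReg_mem, setMem_mem, this] using h4 c hc
      · intro j hj
        rcases Nat.lt_succ_iff_lt_or_eq.1 hj with hj | rfl
        · simpa [tick_mem, query_mem, setReg_mem, setMem_mem, hj.ne] using h5 j hj
        · simp [tick_mem, query_mem, setReg_mem, setMem_mem, eval_var, tick_reg, query_reg,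
            setReg_reg]
      · rw [Finset.sum_range_succ, Nat.cast_add, ← h6]
        simp [tick_reg, query_reg, setReg_reg, setMem_reg, eval_var, eval_add]) σ' h
  exact ⟨key.2.2.2.1, key.2.2.2.2.1, key.2.2.2.2.2,
    time_loop_le (by decide) (by decide) (by simp [eval_var, hS]) σ' h⟩

/-- The effect of drawing the `i`-th sample. -/
structure SampleStep (G : AdjListGraph n) (i s : ℕ) (σ σ' : State) : Prop where
  sample_eq : ∀ c < i * s, σ'.mem aSample c = σ.mem aSample c
  deg_eq : ∀ c < i * s, σ'.mem aDeg c = σ.mem aDeg c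
  sum_eq : ∀ k ≠ i, σ'.mem aSum k = σ.mem aSum k
  sample : ∀ j < s, σ'.mem aSample (i * s + j) = ((cellVertex n σ' (i * s + j) : ℕ) : ℝ)
  deg : ∀ j < s, σ'.mem aDeg (i * s + j) = G.deg (cellVertex n σ' (i * s + j))
  sum : σ'.mem aSum i = G.degSum (sampleAt n s σ' i)
  time : σ'.time ≤ σ.time + 10 + s * 40

theorem sampleSet_support {σ σ' : State} (hI : σ.reg vI = i) (hS : σ.reg vS = s)
    (h : σ' ∈ (sampleSet.run G σ).support) : SampleStep G i s σ σ' := by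
  simp only [sampleSet, block, mem_support_seq] at h
  obtain ⟨τ, hτ, τ1, hτ1, τ2, hτ2, h⟩ := h
  have hIτ : τ.reg vI = i := (reg_eq_of_notMem_writes G _ _ τ hτ vI (by decide)).trans hI
  have hSτ : τ.reg vS = s := (reg_eq_of_notMem_writes G _ _ τ hτ vS (by decide)).trans hS
  obtain ⟨d1, d2, dt⟩ := drawSample_support hI hS hτ
  have e1 := support_assign hτ1
  have hIτ1 : τ1.reg vI = i := by rw [e1]; simpa [tick_reg, setReg_reg] using hIτ
  have hSτ1 : τ1.reg vS = s := by rw [e1]; simpa [tick_reg, setReg_reg] using hSτ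
  have m1 : τ1.mem = τ.mem := by rw [e1]; rfl
  have cv1 : ∀ c, cellVertex n τ1 c = cellVertex n τ c := fun c => by rw [cellVertex, m1, cellVertex]
  have t1 : τ1.time = τ.time + 2 := by rw [e1]; rfl
  obtain ⟨q1, q2, q3, qt⟩ := queryDegrees_support (G := G) hIτ1 hSτ1
    (by rw [e1]; simp [tick_reg, setReg_reg, eval_ofNat])
    (by intro j hj; rw [m1, cv1]; exact d2 j hj) hτ2
  have hI2 : τ2.reg vI = i := (reg_eq_of_notMem_writes G _ _ τ2 hτ2 vI (by decide)).trans hIτ1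
  have e3 : σ' = (τ2.setMem aSum i (τ2.reg vM)).tick 3 := by
    simp only [Cmd.run, PMF.mem_support_pure_iff, eval_var, hI2, Nat.floor_natCast] at h
    exact h
  have ms : σ'.mem aSample = τ.mem aSample := by
    have : σ'.mem aSample = τ2.mem aSample := by rw [e3]; simp [tick_mem, setMem_mem]
    rw [this, mem_eq_of_notMem_stores G _ _ τ2 hτ2 aSample (by decide), m1]
  have md : σ'.mem aDeg = τ2.mem aDeg := by rw [e3]; simp [tick_mem, setMem_mem]
  have cv : ∀ c, cellVertex n σ' c = cellVertex n τ c := fun c => by rw [cellVertex, ms, cellVertex]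
  refine ⟨?_, ?_, ?_, ?_, ?_, ?_, ?_⟩
  · intro c hc
    rw [ms, d1 c hc]
  · intro c hc
    rw [md, q1 c hc, m1, mem_eq_of_notMem_stores G _ _ τ hτ aDeg (by decide)]
  · intro k hk
    have : σ'.mem aSum k = τ2.mem aSum k := by rw [e3]; simp [tick_mem, setMem_mem, hk]
    rw [this, mem_eq_of_notMem_stores G _ _ τ2 hτ2 aSum (by decide), m1,
      mem_eq_of_notMem_stores G _ _ τ hτ aSum (by decide)]
  · intro j hj
    rw [ms, cv, d2 j hj]
  · intro j hj
    rw [md, q2 j hj, cv, cv1]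
  · have : σ'.mem aSum i = τ2.reg vM := by rw [e3]; simp [tick_mem, setMem_mem]
    rw [this, q3, degSum_sampleAt]
    simp only [cv, cv1]
  · have : σ'.time = τ2.time + 3 := by rw [e3]; rfl
    omega

/-- The sampled vertices after `sampleSet` are those after `drawSample`. -/
theorem mean_sampleSet {σ : State}
    (Ψ : (ℕ → ℝ) → ℝ≥0∞) :
    mean (sampleSet.run G σ) (fun τ => Ψ (τ.mem aSample)) ≤
      mean (drawSample.run G σ) (fun τ => Ψ (τ.mem aSample)) := by
  simp only [sampleSet, block]
  rw [mean_seq]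
  refine mean_mono fun τ hτ => ?_
  refine mean_le_of_forall_le fun τ' hτ' => ?_
  rw [mem_eq_of_notMem_stores G _ _ τ' hτ' aSample (by decide)]

end EdgeSampling

/-! ### Tail bounds for one sample. -/

namespace EdgeSampling
open _root_.EdgeSampling.Expr _root_.EdgeSampling.Cmd

variable {n : ℕ} [NeZero n] {G : AdjListGraph n} {i s : ℕ}

/-- For X in [0, 1] and |l| ≤ 1 one has exp(lX) ≤ 1 + (l + l²)X, as X² ≤ X. Averaging and
multiplying over the independent draws gives the bound for the sum. -/
theorem mean_exp_sampleSet_le {σ : State} (hI : σ.reg vI = i) (hS : σ.reg vS = s)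
    {X : Fin n → ℝ} (hX0 : ∀ v, 0 ≤ X v) (hX1 : ∀ v, X v ≤ 1) {l : ℝ} (hl : |l| ≤ 1) :
    mean (sampleSet.run G σ) (fun τ => ENNReal.ofReal
      (Real.exp (l * ∑ j ∈ Finset.range s, X (cellVertex n τ (i * s + j))))) ≤
      ENNReal.ofReal (Real.exp (s * ((l + l ^ 2) * ((∑ v, X v) / n)))) := by
  have hn : (0 : ℝ) < n := by exact_mod_cast NeZero.pos n
  refine (mean_sampleSet (G := G) (σ := σ) fun a => ENNReal.ofReal
    (Real.exp (l * ∑ j ∈ Finset.range s, X (vertexOf n (a (i * s + j)))))).trans ?_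
  have hb : (∑ v, ENNReal.ofReal (Real.exp (l * X v))) / n ≤
      ENNReal.ofReal (Real.exp ((l + l ^ 2) * ((∑ v, X v) / n))) := by
    rw [← ENNReal.ofReal_sum_of_nonneg (fun _ _ => (Real.exp_pos _).le),
      ← ENNReal.ofReal_natCast, ← ENNReal.ofReal_div_of_pos hn]
    refine ENNReal.ofReal_le_ofReal ?_
    have h1 : ∀ v, Real.exp (l * X v) ≤ 1 + (l + l ^ 2) * X v := by
      intro v
      have hy : |l * X v| ≤ 1 := by
        rw [abs_mul, abs_of_nonneg (hX0 v)]
        exact mul_le_one₀ hl (hX0 v) (hX1 v)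
      have := exp_le_one_add_add_sq hy
      have := mul_nonneg (mul_nonneg (sq_nonneg l) (hX0 v)) (sub_nonneg.2 (hX1 v))
      nlinarith
    refine le_trans ?_ (Real.add_one_le_exp _)
    rw [div_le_iff₀ hn]
    refine (Finset.sum_le_sum fun v _ => h1 v).trans_eq ?_
    rw [Finset.sum_add_distrib, ← Finset.mul_sum]
    simp only [Finset.sum_const, Finset.card_univ, Fintype.card_fin, nsmul_eq_mul, mul_one]
    field_simp
    ring
  have := mean_drawSample_prod_le (G := G) hI hS _ hb
  rw [← ENNReal.ofReal_pow (Real.exp_pos _).le, ← Real.exp_nat_mul] at this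
  refine le_trans (le_of_eq ?_) this
  congr 1
  funext τ
  rw [← ENNReal.ofReal_prod_of_nonneg (fun _ _ => (Real.exp_pos _).le), ← Real.exp_sum,
    Finset.mul_sum]
  rfl

/-- A Chernoff bound for the sampled vertices; `l > 0` gives the upper and `l < 0` the lower
tail. -/
theorem sampleSet_tail_le {σ : State} (hI : σ.reg vI = i) (hS : σ.reg vS = s)
    {X : Fin n → ℝ} (hX0 : ∀ v, 0 ≤ X v) (hX1 : ∀ v, X v ≤ 1) {l : ℝ} (hl : |l| ≤ 1) (b : ℝ) :
    (sampleSet.run G σ).toOuterMeasure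
      {τ | l * b ≤ l * ∑ j ∈ Finset.range s, X (cellVertex n τ (i * s + j))} ≤
      ENNReal.ofReal (Real.exp (s * ((l + l ^ 2) * ((∑ v, X v) / n)) - l * b)) := by
  have h := mean_exp_sampleSet_le (G := G) hI hS hX0 hX1 hl
  have h2 := mul_le_mul_left h (ENNReal.ofReal (Real.exp (-(l * b))))
  rw [← mean_mul_const, ← ENNReal.ofReal_mul (Real.exp_pos _).le, ← Real.exp_add,
    ← sub_eq_add_neg] at h2
  refine le_trans (toOuterMeasure_le_mean fun τ _ hτ => ?_) h2
  rw [← ENNReal.ofReal_mul (Real.exp_pos _).le, ← Real.exp_add, ENNReal.one_le_ofReal]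
  refine Real.one_le_exp ?_
  have : l * b ≤ _ := hτ
  linarith

/-- The sample violates a lower or degree bound required of an `ε`-good set. -/
def BadSample (G : AdjListGraph n) (ε T : ℝ) (S : Multiset (Fin n)) : Prop :=
  (∃ v, T < G.deg v ∧
    ¬ ((1 - ε) * (S.card * (G.deg v : ℝ) / n) ≤ G.degInto S v ∧
      (G.degInto S v : ℝ) ≤ (1 + ε) * (S.card * (G.deg v : ℝ) / n))) ∨
  (G.degSum S : ℝ) < S.card * G.davg / 4

/-- With l = ±ε/2 both Chernoff exponents equal -(ε²/4) · s deg(v)/n. For deg v > T the sample size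
makes s deg(v)/n at least 35L/ε², more than enough. -/
theorem degInto_tail_le {ε T L : ℝ} {σ : State} (hI : σ.reg vI = i) (hS : σ.reg vS = s)
    (hε : 0 < ε) (hε2 : ε < 1 / 2) (hT : 0 < T) (hL : 0 ≤ L)
    (hs : n / T * (35 * L / ε ^ 2) ≤ s) {v : Fin n} (hv : T < G.deg v) :
    (sampleSet.run G σ).toOuterMeasure
      {τ | ¬ ((1 - ε) * (s * (G.deg v : ℝ) / n) ≤ G.degInto (sampleAt n s τ i) v ∧
        (G.degInto (sampleAt n s τ i) v : ℝ) ≤ (1 + ε) * (s * (G.deg v : ℝ) / n))} ≤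
      ENNReal.ofReal (2 * Real.exp (-L)) := by
  have hn : (0 : ℝ) < n := by exact_mod_cast NeZero.pos n
  have hmean : (∑ u, G.adj v u) / n = G.deg v / n := by rw [G.deg_eq_sum_adj]
  have hexp : L ≤ s * (G.deg v / n) * (ε ^ 2 / 4) := by
    have h1 : n / T * (35 * L / ε ^ 2) * (T / n) * (ε ^ 2 / 4) ≤
        s * (G.deg v / n) * (ε ^ 2 / 4) := by gcongr
    have h2 : n / T * (35 * L / ε ^ 2) * (T / n) * (ε ^ 2 / 4) = 35 / 4 * L := by
      field_simp
    linarith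
  have hup := sampleSet_tail_le (G := G) hI hS (G.adj_nonneg v) (G.adj_le_one v)
    (l := ε / 2) (by rw [abs_of_pos (by linarith)]; linarith) ((1 + ε) * (s * (G.deg v : ℝ) / n))
  have hlo := sampleSet_tail_le (G := G) hI hS (G.adj_nonneg v) (G.adj_le_one v)
    (l := -(ε / 2)) (by rw [abs_neg, abs_of_pos (by linarith)]; linarith)
    ((1 - ε) * (s * (G.deg v : ℝ) / n))
  rw [hmean] at hup hlo
  have hup2 := hup.trans (ENNReal.ofReal_le_ofReal (Real.exp_le_exp.2
    (le_trans (le_of_eq (by ring)) (neg_le_neg hexp))))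
  have hlo2 := hlo.trans (ENNReal.ofReal_le_ofReal (Real.exp_le_exp.2
    (le_trans (le_of_eq (by ring)) (neg_le_neg hexp))))
  rw [two_mul, ENNReal.ofReal_add (Real.exp_pos _).le (Real.exp_pos _).le]
  refine le_trans ?_ ((toOuterMeasure_union_le _ _ _).trans (add_le_add hlo2 hup2))
  refine toOuterMeasure_mono_support fun τ _ hτ => ?_
  simp only [Set.mem_ofPred_eq, not_and_or, not_le, degInto_sampleAt] at hτ
  rcases hτ with h | h
  · left
    simp only [Set.mem_ofPred_eq]
    nlinarith
  · right
    simp only [Set.mem_ofPred_eq]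
    nlinarith

/-- Single degrees may be far above the average, so they are first capped at θ = √(m/2), which loses
at most half of m. The capped and rescaled degrees lie in [0, 1] with mean at least d/(2θ), and l =
-1/4 gives the exponent -(3/32 - 1/16) · sd/θ. Finally d/θ ≥ √(d/n). -/
theorem degSum_lower_tail_le {L : ℝ} {σ : State} (hI : σ.reg vI = i) (hS : σ.reg vS = s)
    (hm : 0 < G.m) (hs : 32 * L ≤ s * Real.sqrt (G.davg / n)) :
    (sampleSet.run G σ).toOuterMeasure
      {τ | (G.degSum (sampleAt n s τ i) : ℝ) < s * G.davg / 4} ≤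
      ENNReal.ofReal (Real.exp (-L)) := by
  have hn : (0 : ℝ) < n := by exact_mod_cast NeZero.pos n
  have hd := G.davg_pos hm
  have hm' : (0 : ℝ) < G.m := by exact_mod_cast hm
  set θ := Real.sqrt (G.m / 2) with hθ
  have hθ0 : 0 < θ := Real.sqrt_pos.2 (by positivity)
  have hθ2 : θ ^ 2 = G.m / 2 := Real.sq_sqrt (by positivity)
  have hdθ : Real.sqrt (G.davg / n) ≤ G.davg / θ := by
    refine Real.sqrt_le_iff.2 ⟨by positivity, ?_⟩
    rw [div_pow, hθ2, ← G.cast_mul_davg, div_le_div_iff₀ hn (by positivity)]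
    nlinarith [mul_pos hn (mul_pos hd hd)]
  have hmin := G.half_m_le_sum_min θ hθ0 (by rw [hθ2]; linarith)
  have hmean : G.davg / (2 * θ) ≤ (∑ v, min (G.deg v : ℝ) θ / θ) / n := by
    rw [← Finset.sum_div, div_div, div_le_div_iff₀ (by positivity) (by positivity)]
    rw [← G.cast_mul_davg] at hmin
    nlinarith
  have h := sampleSet_tail_le (G := G) hI hS (X := fun v => min (G.deg v : ℝ) θ / θ)
    (fun v => div_nonneg (le_min (Nat.cast_nonneg _) hθ0.le) hθ0.le)
    (fun v => (div_le_one hθ0).2 (min_le_right _ _)) (l := -(1 / 4))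
    (by rw [abs_neg, abs_of_pos] <;> norm_num) (s * G.davg / (4 * θ))
  refine le_trans ?_ (h.trans (ENNReal.ofReal_le_ofReal (Real.exp_le_exp.2 ?_)))
  · refine toOuterMeasure_mono_support fun τ _ hτ => ?_
    simp only [Set.mem_ofPred_eq, degSum_sampleAt] at hτ ⊢
    rw [neg_mul, neg_mul, neg_le_neg_iff, ← Finset.sum_div]
    refine mul_le_mul_of_nonneg_left ?_ (by norm_num)
    rw [div_le_div_iff₀ hθ0 (by positivity)]
    have h1 : ∑ j ∈ Finset.range s, min (G.deg (cellVertex n τ (i * s + j)) : ℝ) θ ≤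
        s * G.davg / 4 := by
      refine le_trans (Finset.sum_le_sum fun j _ => min_le_left _ _) ?_
      push_cast at hτ
      exact hτ.le
    nlinarith
  · have h1 : (s : ℝ) * ((-(1 / 4) + (-(1 / 4)) ^ 2) * ((∑ v, min (G.deg v : ℝ) θ / θ) / n)) ≤
        s * (-(3 / 16) * (G.davg / (2 * θ))) := by
      refine mul_le_mul_of_nonneg_left ?_ (Nat.cast_nonneg s)
      linarith
    have h2 : (s : ℝ) * Real.sqrt (G.davg / n) ≤ s * (G.davg / θ) :=
      mul_le_mul_of_nonneg_left hdθ (Nat.cast_nonneg s)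
    have h3 : (s : ℝ) * (-(3 / 16) * (G.davg / (2 * θ))) - -(1 / 4) * (s * G.davg / (4 * θ)) =
        -(s * (G.davg / θ)) / 32 := by field_simp; ring
    linarith

theorem badSample_le {ε T L : ℝ} {σ : State} (hI : σ.reg vI = i) (hS : σ.reg vS = s)
    (hm : 0 < G.m) (hε : 0 < ε) (hε2 : ε < 1 / 2) (hT : 0 < T) (hL : 0 ≤ L)
    (hs : n / T * (35 * L / ε ^ 2) ≤ s) (hs2 : 32 * L ≤ s * Real.sqrt (G.davg / n)) :
    (sampleSet.run G σ).toOuterMeasure {τ | BadSample G ε T (sampleAt n s τ i)} ≤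
      ENNReal.ofReal ((2 * n + 1) * Real.exp (-L)) := by
  have h1 : (sampleSet.run G σ).toOuterMeasure
      (⋃ v : Fin n, {τ | T < G.deg v ∧
        ¬ ((1 - ε) * (s * (G.deg v : ℝ) / n) ≤ G.degInto (sampleAt n s τ i) v ∧
        (G.degInto (sampleAt n s τ i) v : ℝ) ≤ (1 + ε) * (s * (G.deg v : ℝ) / n))}) ≤
      n * ENNReal.ofReal (2 * Real.exp (-L)) := by
    refine (MeasureTheory.measure_iUnion_fintype_le _ _).trans ?_
    refine (Finset.sum_le_sum (g := fun _ => ENNReal.ofReal (2 * Real.exp (-L)))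
      fun v _ => ?_).trans_eq (by simp)
    by_cases hv : T < G.deg v
    · refine le_trans (PMF.toOuterMeasure_mono _ fun τ hτ => hτ.1.2)
        (degInto_tail_le (G := G) hI hS hε hε2 hT hL hs hv)
    · simp [hv]
  have h2 := degSum_lower_tail_le (G := G) hI hS hm hs2
  have h3 := (toOuterMeasure_union_le _ _ _).trans (add_le_add h1 h2)
  refine le_trans ?_ (h3.trans_eq ?_)
  · refine toOuterMeasure_mono_support fun τ _ hτ => ?_
    rcases hτ with ⟨v, h⟩ | h
    · left
      rw [card_sampleAt] at h
      exact Set.mem_iUnion.2 ⟨v, h⟩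
    · right
      rw [card_sampleAt] at h
      exact h
  · rw [← ENNReal.ofReal_natCast, ← ENNReal.ofReal_mul (Nat.cast_nonneg _),
      ← ENNReal.ofReal_add (by positivity) (by positivity)]
    congr 1; ring

/-- Markov's inequality. High degrees rule out an exponential bound for this tail, which is why
several samples are drawn. -/
theorem heavySample_le {σ : State} (hI : σ.reg vI = i) (hS : σ.reg vS = s) (hs : 0 < s)
    (hm : 0 < G.m) :
    (sampleSet.run G σ).toOuterMeasure
      {τ | 6 * (s * G.davg) ≤ G.degSum (sampleAt n s τ i)} ≤ ENNReal.ofReal (1 / 6) := by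
  have hn : (0 : ℝ) < n := by exact_mod_cast NeZero.pos n
  have hd := G.davg_pos hm
  have hs' : (0 : ℝ) < s := by exact_mod_cast hs
  have hb : (∑ v, ENNReal.ofReal ((G.deg v : ℝ) / (6 * (s * G.davg)))) / n ≤
      ENNReal.ofReal (1 / (6 * s)) := by
    rw [← ENNReal.ofReal_sum_of_nonneg (fun _ _ => by positivity), ← Finset.sum_div, ← G.cast_m,
      ← ENNReal.ofReal_natCast, ← ENNReal.ofReal_div_of_pos hn, ← G.cast_mul_davg]
    refine ENNReal.ofReal_le_ofReal (le_of_eq ?_)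
    field_simp
  have h := mean_drawSample_sum_le (G := G) hI hS _ hb
  rw [← ENNReal.ofReal_natCast s, ← ENNReal.ofReal_mul (Nat.cast_nonneg _)] at h
  have e : (s : ℝ) * (1 / (6 * s)) = 1 / 6 := by field_simp
  rw [e] at h
  refine le_trans (toOuterMeasure_le_mean (f := fun τ => ∑ j ∈ Finset.range s,
    ENNReal.ofReal ((G.deg (cellVertex n τ (i * s + j)) : ℝ) / (6 * (s * G.davg)))) ?_)
    ((mean_sampleSet (G := G) (σ := σ) fun a => ∑ j ∈ Finset.range s, ENNReal.ofReal
      ((G.deg (vertexOf n (a (i * s + j))) : ℝ) / (6 * (s * G.davg)))).trans h)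
  intro τ _ hτ
  rw [← ENNReal.ofReal_sum_of_nonneg (fun _ _ => by positivity), ← Finset.sum_div,
    ENNReal.one_le_ofReal, le_div_iff₀ (by positivity), one_mul]
  have : 6 * (s * G.davg) ≤ G.degSum (sampleAt n s τ i) := hτ
  rw [degSum_sampleAt] at this
  exact_mod_cast this

end EdgeSampling

/-! ### All samples together. -/

namespace EdgeSampling
open _root_.EdgeSampling.Expr _root_.EdgeSampling.Cmd

variable {n : ℕ} [NeZero n] {G : AdjListGraph n} {i s : ℕ}

/-- The first `k` samples are in memory, with their degrees and degree sums. -/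
structure SamplesInv (G : AdjListGraph n) (s T k : ℕ) (τ : State) : Prop where
  size : τ.reg vS = s
  sample : ∀ c < k * s, τ.mem aSample c = ((cellVertex n τ c : ℕ) : ℝ)
  deg : ∀ c < k * s, τ.mem aDeg c = G.deg (cellVertex n τ c)
  sum : ∀ i < k, τ.mem aSum i = G.degSum (sampleAt n s τ i)
  time : τ.time ≤ T + k * (11 + s * 40)

theorem cell_lt {i j k s : ℕ} (hi : i < k) (hj : j < s) : i * s + j < k * s := by
  calc i * s + j < i * s + s := by omega
    _ = (i + 1) * s := by ring
    _ ≤ k * s := Nat.mul_le_mul_right s hi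

theorem SampleStep.sampleAt_eq {σ σ' : State} (h : SampleStep G i s σ σ') {k : ℕ} (hk : k < i) :
    sampleAt n s σ' k = sampleAt n s σ k :=
  sampleAt_congr fun _ hj => h.sample_eq _ (cell_lt hk hj)

theorem sampleAt_setReg_tick (σ : State) (r k : ℕ) (y : ℝ) (i : ℕ) :
    sampleAt n s ((σ.setReg r y).tick k) i = sampleAt n s σ i := rfl

theorem sampleSet_step {T k : ℕ} {τ τ' : State} (h : SamplesInv G s T k τ)
    (hτ' : τ' ∈ (sampleSet.run G ((τ.setReg vI k).tick 1)).support) :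
    SampleStep G k s ((τ.setReg vI k).tick 1) τ' :=
  sampleSet_support (by simp [tick_reg, setReg_reg])
    (by simpa [tick_reg, setReg_reg] using h.size) hτ'

theorem samplesInv_step {T k : ℕ} {τ τ' : State} (h : SamplesInv G s T k τ)
    (hτ' : τ' ∈ (sampleSet.run G ((τ.setReg vI k).tick 1)).support) :
    SamplesInv G s T (k + 1) τ' := by
  have hs := sampleSet_step h hτ'
  have hcell : ∀ c < (k + 1) * s, c < k * s ∨ ∃ j < s, c = k * s + j := by
    intro c hc
    rw [add_mul, one_mul] at hc
    rcases lt_or_ge c (k * s) with h | h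
    · exact Or.inl h
    · exact Or.inr ⟨c - k * s, by omega, by omega⟩
  have hcv : ∀ c < k * s, cellVertex n τ' c = cellVertex n τ c := by
    intro c hc
    rw [cellVertex, hs.sample_eq c hc]; rfl
  refine ⟨?_, ?_, ?_, ?_, ?_⟩
  · rw [reg_eq_of_notMem_writes G _ _ τ' hτ' vS (by decide)]
    simpa [tick_reg, setReg_reg] using h.size
  · intro c hc
    rcases hcell c hc with hc | ⟨j, hj, rfl⟩
    · rw [hcv c hc, hs.sample_eq c hc]; exact h.sample c hc
    · exact hs.sample j hj
  · intro c hc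
    rcases hcell c hc with hc | ⟨j, hj, rfl⟩
    · rw [hcv c hc, hs.deg_eq c hc]; exact h.deg c hc
    · exact hs.deg j hj
  · intro i hi
    rcases Nat.lt_succ_iff_lt_or_eq.1 hi with hi | rfl
    · rw [hs.sum_eq i hi.ne, hs.sampleAt_eq hi]; exact h.sum i hi
    · exact hs.sum
  · have h1 := hs.time
    have h2 := h.time
    simp only [State.tick, State.setReg] at h1
    rw [add_mul, one_mul]
    omega

theorem samplesInv_start {σ : State} (hS : σ.reg vS = s) :
    SamplesInv G s (σ.time + 2) 0 (σ.tick ((var vT).cost + 1)) := by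
  refine ⟨hS, ?_, ?_, ?_, ?_⟩
  · intro c hc; omega
  · intro c hc; omega
  · intro c hc; omega
  · simp [State.tick, Expr.cost]

theorem sampleSets_support {t : ℕ} {σ σ' : State} (hS : σ.reg vS = s) (hT : σ.reg vT = t)
    (h : σ' ∈ (sampleSets.run G σ).support) : SamplesInv G s (σ.time + 2) t σ' := by
  rw [sampleSets_eq] at h
  exact loop_invariant (SamplesInv G s (σ.time + 2)) (by simp [eval_var, hT])
    (samplesInv_start hS) (fun k _ τ hτ τ' hτ' => samplesInv_step hτ hτ') σ' h

/-- If every sample has the property `B` with probability at most `β` and the property `H` with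
probability at most `γ`, then it is unlikely that some sample has `B` or all samples have `H`. -/
theorem sampleSets_prob {t : ℕ} {σ : State} (hS : σ.reg vS = s) (hT : σ.reg vT = t)
    {B H : Multiset (Fin n) → Prop} {β γ : ℝ≥0∞}
    (hB : ∀ (i : ℕ) (τ : State), τ.reg vI = i → τ.reg vS = s →
      (sampleSet.run G τ).toOuterMeasure {τ | B (sampleAt n s τ i)} ≤ β)
    (hH : ∀ (i : ℕ) (τ : State), τ.reg vI = i → τ.reg vS = s →
      (sampleSet.run G τ).toOuterMeasure {τ | H (sampleAt n s τ i)} ≤ γ) :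
    (sampleSets.run G σ).toOuterMeasure
      {τ | (∃ i < t, B (sampleAt n s τ i)) ∨ ∀ i < t, H (sampleAt n s τ i)} ≤
      t * β + γ ^ t := by
  classical
  -- After k samples the potential is [one of them has `B`] + (t - k)β + [all of them have `H`] ·
  -- γ^(t - k). The hypotheses hold from every starting state, hence conditionally on the earlier
  -- samples.
  have key := mean_loop_le (G := G) (N := t) (r := vI) (e := var vT) (c := sampleSet) (σ := σ)
    (SamplesInv G s (σ.time + 2))
    (fun k τ => (if ∃ i < k, B (sampleAt n s τ i) then 1 else 0) + ((t - k : ℕ) : ℝ≥0∞) * β +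
      (if ∀ i < k, H (sampleAt n s τ i) then 1 else 0) * γ ^ (t - k)) (by simp [eval_var, hT])
    (samplesInv_start hS) (fun k _ τ hτ τ' hτ' => samplesInv_step hτ hτ') ?_
  · rw [← sampleSets_eq] at key
    simp only [not_lt_zero, false_and, exists_false, if_false, Nat.sub_zero, zero_add,
      IsEmpty.forall_iff, implies_true, if_true, one_mul, Nat.sub_self, Nat.cast_zero, zero_mul,
      pow_zero, mul_one, add_zero] at key
    refine le_trans (toOuterMeasure_le_mean fun τ _ hτ => ?_) key
    rcases hτ with h | h
    · rw [if_pos h]; exact le_add_right le_rfl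
    · rw [if_pos h]; exact le_add_left le_rfl
  · intro k hk τ hτ
    set τ0 := (τ.setReg vI k).tick 1 with hτ0
    have hBk := hB k τ0 (by simp [hτ0, tick_reg, setReg_reg])
      (by simpa [hτ0, tick_reg, setReg_reg] using hτ.size)
    have hHk := hH k τ0 (by simp [hτ0, tick_reg, setReg_reg])
      (by simpa [hτ0, tick_reg, setReg_reg] using hτ.size)
    rw [toOuterMeasure_eq_mean] at hBk hHk
    have hpt : ∀ τ' ∈ (sampleSet.run G τ0).support,
        (if ∃ i < k + 1, B (sampleAt n s τ' i) then 1 else 0) +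
          ((t - (k + 1) : ℕ) : ℝ≥0∞) * β +
          (if ∀ i < k + 1, H (sampleAt n s τ' i) then 1 else 0) * γ ^ (t - (k + 1)) ≤
        {τ | B (sampleAt n s τ k)}.indicator 1 τ' +
          ((if ∃ i < k, B (sampleAt n s τ i) then 1 else 0) +
            ((t - (k + 1) : ℕ) : ℝ≥0∞) * β) +
          {τ | H (sampleAt n s τ k)}.indicator 1 τ' *
            ((if ∀ i < k, H (sampleAt n s τ i) then 1 else 0) * γ ^ (t - (k + 1))) := by
      intro τ' hτ'
      have hs := sampleSet_step hτ hτ'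
      have heq : ∀ i < k, sampleAt n s τ' i = sampleAt n s τ i := fun i hi => by
        rw [hs.sampleAt_eq hi, sampleAt_setReg_tick]
      refine add_le_add ?_ ?_
      · rw [← add_assoc]
        refine add_le_add ?_ le_rfl
        by_cases h : ∃ i < k + 1, B (sampleAt n s τ' i)
        · rw [if_pos h]
          obtain ⟨i, hi, h⟩ := h
          rcases Nat.lt_succ_iff_lt_or_eq.1 hi with hi | rfl
          · rw [if_pos (⟨i, hi, heq i hi ▸ h⟩ : ∃ i < k, B (sampleAt n s τ i))]
            exact le_add_left le_rfl
          · rw [Set.indicator_of_mem (by exact h)]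
            exact le_add_right le_rfl
        · rw [if_neg h]; exact zero_le
      · rw [← mul_assoc]
        refine mul_le_mul_left ?_ _
        by_cases h : ∀ i < k + 1, H (sampleAt n s τ' i)
        · rw [if_pos h, Set.indicator_of_mem (by exact h k k.lt_succ_self),
            if_pos fun i hi => heq i hi ▸ h i (hi.trans k.lt_succ_self)]
          simp
        · rw [if_neg h]; exact zero_le
    refine (mean_mono hpt).trans ?_
    rw [mean_add, mean_add, mean_const, mean_mul_const]
    have hsplit : t - k = t - (k + 1) + 1 := by omega
    rw [hsplit, Nat.cast_succ, add_mul, one_mul, pow_succ]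
    refine add_le_add ?_ ?_
    · rw [add_comm, add_assoc]
      exact add_le_add le_rfl (add_le_add le_rfl hBk)
    · calc _ ≤ γ * ((if ∀ i < k, H (sampleAt n s τ i) then 1 else 0) * γ ^ (t - (k + 1))) := by
            exact mul_le_mul_left hHk _
        _ = _ := by ring

end EdgeSampling

/-! ### Choosing a sample and building D(S). -/

namespace EdgeSampling
open _root_.EdgeSampling.Expr _root_.EdgeSampling.Cmd

variable {n : ℕ} [NeZero n] {G : AdjListGraph n} {i s : ℕ}

/-- The average degree of the `i`-th sample is in the range required of the chosen sample. -/
def PassesFilter (σ : State) (i : ℕ) : Prop :=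
  1 / 4 * σ.reg vDbar ≤ σ.mem aSum i / σ.reg vS ∧ σ.mem aSum i / σ.reg vS ≤ 12 * σ.reg vDbar

/-- The body of the loop of `chooseSet`. -/
def chooseBody : Cmd :=
  ifLe (var vFound) 0
      (ifLe (1 / 4 * var vDbar) (load aSum (var vI) / var vS)
        (ifLe (load aSum (var vI) / var vS) (12 * var vDbar)
          (block [assign vFound 1, assign vK (var vI)])
          skip)
        skip)
      skip

theorem chooseBody_support {k : ℕ} {τ τ' : State}
    (h : τ' ∈ (chooseBody.run G ((τ.setReg vI k).tick 1)).support) :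
    (τ.reg vFound ≤ 0 ∧ ((PassesFilter τ k ∧ τ'.reg vFound = 1 ∧ τ'.reg vK = k) ∨
      (¬ PassesFilter τ k ∧ τ'.reg vFound = τ.reg vFound))) ∨
    (0 < τ.reg vFound ∧ τ'.reg vFound = τ.reg vFound ∧ τ'.reg vK = τ.reg vK) := by
  rcases support_ifLe h with ⟨h0, h⟩ | ⟨h0, h⟩
  · left
    simp [eval_var, eval_ofNat, tick_reg, setReg_reg] at h0
    refine ⟨h0, ?_⟩
    rcases support_ifLe h with ⟨h1, h⟩ | ⟨h1, h⟩
    · rcases support_ifLe h with ⟨h2, h⟩ | ⟨h2, h⟩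
      · left
        simp only [block, mem_support_seq] at h
        obtain ⟨τ1, hτ1, h⟩ := h
        simp [eval_var, eval_ofNat, eval_mul, eval_div, eval_load, tick_reg, setReg_reg, tick_mem,
          setReg_mem] at h1 h2
        refine ⟨⟨by simpa using h1, h2⟩, ?_, ?_⟩
        · rw [support_assign h, support_assign hτ1]
          simp [tick_reg, setReg_reg, eval_ofNat]
        · rw [support_assign h, support_assign hτ1]
          simp [tick_reg, setReg_reg, eval_var]
      · right
        simp [eval_var, eval_ofNat, eval_mul, eval_div, eval_load, tick_reg, setReg_reg, tick_mem,
          setReg_mem] at h2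
        refine ⟨fun hp => absurd hp.2 (not_le.2 h2), ?_⟩
        rw [reg_eq_of_notMem_writes G _ _ τ' h vFound (by decide)]
        simp [tick_reg, setReg_reg]
    · right
      simp [eval_var, eval_ofNat, eval_mul, eval_div, eval_load, tick_reg, setReg_reg, tick_mem,
        setReg_mem] at h1
      refine ⟨fun hp => absurd hp.1 (not_le.2 (by simpa using h1)), ?_⟩
      rw [reg_eq_of_notMem_writes G _ _ τ' h vFound (by decide)]
      simp [tick_reg, setReg_reg]
  · right
    simp [eval_var, eval_ofNat, tick_reg, setReg_reg] at h0
    refine ⟨h0, ?_, ?_⟩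
    · rw [reg_eq_of_notMem_writes G _ _ τ' h vFound (by decide)]
      simp [tick_reg, setReg_reg]
    · rw [reg_eq_of_notMem_writes G _ _ τ' h vK (by decide)]
      simp [tick_reg, setReg_reg]

theorem chooseSet_support {t : ℕ} {σ σ' : State} (hT : σ.reg vT = t)
    (h : σ' ∈ (chooseSet.run G σ).support) :
    ((σ'.reg vFound = 0 ∧ ∀ i < t, ¬ PassesFilter σ i) ∨
      (σ'.reg vFound = 1 ∧ ∃ i < t, σ'.reg vK = i ∧ PassesFilter σ i)) ∧
    σ'.time ≤ σ.time + 4 + t * 40 := by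
  simp only [chooseSet, block, mem_support_seq] at h
  obtain ⟨τ, hτ, h⟩ := h
  have e := support_assign hτ
  have hTτ : τ.reg vT = t := by rw [e]; simpa [tick_reg, setReg_reg] using hT
  constructor
  · have key := loop_invariant (G := G) (N := t) (c := chooseBody)
      (fun k τ' => τ'.reg vDbar = σ.reg vDbar ∧ τ'.reg vS = σ.reg vS ∧ τ'.mem = σ.mem ∧
        ((τ'.reg vFound = 0 ∧ ∀ i < k, ¬ PassesFilter σ i) ∨
        (τ'.reg vFound = 1 ∧ ∃ i < k, τ'.reg vK = i ∧ PassesFilter σ i)))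
      (by simp [eval_var, hTτ])
      ⟨by rw [e]; simp [tick_reg, setReg_reg], by rw [e]; simp [tick_reg, setReg_reg],
        by rw [e]; rfl, Or.inl ⟨by rw [e]; simp [tick_reg, setReg_reg, eval_ofNat],
          fun i hi => absurd hi (Nat.not_lt_zero i)⟩⟩
      (fun k hk τ hτ τ' hτ' => by
        obtain ⟨hD, hS, hm, hI⟩ := hτ
        have hp : ∀ i, PassesFilter τ i ↔ PassesFilter σ i := fun i => by
          rw [PassesFilter, PassesFilter, hD, hS, hm]
        refine ⟨?_, ?_, ?_, ?_⟩
        · rw [reg_eq_of_notMem_writes G _ _ τ' hτ' vDbar (by decide)]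
          simpa [tick_reg, setReg_reg] using hD
        · rw [reg_eq_of_notMem_writes G _ _ τ' hτ' vS (by decide)]
          simpa [tick_reg, setReg_reg] using hS
        · funext a
          rw [mem_eq_of_notMem_stores G _ _ τ' hτ' a (by simp [chooseBody, block, Cmd.stores]),
            tick_mem, setReg_mem, hm]
        · rcases chooseBody_support hτ' with ⟨h0, ⟨h1, h2, h3⟩ | ⟨h1, h2⟩⟩ | ⟨h0, h1, h2⟩
          · exact Or.inr ⟨h2, k, k.lt_succ_self, h3, (hp k).1 h1⟩
          · rcases hI with ⟨hf, hI⟩ | ⟨hf, -⟩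
            · refine Or.inl ⟨h2.trans hf, fun i hi => ?_⟩
              rcases Nat.lt_succ_iff_lt_or_eq.1 hi with hi | rfl
              · exact hI i hi
              · rwa [← hp i]
            · rw [hf] at h0; norm_num at h0
          · rcases hI with ⟨hf, -⟩ | ⟨hf, i, hi, hI⟩
            · rw [hf] at h0; norm_num at h0
            · exact Or.inr ⟨h1.trans hf, i, hi.trans k.lt_succ_self, h2.trans hI.1, hI.2⟩) σ' h
    exact key.2.2.2
  · have ht := time_loop_le (b := 40) (by decide) (by decide)
      (show ⌊(var vT).eval τ⌋₊ = t by simp [eval_var, hTτ]) σ' h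
    have : τ.time = σ.time + 2 := by rw [e]; rfl
    have e2 : (var vT).cost = 1 := rfl
    omega

/-- The state holds the data structure `D(S)` for the sample with vertices `f 0, …, f (s - 1)`. -/
structure HoldsDS (G : AdjListGraph n) (s : ℕ) (f : ℕ → Fin n) (σ : State) : Prop where
  size : σ.reg vS = s
  vert : ∀ j < s, σ.mem dsVert j = ((f j : ℕ) : ℝ)
  cum : ∀ j < s, σ.mem dsCum j = ((∑ k ∈ Finset.range (j + 1), G.deg (f k) : ℕ) : ℝ)
  total : σ.reg vC = ((∑ k ∈ Finset.range s, G.deg (f k) : ℕ) : ℝ)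

theorem eval_chosen_cell {σ : State} {i s j : ℕ} (hK : σ.reg vK = i) (hS : σ.reg vS = s)
    (hJ : σ.reg vJ = j) : ⌊(var vK * var vS + var vJ).eval σ⌋₊ = i * s + j := by
  rw [eval_add, eval_mul, eval_var, eval_var, eval_var, hK, hS, hJ]
  exact_mod_cast Nat.floor_natCast (R := ℝ) (i * s + j)

theorem buildDS_support {σ σ' : State} {f : ℕ → Fin n} (hK : σ.reg vK = i) (hS : σ.reg vS = s)
    (hv : ∀ j < s, σ.mem aSample (i * s + j) = ((f j : ℕ) : ℝ))
    (hd : ∀ j < s, σ.mem aDeg (i * s + j) = G.deg (f j))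
    (h : σ' ∈ (buildDS.run G σ).support) :
    HoldsDS G s f σ' ∧ σ'.time ≤ σ.time + 4 + s * 40 := by
  simp only [buildDS] at h
  rw [block, block] at h
  swap
  · simp
  rw [mem_support_seq] at h
  obtain ⟨τ, hτ, h⟩ := h
  have e := support_assign hτ
  have hKτ : τ.reg vK = i := by rw [e]; simpa [tick_reg, setReg_reg] using hK
  have hSτ : τ.reg vS = s := by rw [e]; simpa [tick_reg, setReg_reg] using hS
  constructor
  · have key := loop_invariant (G := G) (N := s)
      (fun j τ' => τ'.reg vK = i ∧ τ'.reg vS = s ∧ τ'.mem aSample = σ.mem aSample ∧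
        τ'.mem aDeg = σ.mem aDeg ∧
        (∀ k < j, τ'.mem dsVert k = ((f k : ℕ) : ℝ)) ∧
        (∀ k < j, τ'.mem dsCum k = ((∑ l ∈ Finset.range (k + 1), G.deg (f l) : ℕ) : ℝ)) ∧
        τ'.reg vC = ((∑ k ∈ Finset.range j, G.deg (f k) : ℕ) : ℝ))
      (by simp [eval_var, hSτ])
      ⟨hKτ, hSτ, by rw [e]; rfl, by rw [e]; rfl, fun k hk => absurd hk (Nat.not_lt_zero k),
        fun k hk => absurd hk (Nat.not_lt_zero k), by
          rw [e]; simp [tick_reg, setReg_reg, eval_ofNat]⟩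
      (fun k hk τ hτ τ' hτ' => by
        obtain ⟨h1, h2, h3, h4, h5, h6, h7⟩ := hτ
        simp only [block, Cmd.run, PMF.pure_bind, PMF.mem_support_pure_iff] at hτ'
        have c1 : ∀ σ1 : State, σ1.reg = ((τ.setReg vJ k).tick 1).reg →
            ⌊(var vK * var vS + var vJ).eval σ1⌋₊ = i * s + k := fun σ1 hσ1 =>
          eval_chosen_cell (by rw [hσ1]; simpa [tick_reg, setReg_reg] using h1)
            (by rw [hσ1]; simpa [tick_reg, setReg_reg] using h2)
            (by rw [hσ1]; simp [tick_reg, setReg_reg])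
        have c2 : ∀ σ1 : State, σ1.reg vJ = k → ⌊(var vJ).eval σ1⌋₊ = k := fun σ1 hσ1 => by
          rw [eval_var, hσ1, Nat.floor_natCast]
        have hX : (load aSample (var vK * var vS + var vJ)).eval ((τ.setReg vJ k).tick 1) =
            ((f k : ℕ) : ℝ) := by
          rw [eval_load, c1 _ rfl, tick_mem, setReg_mem, h3, hv k hk]
        rw [hX, c2 _ (by simp [tick_reg, setReg_reg])] at hτ'
        set τ1 := (((τ.setReg vJ k).tick 1).setMem dsVert k ((f k : ℕ) : ℝ)).tick
          ((var vJ).cost + (load aSample (var vK * var vS + var vJ)).cost + 1) with hτ1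
        have hY : (var vC + load aDeg (var vK * var vS + var vJ)).eval τ1 =
            ((∑ l ∈ Finset.range (k + 1), G.deg (f l) : ℕ) : ℝ) := by
          rw [eval_add, eval_load, c1 τ1 rfl, eval_var, Finset.sum_range_succ, Nat.cast_add, ← h7,
            ← hd k hk, ← h4]
          simp [hτ1, tick_reg, setMem_reg, setReg_reg, tick_mem, setMem_mem, setReg_mem]
        rw [hY, c2 _ (by simp [hτ1, tick_reg, setReg_reg, setMem_reg])] at hτ'
        subst hτ'
        refine ⟨?_, ?_, ?_, ?_, ?_, ?_, ?_⟩
        · simpa [hτ1, tick_reg, setReg_reg, setMem_reg] using h1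
        · simpa [hτ1, tick_reg, setReg_reg, setMem_reg] using h2
        · simpa [hτ1, tick_mem, setReg_mem, setMem_mem] using h3
        · simpa [hτ1, tick_mem, setReg_mem, setMem_mem] using h4
        · intro j hj
          rcases Nat.lt_succ_iff_lt_or_eq.1 hj with hj | rfl
          · simpa [hτ1, tick_mem, setReg_mem, setMem_mem, hj.ne] using h5 j hj
          · simp [hτ1, tick_mem, setReg_mem, setMem_mem]
        · intro j hj
          rcases Nat.lt_succ_iff_lt_or_eq.1 hj with hj | rfl
          · simpa [hτ1, tick_mem, setReg_mem, setMem_mem, hj.ne] using h6 j hj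
          · simp [hτ1, tick_mem, setReg_mem, setMem_mem, eval_var, tick_reg, setReg_reg]
        · simp [hτ1, tick_reg, setReg_reg, setMem_reg]) σ' h
    exact ⟨key.2.1, key.2.2.2.2.1, key.2.2.2.2.2.1, key.2.2.2.2.2.2⟩
  · have ht := time_loop_le (b := 40) (by decide) (by decide)
      (show ⌊(var vS).eval τ⌋₊ = s by simp [eval_var, hSτ]) σ' h
    have : τ.time = σ.time + 2 := by rw [e]; rfl
    have e2 : (var vS).cost = 1 := rfl
    omega

end EdgeSampling

/-! ### Counting the edges of E(S). -/

namespace AdjListGraph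

variable {n : ℕ} (G : AdjListGraph n)

open scoped Classical in
theorem card_filter_adj (v : Fin n) :
    (Finset.univ.filter fun w => G.graph.Adj v w).card = G.deg v := by
  have := G.sum_nbr v fun _ => (1 : ℕ)
  simpa using this.symm

theorem card_edgesFrom (S : Multiset (Fin n)) : (G.edgesFrom S).card = G.degSum S := by
  simp only [edgesFrom, Multiset.card_bind, Function.comp_def, Multiset.card_map, degSum]
  congr 1
  exact Multiset.map_congr rfl fun v _ => G.card_filter_adj v

-- Multiplicities in E(S) are counted by pairs of an occurrence of a vertex in S and one of its
-- neighbour indices. This is the indexing that `sampleEdge` inverts.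
open scoped Classical in
theorem count_edgesFrom (S : Multiset (Fin n)) (u w : Fin n) :
    (G.edgesFrom S).count (u, w) =
      (S.map fun v => ∑ i : Fin (G.deg v), if v = u ∧ (G.nbr v i : Fin n) = w then 1 else 0).sum := by
  rw [edgesFrom, Multiset.count_bind]
  congr 1
  refine Multiset.map_congr rfl fun v _ => ?_
  rw [G.sum_nbr v fun x => if v = u ∧ x = w then 1 else 0]
  by_cases hv : v = u
  · subst hv
    rw [Multiset.count_map_eq_count' _ _ (Prod.mk_right_injective v)]
    simp only [true_and]
    rw [Multiset.count_eq_of_nodup (Finset.nodup _)]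
    have : ∀ x, (if G.graph.Adj v x then if x = w then 1 else 0 else 0) =
        if x = w then if G.graph.Adj v w then 1 else 0 else 0 := by
      intro x
      by_cases hx : x = w
      · simp [hx]
      · simp [hx]
    simp [this]
  · rw [Multiset.count_eq_zero_of_notMem]
    · simp [hv]
    · intro h
      obtain ⟨x, -, hx⟩ := Multiset.mem_map.1 h
      exact hv (Prod.ext_iff.1 hx).1

end AdjListGraph

/-! ### Sampling a uniform edge from D(S). -/

namespace EdgeSampling
open _root_.EdgeSampling.Expr _root_.EdgeSampling.Cmd

variable {n : ℕ} [NeZero n] {G : AdjListGraph n} {s : ℕ} {f : ℕ → Fin n}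

/-- The body of the scanning loop of `sampleEdge`. -/
def scanBody : Cmd :=
  ifLe (var vHit) 0
      (ifLe (load dsCum (var vJ)) (var vR)
        (assign vPrev (load dsCum (var vJ)))
        (block [
          assign vHit 1,
          assign vU (load dsVert (var vJ)),
          assign vIdx (var vR - var vPrev)]))
      skip

/-- Locate the edge with the index in register `vR` and query its second endpoint. -/
def locateEdge : Cmd := block [
  assign vHit 0,
  assign vPrev 0,
  loop vJ (var vS) scanBody,
  neighbor vW (var vU) (var vIdx)]

theorem sampleEdge_eq : sampleEdge = .seq (random vR (var vC)) locateEdge := rfl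

theorem scanBody_support {k : ℕ} {τ τ' : State}
    (h : τ' ∈ (scanBody.run G ((τ.setReg vJ k).tick 1)).support) :
    τ'.queries = τ.queries ∧
    ((τ.reg vHit ≤ 0 ∧ ((τ.mem dsCum k ≤ τ.reg vR ∧ τ'.reg vHit = τ.reg vHit ∧
        τ'.reg vPrev = τ.mem dsCum k) ∨
      (τ.reg vR < τ.mem dsCum k ∧ τ'.reg vHit = 1 ∧ τ'.reg vU = τ.mem dsVert k ∧
        τ'.reg vIdx = τ.reg vR - τ.reg vPrev))) ∨
    (0 < τ.reg vHit ∧ τ'.reg vHit = τ.reg vHit ∧ τ'.reg vU = τ.reg vU ∧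
      τ'.reg vIdx = τ.reg vIdx)) := by
  rcases support_ifLe h with ⟨h0, h⟩ | ⟨h0, h⟩
  · simp [eval_var, eval_ofNat, tick_reg, setReg_reg] at h0
    rcases support_ifLe h with ⟨h1, h⟩ | ⟨h1, h⟩
    · simp [eval_var, eval_load, tick_reg, setReg_reg, tick_mem, setReg_mem] at h1
      rw [support_assign h]
      refine ⟨rfl, Or.inl ⟨h0, Or.inl ⟨h1, ?_, ?_⟩⟩⟩ <;>
        simp [eval_var, eval_load, tick_reg, setReg_reg, tick_mem, setReg_mem]
    · simp [eval_var, eval_load, tick_reg, setReg_reg, tick_mem, setReg_mem] at h1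
      simp only [block, mem_support_seq] at h
      obtain ⟨τ1, hτ1, τ2, hτ2, h⟩ := h
      rw [support_assign h, support_assign hτ2, support_assign hτ1]
      refine ⟨rfl, Or.inl ⟨h0, Or.inr ⟨h1, ?_, ?_, ?_⟩⟩⟩ <;>
        simp [eval_var, eval_load, eval_ofNat, eval_sub, tick_reg, setReg_reg, tick_mem,
          setReg_mem]
  · simp [eval_var, eval_ofNat, tick_reg, setReg_reg] at h0
    simp only [Cmd.run, PMF.mem_support_pure_iff] at h
    subst h
    exact ⟨rfl, Or.inr ⟨h0, rfl, rfl, rfl⟩⟩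

/-- The partial sums of the degrees. -/
def degUpTo (G : AdjListGraph n) (f : ℕ → Fin n) (k : ℕ) : ℕ :=
  ∑ l ∈ Finset.range k, G.deg (f l)

omit [NeZero n] in
theorem degUpTo_succ (k : ℕ) :
    degUpTo G f (k + 1) = degUpTo G f k + G.deg (f k) := Finset.sum_range_succ _ _

omit [NeZero n] in
theorem degUpTo_mono : Monotone (degUpTo G f) := fun _ _ h =>
  Finset.sum_le_sum_of_subset (Finset.range_mono h)

/-- The scan stops at the first k with r < `degUpTo G f (k + 1)`. For r = `degUpTo G f j + a` with a
below the degree of `f j` this is k = j, and the last partial sum passed leaves the index a. -/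
theorem locateEdge_support {σ σ' : State} (hds : HoldsDS G s f σ) {j : ℕ} (hj : j < s)
    (a : Fin (G.deg (f j))) (hR : σ.reg vR = ((degUpTo G f j + a : ℕ) : ℝ))
    (h : σ' ∈ (locateEdge.run G σ).support) :
    σ'.reg vU = ((f j : ℕ) : ℝ) ∧ σ'.reg vW = ((G.nbr (f j) a : Fin n) : ℕ) ∧
      σ'.queries = σ.queries + 1 ∧ σ'.time ≤ σ.time + 20 + s * 40 := by
  simp only [locateEdge, block, mem_support_seq] at h
  obtain ⟨τ1, hτ1, τ2, hτ2, τ3, hτ3, h⟩ := h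
  have e1 := support_assign hτ1
  have e2 := support_assign hτ2
  have hS2 : τ2.reg vS = s := by
    rw [e2, e1]; simpa [tick_reg, setReg_reg] using hds.size
  have hN : ⌊(var vS).eval τ2⌋₊ = s := by simp [eval_var, hS2]
  have key := loop_invariant (G := G) (N := s)
    (fun k τ => τ.reg vR = σ.reg vR ∧ τ.mem = σ.mem ∧ τ.queries = σ.queries ∧
      ((τ.reg vHit = 0 ∧ τ.reg vPrev = degUpTo G f k ∧ k ≤ j) ∨
        (τ.reg vHit = 1 ∧ j < k ∧ τ.reg vU = ((f j : ℕ) : ℝ) ∧ τ.reg vIdx = ((a : ℕ) : ℝ))))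
    hN ⟨by rw [e2, e1]; simp [tick_reg, setReg_reg], by rw [e2, e1]; rfl, by rw [e2, e1]; rfl,
      Or.inl ⟨by rw [e2, e1]; simp [tick_reg, setReg_reg, eval_ofNat],
        by rw [e2, e1]; simp [tick_reg, setReg_reg, eval_ofNat, degUpTo], Nat.zero_le j⟩⟩
    (fun k hk τ hτ τ' hτ' => by
      obtain ⟨h1, h2, h3, h4⟩ := hτ
      have hcum : τ.mem dsCum k = degUpTo G f (k + 1) := by rw [h2]; exact hds.cum k hk
      obtain ⟨b1, b2⟩ := scanBody_support hτ'
      refine ⟨?_, ?_, b1.trans h3, ?_⟩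
      · rw [reg_eq_of_notMem_writes G _ _ τ' hτ' vR (by decide)]
        simpa [tick_reg, setReg_reg] using h1
      · funext c
        rw [mem_eq_of_notMem_stores G _ _ τ' hτ' c (by simp [scanBody, block, Cmd.stores]),
          tick_mem, setReg_mem, h2]
      · rw [hcum, h1, hR] at b2
        rcases b2 with ⟨c0, ⟨c1, c2, c3⟩ | ⟨c1, c2, c3, c4⟩⟩ | ⟨c0, c1, c2, c3⟩
        · rcases h4 with ⟨d1, d2, d3⟩ | ⟨d1, -⟩
          · refine Or.inl ⟨c2.trans d1, c3, ?_⟩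
            have c1' : degUpTo G f (k + 1) ≤ degUpTo G f j + a := by exact_mod_cast c1
            by_contra hne
            have : k = j := by omega
            subst this
            rw [degUpTo_succ] at c1'
            have := a.2
            omega
          · rw [d1] at c0; norm_num at c0
        · rcases h4 with ⟨d1, d2, d3⟩ | ⟨d1, -⟩
          · have c1' : degUpTo G f j + a < degUpTo G f (k + 1) := by exact_mod_cast c1
            have hkj : k = j := by
              by_contra hne
              have := degUpTo_mono (G := G) (f := f) (by omega : k + 1 ≤ j)
              omega
            subst hkj
            refine Or.inr ⟨c2, k.lt_succ_self, ?_, ?_⟩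
            · rw [c3, h2]; exact hds.vert k hk
            · rw [c4, d2]; push_cast; ring
          · rw [d1] at c0; norm_num at c0
        · rcases h4 with ⟨d1, -⟩ | ⟨d1, d2, d3, d4⟩
          · rw [d1] at c0; norm_num at c0
          · exact Or.inr ⟨c1.trans d1, d2.trans k.lt_succ_self, c2.trans d3, c3.trans d4⟩)
    τ3 hτ3
  obtain ⟨-, -, k3, k4⟩ := key
  have ht := time_loop_le (b := 40) (by decide) (by decide) hN τ3 hτ3
  have ht2 : τ2.time = σ.time + 4 := by rw [e2, e1]; rfl
  have ec : (var vS).cost = 1 := rfl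
  rcases k4 with ⟨-, -, h4⟩ | ⟨-, -, hU, hI⟩
  · omega
  · simp only [Cmd.run, PMF.mem_support_pure_iff, eval_var, hU, hI, nbrAnswer_natCast] at h
    subst h
    refine ⟨by simpa [tick_reg, query_reg, setReg_reg] using hU,
      by simp [tick_reg, query_reg, setReg_reg], ?_, ?_⟩
    · simp [State.tick, State.query, State.setReg, k3]
    · simp [State.tick, State.query, State.setReg, Expr.cost]
      omega

omit [NeZero n] in
theorem exists_degUpTo {r : ℕ} (hr : r < degUpTo G f s) :
    ∃ j < s, ∃ a : Fin (G.deg (f j)), r = degUpTo G f j + a := by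
  induction s with
  | zero => simp [degUpTo] at hr
  | succ s ih =>
    by_cases h : r < degUpTo G f s
    · obtain ⟨j, hj, a, ha⟩ := ih h
      exact ⟨j, hj.trans s.lt_succ_self, a, ha⟩
    · rw [degUpTo_succ] at hr
      exact ⟨s, s.lt_succ_self, ⟨r - degUpTo G f s, by omega⟩, by simp; omega⟩

-- Cutting the range of r at the partial sums. With this, the uniform average over r becomes the
-- count of pairs (j, a) that defines multiplicity in E(S).
omit [NeZero n] in
theorem sum_range_degUpTo {M : Type*} [AddCommMonoid M] (φ : ℕ → M) :
    ∑ r ∈ Finset.range (degUpTo G f s), φ r =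
      ∑ j ∈ Finset.range s, ∑ a : Fin (G.deg (f j)), φ (degUpTo G f j + a) := by
  induction s with
  | zero => simp [degUpTo]
  | succ s ih =>
    rw [degUpTo_succ, Finset.sum_range_add, ih, Finset.sum_range_succ, Finset.sum_range (n := G.deg (f s))]

/-- The data structure supports sampling a uniform edge. -/
theorem supportsUniformEdge_of_holdsDS {σ : State} (hds : HoldsDS G s f σ)
    (hpos : 0 < degUpTo G f s) :
    SupportsUniformEdge G 70 ((Multiset.range s).map f) σ := by
  classical
  have hM : ⌊(var vC).eval σ⌋₊ = degUpTo G f s := by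
    rw [eval_var, hds.total]; exact Nat.floor_natCast _
  have hcard : (G.edgesFrom ((Multiset.range s).map f)).card = degUpTo G f s := by
    rw [G.card_edgesFrom, AdjListGraph.degSum, Multiset.map_map]; rfl
  have hds' : ∀ (y : ℝ) (k : ℕ), HoldsDS G s f ((σ.setReg vR y).tick k) := fun y k =>
    ⟨by simpa [tick_reg, setReg_reg] using hds.size, hds.vert, hds.cum,
      by simpa [tick_reg, setReg_reg] using hds.total⟩
  refine ⟨?_, ?_, ?_⟩
  · intro h
    rw [h, Multiset.card_zero] at hcard
    omega
  · intro u w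
    rw [toOuterMeasure_eq_mean, sampleEdge_eq, mean_seq, mean_random hM hpos, hcard,
      G.count_edgesFrom, Multiset.map_map]
    congr 1
    rw [← Finset.sum_range (fun r => mean (locateEdge.run G ((σ.setReg vR ((r : ℕ) : ℝ)).tick
      ((var vC).cost + 1))) ({σ' : State | σ'.reg vU = ((u : ℕ) : ℝ) ∧
        σ'.reg vW = ((w : ℕ) : ℝ)}.indicator 1)), sum_range_degUpTo]
    change _ = ((∑ j ∈ Finset.range s, ∑ a : Fin (G.deg (f j)),
      if f j = u ∧ (G.nbr (f j) a : Fin n) = w then 1 else 0 : ℕ) : ℝ≥0∞)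
    rw [Nat.cast_sum]
    refine Finset.sum_congr rfl fun j hj => ?_
    rw [Nat.cast_sum]
    refine Finset.sum_congr rfl fun a _ => ?_
    have hmem := fun σ' h => locateEdge_support (hds' ((degUpTo G f j + a : ℕ) : ℝ)
      ((var vC).cost + 1)) (σ' := σ') (Finset.mem_range.1 hj) a
      (by simp [tick_reg, setReg_reg]) h
    have hev : ∀ σ' ∈ (locateEdge.run G ((σ.setReg vR ((degUpTo G f j + a : ℕ) : ℝ)).tick
        ((var vC).cost + 1))).support, ({σ' : State | σ'.reg vU = ((u : ℕ) : ℝ) ∧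
        σ'.reg vW = ((w : ℕ) : ℝ)}.indicator 1 σ' : ℝ≥0∞) =
        ((if f j = u ∧ (G.nbr (f j) a : Fin n) = w then 1 else 0 : ℕ) : ℝ≥0∞) := by
      intro σ' h
      obtain ⟨h1, h2, -, -⟩ := hmem σ' h
      have : σ' ∈ {σ' : State | σ'.reg vU = ((u : ℕ) : ℝ) ∧ σ'.reg vW = ((w : ℕ) : ℝ)} ↔
          f j = u ∧ (G.nbr (f j) a : Fin n) = w := by
        rw [Set.mem_ofPred_eq, h1, h2, Nat.cast_inj, Nat.cast_inj, Fin.val_inj, Fin.val_inj]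
      by_cases hh : f j = u ∧ (G.nbr (f j) a : Fin n) = w
      · rw [Set.indicator_of_mem (this.2 hh), if_pos hh]; simp
      · rw [Set.indicator_of_notMem (fun h => hh (this.1 h)), if_neg hh]; simp
    refine le_antisymm ?_ ?_
    · exact (mean_mono fun a ha => (hev a ha).le).trans (mean_const _ _).le
    · exact (mean_const _ _).ge.trans (mean_mono fun a ha => (hev a ha).ge)
  · intro σ' h
    rw [sampleEdge_eq, mem_support_seq] at h
    obtain ⟨τ, hτ, h⟩ := h
    simp only [Cmd.run, PMF.support_map, Set.mem_image] at hτ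
    obtain ⟨r, hr, rfl⟩ := hτ
    change r ∈ ((PMF.uniformOfFintype (Fin (⌊(var vC).eval σ⌋₊ - 1 + 1))).bind
      fun a => PMF.pure (a : ℕ)).support at hr
    simp only [PMF.mem_support_bind_iff, PMF.mem_support_pure_iff] at hr
    obtain ⟨b, -, rfl⟩ := hr
    have hb : (b : ℕ) < degUpTo G f s := by
      have := b.2
      omega
    obtain ⟨j, hj, a, ha⟩ := exists_degUpTo hb
    obtain ⟨-, -, h1, h2⟩ := locateEdge_support (hds' _ _) hj a
      (by simp [tick_reg, setReg_reg, ha]) h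
    have hs : 1 ≤ s := by omega
    refine ⟨h1, ?_⟩
    rw [Multiset.card_map, Multiset.card_range]
    -- The random draw and the fixed part of the scan cost at most 22 steps; since s ≥ 1 they fit
    -- into 30s beside the 40s for the loop.
    have h3 : σ'.time ≤ σ.time + 70 * s := by
      have : (((σ.setReg vR ((b : ℕ) : ℝ)).tick ((var vC).cost + 1)).time) = σ.time + 2 := rfl
      omega
    exact_mod_cast h3

end EdgeSampling

/-! ### Parameters, and the running time after the estimate. -/

namespace EdgeSampling
open _root_.EdgeSampling.Expr _root_.EdgeSampling.Cmd

/-- The number of samples. -/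
noncomputable def numSamples (δ : ℝ) : ℕ := ⌈Real.logb 3 (3 / δ)⌉₊

/-- Compute the parameters from the estimate of the average degree. -/
def setParameters : Cmd := block [
  assign vXbar (sqrt (var vN / var vDbar)),
  ifLe (var vX) (var vXbar) (assign vXbar (var vX)) skip,
  assign vT (ceil (log (3 / var vDelta) / log 3)),
  assign vTau (var vXbar * var vDbar / var vEps),
  assign vS (ceil (var vN / var vTau *
    (35 * log (6 * var vN * var vT / var vDelta) / (var vEps * var vEps))))]

/-- Set up the data structure for the chosen sample, or fail if there is none. -/
def finish : Cmd :=
  ifLe (var vFound) 0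
    (assign vOk 0)
    (block [
      buildDS,
      assign vGamma (load aSum (var vK) / (var vDbar * var vS)),
      assign vOk 1])

/-- The part of the preprocessing after the estimation of the average degree. -/
def afterEstimate : Cmd := .seq setParameters (.seq sampleSets (.seq chooseSet finish))

section Numeric

variable {n : ℕ} {ε δ : ℝ}

theorem numSamples_cast (hδ : 0 < δ) (hδ1 : δ < 1) :
    (⌈Real.logb 3 (3 / δ)⌉ : ℝ) = (numSamples δ : ℝ) := by
  refine (natCast_ceil_eq_intCast_ceil ?_).symm
  refine Real.logb_nonneg (by norm_num) ?_
  rw [le_div_iff₀ hδ]; linarith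

theorem one_le_numSamples (hδ : 0 < δ) (hδ1 : δ < 1) : 1 ≤ numSamples δ := by
  refine Nat.one_le_ceil_iff.2 (Real.logb_pos (by norm_num) ?_)
  rw [lt_div_iff₀ hδ]; linarith

theorem one_third_pow_numSamples_le (hδ : 0 < δ) : (1 / 3 : ℝ) ^ numSamples δ ≤ δ / 3 := by
  have h : Real.logb 3 (3 / δ) ≤ numSamples δ := Nat.le_ceil _
  rw [Real.logb_le_iff_le_rpow (by norm_num) (by positivity), Real.rpow_natCast] at h
  rw [div_pow, one_pow, div_le_div_iff₀ (by positivity) (by norm_num)]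
  rw [div_le_iff₀ hδ] at h
  linarith

/-- The logarithm in the sample size. -/
noncomputable def sampleLog (n : ℕ) (δ : ℝ) : ℝ := Real.log (6 * n * numSamples δ / δ)

theorem one_lt_sampleLog_arg (hn : 1 ≤ n) (hδ : 0 < δ) (hδ1 : δ < 1) :
    1 < 6 * (n : ℝ) * numSamples δ / δ := by
  have h1 : (1 : ℝ) ≤ numSamples δ := by exact_mod_cast one_le_numSamples hδ hδ1
  have h2 : (1 : ℝ) ≤ n := by exact_mod_cast hn
  rw [lt_div_iff₀ hδ]
  nlinarith

theorem sampleLog_pos (hn : 1 ≤ n) (hδ : 0 < δ) (hδ1 : δ < 1) : 0 < sampleLog n δ :=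
  Real.log_pos (one_lt_sampleLog_arg hn hδ hδ1)

/-- The logarithm in the sample size is tuned to a union bound over about 2n tail events in each of
the t samples. -/
theorem exp_neg_sampleLog (hn : 1 ≤ n) (hδ : 0 < δ) (hδ1 : δ < 1) :
    Real.exp (-sampleLog n δ) = δ / (6 * n * numSamples δ) := by
  rw [sampleLog, ← Real.log_inv, Real.exp_log, inv_div]
  have := one_lt_sampleLog_arg hn hδ hδ1
  positivity

theorem sampleSize_eq {T : ℝ} (hδ : 0 < δ) (hδ1 : δ < 1) :
    sampleSize n ε δ T = ⌈(n : ℝ) / T * (35 * sampleLog n δ / ε ^ 2)⌉₊ := by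
  rw [sampleSize, sampleLog, numSamples_cast hδ hδ1]

end Numeric

variable {n : ℕ} [NeZero n] {G : AdjListGraph n}

theorem run_preprocessing (A : Cmd) (σ : State) : (preprocessing A).run G σ =
    (Cmd.seq (call vDbar A [var vN, var vEps, var vDelta / 3]) afterEstimate).run G σ := by
  simp only [preprocessing, afterEstimate, setParameters, finish, block, Cmd.run, PMF.bind_bind]

/-- The registers after `setParameters`. -/
structure Parameters (n : ℕ) (ε δ x D : ℝ) (σ : State) : Prop where
  dbar : σ.reg vDbar = D
  xbar : σ.reg vXbar = min x (Real.sqrt (n / D))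
  tau : σ.reg vTau = min x (Real.sqrt (n / D)) * D / ε
  rounds : σ.reg vT = numSamples δ
  size : σ.reg vS = sampleSize n ε δ (min x (Real.sqrt (n / D)) * D / ε)

theorem setParameters_support {ε δ x D : ℝ} {σ σ' : State} (hε : 0 < ε) (hδ : 0 < δ)
    (hδ1 : δ < 1) (hx : 0 < x) (hD : 0 < D) (h0 : σ.reg vN = n) (h1 : σ.reg vEps = ε)
    (h2 : σ.reg vDelta = δ) (h3 : σ.reg vX = x) (h4 : σ.reg vDbar = D)
    (h : σ' ∈ (setParameters.run G σ).support) :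
    Parameters n ε δ x D σ' ∧ σ'.time ≤ σ.time + 60 := by
  have hn1 : 1 ≤ n := NeZero.pos n
  have hn : (0 : ℝ) < n := by exact_mod_cast NeZero.pos n
  refine ⟨?_, (time_le_maxCost G _ (by decide) _ _ h).trans
    (Nat.add_le_add_left (by decide) _)⟩
  have hf := reg_eq_of_notMem_writes G _ _ σ' h
  simp only [setParameters, block, mem_support_seq] at h
  obtain ⟨τ1, e1, τ2, e2, τ3, e3, τ4, e4, e5⟩ := h
  have e1 := support_assign e1
  have f1 : ∀ r ≠ vXbar, τ1.reg r = σ.reg r := fun r hr => by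
    rw [e1]; simp [tick_reg, setReg_reg, hr]
  have g1 : τ1.reg vXbar = Real.sqrt (n / D) := by
    rw [e1]; simp [tick_reg, setReg_reg, eval_sqrt, eval_div, eval_var, h0, h4]
  have f2 : ∀ r ≠ vXbar, τ2.reg r = σ.reg r := fun r hr => by
    rw [reg_eq_of_notMem_writes G _ _ τ2 e2 r (by simpa [Cmd.writes] using hr), f1 r hr]
  have g2 : τ2.reg vXbar = min x (Real.sqrt (n / D)) := by
    rcases support_ifLe e2 with ⟨hle, e2⟩ | ⟨hlt, e2⟩
    · rw [eval_var, eval_var, g1, f1 vX (by decide), h3] at hle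
      rw [support_assign e2, min_eq_left hle]
      simp [tick_reg, setReg_reg, eval_var, f1, h3]
    · rw [eval_var, eval_var, g1, f1 vX (by decide), h3] at hlt
      simp only [Cmd.run, PMF.mem_support_pure_iff] at e2
      rw [e2, min_eq_right hlt.le, tick_reg, tick_reg, g1]
  have e3 := support_assign e3
  have e4 := support_assign e4
  have e5 := support_assign e5
  set X := min x (Real.sqrt (n / D)) with hX
  have hX0 : 0 < X := lt_min hx (Real.sqrt_pos.2 (by positivity))
  have g3 : τ3.reg vT = numSamples δ := by
    rw [← numSamples_cast hδ hδ1, e3]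
    simp [tick_reg, setReg_reg, eval_ceil, eval_div, eval_log, eval_var, eval_ofNat, f2, h2,
      Real.logb]
  have f3 : ∀ r ≠ vT, τ3.reg r = τ2.reg r := fun r hr => by
    rw [e3]; simp [tick_reg, setReg_reg, hr]
  have g4 : τ4.reg vTau = X * D / ε := by
    rw [e4]
    simp [tick_reg, setReg_reg, eval_div, eval_mul, eval_var, f3, f2, g2, h1, h4]
  have f4 : ∀ r ≠ vTau, τ4.reg r = τ3.reg r := fun r hr => by
    rw [e4]; simp [tick_reg, setReg_reg, hr]
  have f5 : ∀ r ≠ vS, σ'.reg r = τ4.reg r := fun r hr => by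
    rw [e5]; simp [tick_reg, setReg_reg, hr]
  refine ⟨(hf vDbar (by decide)).trans h4, ?_, ?_, ?_, ?_⟩
  · rw [f5 _ (by decide), f4 _ (by decide), f3 _ (by decide), g2]
  · rw [f5 _ (by decide), g4]
  · rw [f5 _ (by decide), f4 _ (by decide), g3]
  · have hpos : 0 ≤ (n : ℝ) / (X * D / ε) * (35 * sampleLog n δ / ε ^ 2) := by
      have := sampleLog_pos hn1 hδ hδ1
      positivity
    rw [sampleSize_eq hδ hδ1, natCast_ceil_eq_intCast_ceil hpos, e5]
    simp [tick_reg, setReg_reg, eval_ceil, eval_div, eval_log, eval_mul, eval_var, eval_ofNat, f4,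
      f3, f2, h0, h1, h2, g3, g4, sampleLog, sq]

/-- The time used after the estimation of the average degree. -/
theorem afterEstimate_time {ε δ x D : ℝ} {σ σ' : State} (hε : 0 < ε) (hδ : 0 < δ)
    (hδ1 : δ < 1) (hx : 0 < x) (hD : 0 < D) (h0 : σ.reg vN = n) (h1 : σ.reg vEps = ε)
    (h2 : σ.reg vDelta = δ) (h3 : σ.reg vX = x) (h4 : σ.reg vDbar = D)
    (h : σ' ∈ (afterEstimate.run G σ).support) :
    σ'.time ≤ σ.time + 100 + 100 * (numSamples δ *
      (sampleSize n ε δ (min x (Real.sqrt (n / D)) * D / ε) + 1)) := by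
  simp only [afterEstimate, mem_support_seq] at h
  obtain ⟨τ1, e1, τ2, e2, τ3, e3, e4⟩ := h
  obtain ⟨p, t1⟩ := setParameters_support hε hδ hδ1 hx hD h0 h1 h2 h3 h4 e1
  have t2 := (sampleSets_support p.size p.rounds e2).time
  have hT : τ2.reg vT = numSamples δ :=
    (reg_eq_of_notMem_writes G _ _ τ2 e2 vT (by decide)).trans p.rounds
  have t3 := (chooseSet_support hT e3).2
  have hS : τ3.reg vS = sampleSize n ε δ (min x (Real.sqrt (n / D)) * D / ε) := by
    rw [reg_eq_of_notMem_writes G _ _ τ3 e3 vS (by decide),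
      reg_eq_of_notMem_writes G _ _ τ2 e2 vS (by decide), p.size]
  set s := sampleSize n ε δ (min x (Real.sqrt (n / D)) * D / ε)
  have ht : 1 ≤ numSamples δ := one_le_numSamples hδ hδ1
  have t4 : σ'.time ≤ τ3.time + 30 + s * 40 := by
    rcases support_ifLe e4 with ⟨-, e4⟩ | ⟨-, e4⟩
    · have := time_le_maxCost G _ (by decide) _ _ e4
      have e : (τ3.tick ((var vFound).cost + cost 0 + 1)).time = τ3.time + 3 := rfl
      have e' : (assign vOk 0).maxCost = 2 := rfl
      omega
    · simp only [block, mem_support_seq] at e4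
      obtain ⟨τ4, e4, e5⟩ := e4
      have t5 := time_le_maxCost G (.seq (assign vGamma (load aSum (var vK) /
        (var vDbar * var vS))) (assign vOk 1)) (by decide) _ _ (mem_support_seq.2 e5)
      have e' : (Cmd.seq (assign vGamma (load aSum (var vK) /
        (var vDbar * var vS))) (assign vOk 1)).maxCost = 9 := rfl
      have e : (τ3.tick ((var vFound).cost + cost 0 + 1)).time = τ3.time + 3 := rfl
      simp only [buildDS] at e4
      rw [block, block] at e4
      swap
      · simp
      rw [mem_support_seq] at e4
      obtain ⟨τ5, e6, e4⟩ := e4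
      have e6 := support_assign e6
      have hS5 : τ5.reg vS = s := by rw [e6]; simpa [tick_reg, setReg_reg] using hS
      have t6 := time_loop_le (b := 40) (by decide) (by decide)
        (show ⌊(var vS).eval τ5⌋₊ = s by simp [eval_var, hS5]) τ4 e4
      have e7 : τ5.time = τ3.time + 5 := by rw [e6]; rfl
      have e8 : (var vS).cost = 1 := rfl
      omega
  have hs : s * 40 ≤ numSamples δ * s * 40 := by nlinarith
  have e9 : numSamples δ * (11 + s * 40) = 11 * numSamples δ + numSamples δ * s * 40 := by ring
  have e10 : 100 * (numSamples δ * (s + 1)) = 100 * (numSamples δ * s) + 100 * numSamples δ := by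
    ring
  omega

end EdgeSampling

/-! ### Success probability after the estimate. -/

namespace EdgeSampling
open _root_.EdgeSampling.Expr _root_.EdgeSampling.Cmd

variable {n : ℕ} [NeZero n] {G : AdjListGraph n} {i s : ℕ}

theorem SupportsUniformEdge.mono {C C' : ℝ} (h : C ≤ C') {S : Multiset (Fin n)} {σ : State}
    (hS : SupportsUniformEdge G C S σ) : SupportsUniformEdge G C' S σ :=
  ⟨hS.1, hS.2.1, fun σ' hσ' => ⟨(hS.2.2 σ' hσ').1, (hS.2.2 σ' hσ').2.trans (by gcongr)⟩⟩

/-- Some sample is bad, or all samples have too many edges. -/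
def SamplesFail (G : AdjListGraph n) (ε T : ℝ) (s t : ℕ) (τ : State) : Prop :=
  (∃ i < t, BadSample G ε T (sampleAt n s τ i)) ∨
    ∀ i < t, 6 * (s * G.davg) ≤ G.degSum (sampleAt n s τ i)

/-- The procedure succeeds if the samples do not fail. -/
theorem successful_of_samples {ε δ x D C : ℝ} {τ1 τ2 τ3 σ' : State} (hε2 : ε < 1 / 2)
    (hm : 0 < G.m) (hx : 1 ≤ x) (hD : 0 < D) (hgood : G.GoodEstimate ε D) (hC : 70 ≤ C)
    (hs : 0 < sampleSize n ε δ (min x (Real.sqrt (n / D)) * D / ε))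
    (p : Parameters n ε δ x D τ1)
    (h2 : τ2 ∈ (sampleSets.run G τ1).support)
    (hfail : ¬ SamplesFail G ε (min x (Real.sqrt (n / D)) * D / ε)
      (sampleSize n ε δ (min x (Real.sqrt (n / D)) * D / ε)) (numSamples δ) τ2)
    (h3 : τ3 ∈ (chooseSet.run G τ2).support) (h4 : σ' ∈ (finish.run G τ3).support) :
    Successful G ε δ C σ' := by
  have hd := G.davg_pos hm
  set T := min x (Real.sqrt (n / D)) * D / ε with hT
  set s := sampleSize n ε δ T with hsdef
  set t := numSamples δ with ht
  have hs' : (0 : ℝ) < s := by exact_mod_cast hs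
  have inv := sampleSets_support p.size p.rounds h2
  have w2 := reg_eq_of_notMem_writes G _ _ τ2 h2
  have w3 := reg_eq_of_notMem_writes G _ _ τ3 h3
  have w4 := reg_eq_of_notMem_writes G _ _ σ' h4
  have hT2 : τ2.reg vT = t := (w2 vT (by decide)).trans p.rounds
  have hD2 : τ2.reg vDbar = D := (w2 vDbar (by decide)).trans p.dbar
  have hS2 : τ2.reg vS = s := inv.size
  have hS3 : τ3.reg vS = s := (w3 vS (by decide)).trans hS2
  have hm3 : τ3.mem = τ2.mem := by
    funext a
    exact mem_eq_of_notMem_stores G _ _ τ3 h3 a (by simp [chooseSet, block, Cmd.stores])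
  simp only [SamplesFail, not_or, not_exists, not_and, not_forall, not_le] at hfail
  obtain ⟨hbad, i0, hi0, hlight⟩ := hfail
  have hlow : ∀ i < t, s * G.davg / 4 ≤ G.degSum (sampleAt n s τ2 i) := by
    intro i hi
    have := hbad i hi
    simp only [BadSample, not_or, not_lt, card_sampleAt] at this
    exact this.2
  have hpass : PassesFilter τ2 i0 := by
    rw [PassesFilter, inv.sum i0 hi0, hD2, hS2]
    have := hlow i0 hi0
    have h1 := hgood.1
    have h2 := hgood.2
    constructor
    · rw [le_div_iff₀ hs']; nlinarith
    · rw [div_le_iff₀ hs']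
      -- This is where the 6 of `heavySample_le` meets the 12 of the filter: 12D ≥ 6d, because D ≥
      -- (1 - ε)d ≥ d/2.
      have : 1 / 2 * G.davg ≤ D := by nlinarith
      nlinarith
  rcases (chooseSet_support hT2 h3).1 with ⟨-, hno⟩ | ⟨hfound, i, hi, hK, hpi⟩
  · exact absurd hpass (hno i0 hi0)
  rw [PassesFilter, inv.sum i hi, hD2, hS2] at hpi
  rcases support_ifLe h4 with ⟨hle, -⟩ | ⟨-, h4⟩
  · simp [eval_var, eval_ofNat, hfound] at hle
    norm_num at hle
  simp only [block, mem_support_seq] at h4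
  obtain ⟨τ4, h4, τ5, h5, h6⟩ := h4
  have hds := (buildDS_support (G := G) (i := i) (s := s)
    (f := fun j => cellVertex n τ2 (i * s + j))
    (by simpa [tick_reg] using hK) (by simpa [tick_reg] using hS3)
    (fun j hj => by rw [tick_mem, hm3]; exact inv.sample _ (cell_lt hi hj))
    (fun j hj => by rw [tick_mem, hm3]; exact inv.deg _ (cell_lt hi hj)) h4).1
  have w5 := reg_eq_of_notMem_writes G _ _ τ4 h4
  have e5 := support_assign h5
  have e6 := support_assign h6
  have hf : ∀ r, r ≠ vGamma → r ≠ vOk → σ'.reg r = τ4.reg r := fun r hr hr' => by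
    rw [e6, e5]; simp [tick_reg, setReg_reg, hr, hr']
  have hmem : σ'.mem = τ4.mem := by rw [e6, e5]; rfl
  have hds' : HoldsDS G s (fun j => cellVertex n τ2 (i * s + j)) σ' :=
    ⟨by rw [hf _ (by decide) (by decide)]; exact hds.size, by rw [hmem]; exact hds.vert,
      by rw [hmem]; exact hds.cum, by rw [hf _ (by decide) (by decide)]; exact hds.total⟩
  have hD' : σ'.reg vDbar = D := (w4 vDbar (by decide)).trans ((w3 vDbar (by decide)).trans hD2)
  have hX' : σ'.reg vXbar = min x (Real.sqrt (n / D)) :=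
    (w4 vXbar (by decide)).trans ((w3 vXbar (by decide)).trans
      ((w2 vXbar (by decide)).trans p.xbar))
  have hT' : σ'.reg vTau = T :=
    (w4 vTau (by decide)).trans ((w3 vTau (by decide)).trans ((w2 vTau (by decide)).trans p.tau))
  have hpos : 0 < degUpTo G (fun j => cellVertex n τ2 (i * s + j)) s := by
    have := hlow i hi
    rw [degSum_sampleAt] at this
    have h0 : 0 < s * G.davg / 4 := by positivity
    have := h0.trans_le this
    exact_mod_cast this
  have hGamma : σ'.reg vGamma = (G.degSum (sampleAt n s τ2 i) : ℝ) / (D * s) := by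
    have hsum : τ4.mem aSum i = G.degSum (sampleAt n s τ2 i) := by
      rw [mem_eq_of_notMem_stores G _ _ τ4 h4 aSum (by decide), tick_mem, hm3, inv.sum i hi]
    have hK4 : τ4.reg vK = i := (w5 vK (by decide)).trans hK
    have hD4 : τ4.reg vDbar = D := (hf vDbar (by decide) (by decide)).symm.trans hD'
    rw [e6, e5]
    simp [tick_reg, setReg_reg, eval_div, eval_mul, eval_load, eval_var, hK4, hD4, hsum, hds.size]
  refine ⟨by rw [e6]; simp [tick_reg, setReg_reg, eval_ofNat], ⟨sampleAt n s τ2 i, ?_, ?_, ?_, ?_⟩,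
    ?_, ?_, ?_, ?_⟩
  · rw [card_sampleAt, hT']
  · rw [hT']
    have hb := hbad i hi
    rw [BadSample, not_or] at hb
    refine ⟨fun v hv => by_contra fun h => hb.1 ⟨v, hv, h⟩, ?_, ?_⟩
    · rw [card_sampleAt, le_div_iff₀ hs']
      have := hlow i hi
      linarith
    · rw [card_sampleAt]
      exact hpi.2.trans (mul_le_mul_of_nonneg_left hgood.2 (by norm_num))
  · exact (supportsUniformEdge_of_holdsDS hds' hpos).mono hC
  · rw [hGamma, hD', card_sampleAt]
  · rw [hX']
    refine le_min hx (Real.one_le_sqrt.2 ?_)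
    rw [le_div_iff₀ hD, one_mul]
    exact hgood.2.trans G.davg_le
  · rw [hX', hD']; exact min_le_right _ _
  · rw [hT', hX', hD']
  · rw [hD']; exact hgood

/-- Bad samples cost δ/3 + δ/(6n) and the event that all samples are heavy costs at most δ/3. The
rest of δ is left for the estimate. -/
theorem samplesFail_numeric {t n : ℕ} {δ : ℝ} (hn : 2 ≤ n) (ht : 1 ≤ t) (hδ : 0 < δ)
    (h3 : (1 / 3 : ℝ) ^ t ≤ δ / 3) :
    t * ((2 * n + 1) * (δ / (6 * n * t))) + (1 / 6) ^ t ≤ 2 / 3 * δ + δ / 12 := by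
  have hn' : (2 : ℝ) ≤ n := by exact_mod_cast hn
  have ht' : (1 : ℝ) ≤ t := by exact_mod_cast ht
  have h1 : (t : ℝ) * ((2 * n + 1) * (δ / (6 * n * t))) = δ / 3 + δ / (6 * n) := by
    field_simp; ring
  have h2 : δ / (6 * n) ≤ δ / 12 := by
    gcongr; linarith
  have h4 : (1 / 6 : ℝ) ^ t ≤ (1 / 3) ^ t := by gcongr; norm_num
  linarith

theorem sqrt_div_mul {a b : ℝ} (hb : 0 < b) : Real.sqrt (a / b) * b = Real.sqrt (a * b) := by
  rw [show a * b = a / b * b ^ 2 by field_simp, Real.sqrt_mul' _ (sq_nonneg b),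
    Real.sqrt_sq hb.le]

/-- After a good estimate, the procedure rarely fails. -/
theorem afterEstimate_prob {ε δ x D C : ℝ} {σ : State} (hm : 0 < G.m) (hε : 0 < ε)
    (hε2 : ε < 1 / 2) (hδ : 0 < δ) (hδ1 : δ < 1) (hx : 1 ≤ x) (hgood : G.GoodEstimate ε D)
    (hC : 70 ≤ C) (h0 : σ.reg vN = n) (h1 : σ.reg vEps = ε)
    (h2 : σ.reg vDelta = δ) (h3 : σ.reg vX = x) (h4 : σ.reg vDbar = D) :
    (afterEstimate.run G σ).toOuterMeasure {σ' | Successful G ε δ C σ'}ᶜ ≤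
      ENNReal.ofReal (2 / 3 * δ + δ / 12) := by
  have hn1 : 1 ≤ n := NeZero.pos n
  have hn : (0 : ℝ) < n := by exact_mod_cast NeZero.pos n
  have hd := G.davg_pos hm
  have hD : 0 < D := lt_of_lt_of_le (mul_pos (by linarith) hd) hgood.1
  set X := min x (Real.sqrt (n / D)) with hX
  have hX0 : 0 < X := lt_min (by linarith) (Real.sqrt_pos.2 (by positivity))
  set T := X * D / ε with hT
  have hT0 : 0 < T := by positivity
  set s := sampleSize n ε δ T with hsdef
  have hL := sampleLog_pos hn1 hδ hδ1
  have hs1 : n / T * (35 * sampleLog n δ / ε ^ 2) ≤ s := by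
    rw [hsdef, sampleSize_eq hδ hδ1]; exact Nat.le_ceil _
  have hs0 : 0 < s := by
    have : 0 < n / T * (35 * sampleLog n δ / ε ^ 2) := by positivity
    exact_mod_cast this.trans_le hs1
  have hs2 : 32 * sampleLog n δ ≤ s * Real.sqrt (G.davg / n) := by
    -- Capping x at √(n/D) is what makes the sample large enough for the degree sum: it forces T ≤
    -- √(dn)/ε, hence s√(d/n) ≥ 35L/ε.
    have a1 : T ≤ n * Real.sqrt (G.davg / n) / ε := by
      refine div_le_div_of_nonneg_right ?_ hε.le
      calc X * D ≤ Real.sqrt (n / D) * D :=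
            mul_le_mul_of_nonneg_right (min_le_right _ _) hD.le
        _ = Real.sqrt (n * D) := sqrt_div_mul hD
        _ ≤ Real.sqrt (G.davg * n) := by
            rw [mul_comm]
            exact Real.sqrt_le_sqrt (mul_le_mul_of_nonneg_right hgood.2 hn.le)
        _ = n * Real.sqrt (G.davg / n) := by rw [← sqrt_div_mul hn, mul_comm]
    have a2 : ε ≤ n / T * Real.sqrt (G.davg / n) := by
      rw [div_mul_eq_mul_div, le_div_iff₀ hT0]
      calc ε * T ≤ ε * (n * Real.sqrt (G.davg / n) / ε) := by gcongr
        _ = _ := by field_simp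
    have a3 := mul_le_mul_of_nonneg_right hs1 (Real.sqrt_nonneg (G.davg / n))
    have a4 : ε * (35 * sampleLog n δ / ε ^ 2) ≤
        n / T * Real.sqrt (G.davg / n) * (35 * sampleLog n δ / ε ^ 2) := by gcongr
    have a5 : ε * (35 * sampleLog n δ / ε ^ 2) = 35 * sampleLog n δ / ε := by field_simp
    have a6 : 35 * sampleLog n δ ≤ 35 * sampleLog n δ / ε := by
      rw [le_div_iff₀ hε]; nlinarith
    have a7 : n / T * (35 * sampleLog n δ / ε ^ 2) * Real.sqrt (G.davg / n) =
      n / T * Real.sqrt (G.davg / n) * (35 * sampleLog n δ / ε ^ 2) := by ring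
    linarith
  have hprob : ∀ τ, Parameters n ε δ x D τ → (sampleSets.run G τ).toOuterMeasure
      {τ' | SamplesFail G ε T s (numSamples δ) τ'} ≤ ENNReal.ofReal (2 / 3 * δ + δ / 12) := by
    intro τ p
    refine (sampleSets_prob (G := G) (H := fun S => 6 * (s * G.davg) ≤ G.degSum S) p.size p.rounds
      (fun i τ hI hS => badSample_le hI hS hm hε hε2 hT0 hL.le hs1 hs2)
      (fun i τ hI hS => heavySample_le hI hS hs0 hm)).trans ?_
    rw [exp_neg_sampleLog hn1 hδ hδ1, ← ENNReal.ofReal_natCast,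
      ← ENNReal.ofReal_mul (Nat.cast_nonneg _), ← ENNReal.ofReal_pow (by norm_num),
      ← ENNReal.ofReal_add (by positivity) (by positivity)]
    exact ENNReal.ofReal_le_ofReal (samplesFail_numeric (G.two_le_of_m_pos hm)
      (one_le_numSamples hδ hδ1) hδ (one_third_pow_numSamples_le hδ))
  rw [afterEstimate, toOuterMeasure_eq_mean, mean_seq]
  refine mean_le_of_forall_le fun τ1 hτ1 => ?_
  obtain ⟨p, -⟩ := setParameters_support hε hδ hδ1 (by linarith) hD h0 h1 h2 h3 h4 hτ1
  refine le_trans ?_ (hprob τ1 p)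
  rw [mean_seq, toOuterMeasure_eq_mean]
  refine mean_mono fun τ2 hτ2 => ?_
  by_cases hfail : SamplesFail G ε T s (numSamples δ) τ2
  · rw [Set.indicator_of_mem (a := τ2) (by exact hfail)]
    refine mean_le_of_forall_le fun a _ => ?_
    exact Set.indicator_le_self _ _ _
  · refine le_trans (mean_le_of_forall_le (c := 0) fun σ' hσ' => ?_) zero_le
    obtain ⟨τ3, hτ3, hσ'⟩ := mem_support_seq.1 hσ'
    rw [Set.indicator_of_notMem]
    simp only [Set.mem_compl_iff, not_not]
    exact successful_of_samples hε2 hm hx hD hgood hC hs0 p hτ2 hfail hτ3 hσ'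

end EdgeSampling

/-! ### Numerical bounds and the expected running time. -/

namespace EdgeSampling
open _root_.EdgeSampling.Expr _root_.EdgeSampling.Cmd

section Numeric

variable {n : ℕ} {ε δ : ℝ}

/-- The logarithm in the complexity bound. -/
noncomputable def boundLog (n : ℕ) (δ : ℝ) : ℝ := Real.log (n * Real.log (3 / δ) / δ)

theorem boundLog_arg (hn : 2 ≤ n) (hδ : 0 < δ) (hδ1 : δ < 1) :
    1 ≤ Real.log (3 / δ) ∧ n / δ ≤ n * Real.log (3 / δ) / δ ∧ 2 ≤ n / δ := by
  have hn2 : (2 : ℝ) ≤ n := by exact_mod_cast hn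
  have h1 : 1 ≤ Real.log (3 / δ) := by
    rw [Real.le_log_iff_exp_le (by positivity)]
    have : 3 ≤ 3 / δ := by rw [le_div_iff₀ hδ]; linarith
    linarith [Real.exp_one_lt_d9]
  refine ⟨h1, ?_, ?_⟩
  · gcongr
    exact le_mul_of_one_le_right (by linarith) h1
  · rw [le_div_iff₀ hδ]; nlinarith

/-- The logarithm of anything polynomial in n log(3/δ)/δ is a constant multiple of the logarithm in
the target bound. The other logarithms of the analysis are reduced to it in this way. -/
theorem log_le_mul_boundLog {y : ℝ} {k : ℕ} (hn : 2 ≤ n) (hδ : 0 < δ) (hδ1 : δ < 1) (hy : 0 < y)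
    (h : y ≤ (n * Real.log (3 / δ) / δ) ^ k) : Real.log y ≤ k * boundLog n δ := by
  obtain ⟨-, h2, h3⟩ := boundLog_arg hn hδ hδ1
  rw [boundLog, ← Real.log_pow]
  exact Real.log_le_log hy h

theorem half_le_boundLog (hn : 2 ≤ n) (hδ : 0 < δ) (hδ1 : δ < 1) : 1 / 2 ≤ boundLog n δ := by
  obtain ⟨-, h2, h3⟩ := boundLog_arg hn hδ hδ1
  have := log_le_mul_boundLog (k := 1) (y := 2) hn hδ hδ1 (by norm_num) (by rw [pow_one]; linarith)
  have h4 := Real.log_two_gt_d9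
  push_cast at this
  linarith

theorem numRounds_le_boundLog (hn : 2 ≤ n) (hδ : 0 < δ) (hδ1 : δ < 1) :
    (numRounds n : ℝ) ≤ 11 * boundLog n δ := by
  obtain ⟨-, h2, h3⟩ := boundLog_arg hn hδ hδ1
  have hn2 : (2 : ℝ) ≤ n := by exact_mod_cast hn
  have h5 : (n : ℝ) ≤ n / δ := by rw [le_div_iff₀ hδ]; nlinarith
  have := log_le_mul_boundLog (k := 1) (y := n) hn hδ hδ1 (by linarith) (by rw [pow_one]; linarith)
  have h4 := half_le_boundLog hn hδ hδ1
  have := numRounds_le n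
  push_cast at *
  linarith

theorem numSamples_le_boundLog (hn : 2 ≤ n) (hδ : 0 < δ) (hδ1 : δ < 1) :
    (numSamples δ : ℝ) ≤ 2 * Real.log (3 / δ) ∧ (numSamples δ : ℝ) ≤ 4 * boundLog n δ := by
  obtain ⟨h1, h2, h3⟩ := boundLog_arg hn hδ hδ1
  have hlog3 : 1 ≤ Real.log 3 := by
    rw [Real.le_log_iff_exp_le (by norm_num)]
    linarith [Real.exp_one_lt_d9]
  have h4 : (numSamples δ : ℝ) ≤ 2 * Real.log (3 / δ) := by
    have h5 : Real.logb 3 (3 / δ) ≤ Real.log (3 / δ) := div_le_self (by linarith) hlog3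
    have h6 : 0 ≤ Real.logb 3 (3 / δ) := div_nonneg (by linarith) (by linarith)
    have := (Nat.ceil_lt_add_one h6).le
    unfold numSamples
    linarith
  refine ⟨h4, h4.trans ?_⟩
  have := log_le_mul_boundLog (k := 2) (y := 3 / δ) hn hδ hδ1 (by positivity) (by
    have hn2 : (2 : ℝ) ≤ n := by exact_mod_cast hn
    calc 3 / δ ≤ (2 / δ) ^ 2 := by
          rw [div_pow, div_le_div_iff₀ hδ (by positivity)]
          nlinarith [sq_nonneg δ]
      _ ≤ (n * Real.log (3 / δ) / δ) ^ 2 := by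
          gcongr
          nlinarith)
  push_cast at this
  linarith

theorem sampleLog_le_boundLog (hn : 2 ≤ n) (hδ : 0 < δ) (hδ1 : δ < 1) :
    sampleLog n δ ≤ 5 * boundLog n δ := by
  obtain ⟨h1, h2, h3⟩ := boundLog_arg hn hδ hδ1
  have h4 := (numSamples_le_boundLog hn hδ hδ1).1
  have h5 := one_lt_sampleLog_arg (by omega : 1 ≤ n) hδ hδ1
  refine log_le_mul_boundLog (k := 5) hn hδ hδ1 (by linarith) ?_
  set Z := n * Real.log (3 / δ) / δ with hZ
  have hZ2 : 2 ≤ Z := by linarith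
  calc 6 * n * numSamples δ / δ ≤ 6 * n * (2 * Real.log (3 / δ)) / δ := by gcongr
    _ = 12 * Z := by rw [hZ]; ring
    _ ≤ Z ^ 4 * Z := by
        gcongr
        calc (12 : ℝ) ≤ 2 ^ 4 := by norm_num
          _ ≤ Z ^ 4 := by gcongr
    _ = Z ^ 5 := by ring

theorem roundFactor_le (hn : 2 ≤ n) (hε : 0 < ε) (hδ : 0 < δ) (hδ1 : δ < 1) :
    roundFactor n ε (δ / 3) ≤ 2 ^ 18 * (3 * boundLog n δ) / (ε * ε * Real.sqrt ε) := by
  obtain ⟨h1, h2, h3⟩ := boundLog_arg hn hδ hδ1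
  have hn2 : (2 : ℝ) ≤ n := by exact_mod_cast hn
  have hr := Real.sqrt_pos.2 hε
  have h4 : Real.log (n / (δ / 3)) ≤ 3 * boundLog n δ := by
    refine log_le_mul_boundLog (k := 3) hn hδ hδ1 (by positivity) ?_
    calc (n : ℝ) / (δ / 3) = 3 * (n / δ) := by field_simp
      _ ≤ 2 ^ 2 * (n / δ) := by gcongr; norm_num
      _ ≤ (n / δ) ^ 2 * (n / δ) := by gcongr
      _ = (n / δ) ^ 3 := by ring
      _ ≤ _ := by gcongr
  unfold roundFactor
  refine div_le_div_of_nonneg_right ?_ (by positivity)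
  linarith

/-- A bound for the running time in terms of a bound `Y` for the number of repetitions. -/
noncomputable def timeBound (n : ℕ) (ε δ Y : ℝ) : ℝ :=
  168 + 160 * numRounds n + 320 * (roundFactor n ε (δ / 3) * Y) +
    100 * (numSamples δ * (35 * sampleLog n δ / ε * (4 * Y) + 2))

/-- Write l for the logarithm. The search contributes lY/ε^2.5 and the t samples contribute l ·
lY/ε, which is the source of the square. Everything else is absorbed because l ≥ 1/2, Y ≥ 1 and ε <
1. -/
theorem timeBound_le {Y : ℝ} (hn : 2 ≤ n) (hε : 0 < ε) (hε2 : ε < 1 / 2) (hδ : 0 < δ)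
    (hδ1 : δ < 1) (hY : 1 ≤ Y) :
    timeBound n ε δ Y ≤ 2 ^ 30 * (Y * (boundLog n δ ^ 2 / ε ^ (5 / 2 : ℝ))) := by
  have hr := Real.sqrt_pos.2 hε
  have hpow : ε ^ (5 / 2 : ℝ) = ε * ε * Real.sqrt ε := by
    rw [Real.sqrt_eq_rpow, show (5 / 2 : ℝ) = 2 + 1 / 2 by norm_num, Real.rpow_add hε,
      Real.rpow_two, sq]
  have hr1 : Real.sqrt ε ≤ 1 := Real.sqrt_le_one.2 (by linarith)
  set R := 1 / (ε * ε * Real.sqrt ε) with hR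
  have hεR : 1 / ε ≤ R := by
    rw [hR]
    refine one_div_le_one_div_of_le (by positivity) ?_
    have : ε * Real.sqrt ε ≤ 1 := mul_le_one₀ (by linarith) hr.le hr1
    nlinarith
  have hR1 : 1 ≤ R := by
    refine le_trans ?_ hεR
    rw [le_div_iff₀ hε]; linarith
  set l := boundLog n δ with hl
  have hl2 : 1 / 2 ≤ l := half_le_boundLog hn hδ hδ1
  have hN := numRounds_le_boundLog hn hδ hδ1
  have ht := (numSamples_le_boundLog hn hδ hδ1).2
  have hL := sampleLog_le_boundLog hn hδ hδ1
  have hL0 := sampleLog_pos (by omega : 1 ≤ n) hδ hδ1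
  have hK := roundFactor_le hn hε hδ hδ1
  rw [← hl] at hN ht hL hK
  have hK' : roundFactor n ε (δ / 3) ≤ 2 ^ 18 * (3 * l) * R := by
    rw [hR, mul_one_div]; exact hK
  have hRY : 1 ≤ R * Y := one_le_mul_of_one_le_of_one_le hR1 hY
  set W := R * Y with hW
  have hlW : l ≤ l * W := le_mul_of_one_le_right (by linarith) hRY
  have hll : l ≤ 2 * l ^ 2 := by nlinarith
  have hllW : l * W ≤ 2 * (l ^ 2 * W) := by nlinarith
  have e1 : roundFactor n ε (δ / 3) * Y ≤ 2 ^ 18 * 3 * (l * W) := by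
    calc _ ≤ 2 ^ 18 * (3 * l) * R * Y := by gcongr
      _ = _ := by rw [hW]; ring
  have e2 : 35 * sampleLog n δ / ε * (4 * Y) + 2 ≤ 704 * (l * W) := by
    have : 35 * sampleLog n δ / ε * (4 * Y) ≤ 700 * (l * W) := by
      calc 35 * sampleLog n δ / ε * (4 * Y) = 35 * sampleLog n δ * (1 / ε) * (4 * Y) := by ring
        _ ≤ 35 * (5 * l) * R * (4 * Y) := by gcongr
        _ = _ := by rw [hW]; ring
    linarith
  have e3 : (numSamples δ : ℝ) * (35 * sampleLog n δ / ε * (4 * Y) + 2) ≤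
      4 * l * (704 * (l * W)) := by
    gcongr
  have e4 : Y * (l ^ 2 / ε ^ (5 / 2 : ℝ)) = l ^ 2 * W := by
    rw [hpow, hW, hR]; ring
  rw [e4, timeBound]
  have e5 : 4 * l * (704 * (l * W)) = 2816 * (l ^ 2 * W) := by ring
  have e6 : 1 ≤ 4 * (l ^ 2 * W) := by linarith
  rw [e5] at e3
  linarith

/-- The ε in the threshold cancels one of the two in the denominator. For q = √(n/D) one has
1/min(x, q) ≤ 1/x + 1/q and n/(Dq) = q. -/
theorem sampleSize_le {x D : ℝ} (hn : 1 ≤ n) (hε : 0 < ε) (hδ : 0 < δ)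
    (hδ1 : δ < 1) (hx : 0 < x) (hD : 0 < D) :
    (sampleSize n ε δ (min x (Real.sqrt (n / D)) * D / ε) : ℝ) ≤
      35 * sampleLog n δ / ε * (n / (D * x) + Real.sqrt (n / D)) + 1 := by
  have hn0 : (0 : ℝ) < n := by exact_mod_cast hn
  have hL := sampleLog_pos hn hδ hδ1
  have hq : 0 < Real.sqrt (n / D) := Real.sqrt_pos.2 (by positivity)
  have hX0 : 0 < min x (Real.sqrt (n / D)) := lt_min hx hq
  rw [sampleSize_eq hδ hδ1]
  refine (Nat.ceil_lt_add_one (by positivity)).le.trans ?_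
  rw [add_le_add_iff_right]
  have e : (n : ℝ) / (min x (Real.sqrt (n / D)) * D / ε) * (35 * sampleLog n δ / ε ^ 2) =
      35 * sampleLog n δ / ε * (n / (D * min x (Real.sqrt (n / D)))) := by
    field_simp
  rw [e]
  refine mul_le_mul_of_nonneg_left ?_ (by positivity)
  rcases le_total x (Real.sqrt (n / D)) with h | h
  · rw [min_eq_left h]; linarith
  · rw [min_eq_right h]
    have h2 : n / (D * Real.sqrt (n / D)) = Real.sqrt (n / D) := by
      rw [div_eq_iff (by positivity), mul_left_comm, Real.mul_self_sqrt (by positivity)]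
      field_simp
    rw [h2]
    have : 0 ≤ n / (D * x) := by positivity
    linarith

end Numeric

variable {n : ℕ} [NeZero n] {G : AdjListGraph n}

/-- The state after the subroutine has returned in the state `a`. -/
noncomputable def afterCall (σ a : State) : State :=
  { (σ.setReg vDbar (a.reg 0)) with
    queries := σ.queries + a.queries
    time := σ.time + a.time + 5 + 1 }

theorem mean_preprocessing (A : Cmd) {ε δ x : ℝ} (F : State → ℝ≥0∞) :
    mean ((preprocessing A).run G (State.init [(n : ℝ), ε, δ, x])) F =
      mean (A.run G (State.init [(n : ℝ), ε, δ / 3])) fun a =>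
        mean (afterEstimate.run G (afterCall (State.init [(n : ℝ), ε, δ, x]) a)) F := by
  rw [run_preprocessing, mean_seq]
  simp only [Cmd.run, mean_map]
  rfl

/-- A good estimate fails with probability at most δ/48, since n ≥ 2, and the samples fail with
probability at most 2δ/3 + δ/12; the sum is below δ. -/
theorem preprocessing_prob {ε δ x C : ℝ} (hm : 0 < G.m) (hε : 0 < ε)
    (hε2 : ε < 1 / 2) (hδ : 0 < δ) (hδ1 : δ < 1) (hx : 1 ≤ x) (hC : 70 ≤ C) :
    ((preprocessing estimateDegree).run G (State.init [(n : ℝ), ε, δ, x])).toOuterMeasure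
      {σ | Successful G ε δ C σ}ᶜ ≤ ENNReal.ofReal δ := by
  have hn2 : (2 : ℝ) ≤ n := by exact_mod_cast G.two_le_of_m_pos hm
  have hA := estimateDegree_prob (G := G) (δ := δ / 3) hm hε hε2 (by positivity) (by linarith)
  rw [toOuterMeasure_eq_mean] at hA
  rw [toOuterMeasure_eq_mean, mean_preprocessing]
  refine (mean_mono fun a _ => ?_).trans ((mean_add _ _
    (fun _ => ENNReal.ofReal (2 / 3 * δ + δ / 12))).le.trans
    ((add_le_add hA (mean_const _ _).le).trans ?_))
  · by_cases ha : G.GoodEstimate ε (a.reg 0)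
    · rw [← toOuterMeasure_eq_mean]
      exact le_add_left (afterEstimate_prob hm hε hε2 hδ hδ1 hx ha hC rfl rfl rfl rfl rfl)
    · rw [Set.indicator_of_mem (by exact fun h => ha h.1)]
      refine le_add_right (mean_le_of_forall_le fun σ' _ => ?_)
      exact Set.indicator_le_self _ _ _
  · rw [← ENNReal.ofReal_add (by positivity) (by positivity)]
    refine ENNReal.ofReal_le_ofReal ?_
    have : δ / 3 / (n : ℝ) ^ 4 ≤ δ / 3 / 2 ^ 4 := by gcongr
    linarith

/-- The parameter Y allows two uses: with the maximum in the claimed bound after a successful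
search, and with 16n³ after an arbitrary one. -/
theorem afterEstimate_time_le {ε δ x Y : ℝ} {a : State} (hε : 0 < ε)
    (hδ : 0 < δ) (hδ1 : δ < 1) (hx : 1 ≤ x)
    (hD : 0 < a.reg 0) (hY : n / (a.reg 0 * x) + Real.sqrt (n / a.reg 0) ≤ 4 * Y)
    (ht : a.time ≤ 62 + 160 * (numRounds n : ℝ) + 320 * (roundFactor n ε (δ / 3) * Y)) :
    mean (afterEstimate.run G (afterCall (State.init [(n : ℝ), ε, δ, x]) a))
      (fun σ => (σ.time : ℝ≥0∞)) ≤ ENNReal.ofReal (timeBound n ε δ Y) := by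
  have hn1 : 1 ≤ n := NeZero.pos n
  refine mean_le_of_forall_le fun σ hσ => ?_
  rw [← ENNReal.ofReal_natCast]
  refine ENNReal.ofReal_le_ofReal ?_
  have h1 := afterEstimate_time (x := x) hε hδ hδ1 (by linarith) hD rfl rfl rfl rfl rfl hσ
  have h2 := sampleSize_le (ε := ε) (x := x) hn1 hε hδ hδ1 (by linarith) hD
  set s := sampleSize n ε δ (min x (Real.sqrt (n / a.reg 0)) * a.reg 0 / ε)
  have h3 : (σ.time : ℝ) ≤ a.time + 106 + 100 * (numSamples δ * (s + 1)) := by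
    have : (afterCall (State.init [(n : ℝ), ε, δ, x]) a).time = 0 + a.time + 5 + 1 := rfl
    rw [this] at h1
    have : σ.time ≤ a.time + 106 + 100 * (numSamples δ * (s + 1)) := by omega
    exact_mod_cast this
  have hL := sampleLog_pos hn1 hδ hδ1
  have h4 : (s : ℝ) + 1 ≤ 35 * sampleLog n δ / ε * (4 * Y) + 2 := by
    have : 35 * sampleLog n δ / ε * (n / (a.reg 0 * x) + Real.sqrt (n / a.reg 0)) ≤
        35 * sampleLog n δ / ε * (4 * Y) := by gcongr
    linarith
  have h5 : (numSamples δ : ℝ) * (s + 1) ≤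
      numSamples δ * (35 * sampleLog n δ / ε * (4 * Y) + 2) := by gcongr
  rw [timeBound]
  linarith

theorem preprocessing_time {ε δ x : ℝ} (hm : 0 < G.m) (hε : 0 < ε)
    (hε2 : ε < 1 / 2) (hδ : 0 < δ) (hδ1 : δ < 1) (hx : 1 ≤ x) :
    expect ((preprocessing estimateDegree).run G (State.init [(n : ℝ), ε, δ, x])) State.time ≤
      ENNReal.ofReal (2 ^ 35 * complexityBound G ε δ x) := by
  have hn2' := G.two_le_of_m_pos hm
  have hn2 : (2 : ℝ) ≤ n := by exact_mod_cast hn2'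
  have hd := G.davg_pos hm
  set M := max ((n : ℝ) / (G.davg * x)) (Real.sqrt ((n : ℝ) / G.davg)) with hM
  have hM1 : 1 ≤ M := le_max_of_le_right (Real.one_le_sqrt.2 (by
    rw [le_div_iff₀ hd, one_mul]; exact G.davg_le))
  have hA := estimateDegree_prob (G := G) (δ := δ / 3) hm hε hε2 (by positivity) (by linarith)
  have hK := roundFactor_pos (n := n) (δ := δ / 3) hε (by positivity) (by linarith)
  set Q := {σ : State | G.GoodEstimate ε (σ.reg 0) ∧ σ.time ≤ 62 + 160 * (numRounds n : ℝ) +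
    320 * (roundFactor n ε (δ / 3) * Real.sqrt (n / G.davg))} with hQ
  set B := boundLog n δ ^ 2 / ε ^ (5 / 2 : ℝ) with hB
  have hB0 : 0 ≤ B := by positivity
  have hgood : ∀ a ∈ Q, mean (afterEstimate.run G (afterCall (State.init [(n : ℝ), ε, δ, x]) a))
      (fun σ => (σ.time : ℝ≥0∞)) ≤ ENNReal.ofReal (2 ^ 30 * (M * B)) := by
    intro a ha
    have hDd : G.davg / 2 ≤ a.reg 0 := le_trans (by nlinarith) ha.1.1
    have hD : 0 < a.reg 0 := by linarith
    refine (afterEstimate_time_le (Y := M) hε hδ hδ1 hx hD ?_ (ha.2.trans ?_)).trans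
      (ENNReal.ofReal_le_ofReal (timeBound_le hn2' hε hε2 hδ hδ1 hM1))
    · have h1 : n / (a.reg 0 * x) ≤ 2 * M := by
        calc n / (a.reg 0 * x) ≤ n / (G.davg / 2 * x) := by gcongr
          _ = 2 * (n / (G.davg * x)) := by field_simp
          _ ≤ 2 * M := by gcongr; exact le_max_left _ _
      have h2 : Real.sqrt (n / a.reg 0) ≤ 2 * M := by
        calc Real.sqrt (n / a.reg 0) ≤ Real.sqrt (2 ^ 2 * (n / G.davg)) := by
              refine Real.sqrt_le_sqrt ?_
              calc n / a.reg 0 ≤ n / (G.davg / 2) := by gcongr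
                _ = 2 * (n / G.davg) := by field_simp
                _ ≤ 2 ^ 2 * (n / G.davg) := by gcongr; norm_num
          _ = 2 * Real.sqrt (n / G.davg) := by
              rw [Real.sqrt_mul (by norm_num), Real.sqrt_sq (by norm_num)]
          _ ≤ 2 * M := by gcongr; exact le_max_right _ _
      linarith
    · gcongr
      exact le_max_right _ _
  have hall : ∀ a ∈ (estimateDegree.run G (State.init [(n : ℝ), ε, δ / 3])).support,
      mean (afterEstimate.run G (afterCall (State.init [(n : ℝ), ε, δ, x]) a))
        (fun σ => (σ.time : ℝ≥0∞)) ≤ ENNReal.ofReal (2 ^ 30 * (16 * n ^ 3 * B)) := by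
    intro a ha
    obtain ⟨h1, h2⟩ := estimateDegree_support hε hε2 (by positivity) (by linarith) ha
    have hD : 0 < a.reg 0 := lt_of_lt_of_le (by positivity) h1
    have hnD : n / a.reg 0 ≤ 32 * (n : ℝ) ^ 3 := by
      rw [div_le_iff₀ hD]
      calc (n : ℝ) = 32 * n ^ 3 * (1 / (32 * n ^ 2)) := by field_simp
        _ ≤ 32 * n ^ 3 * a.reg 0 := by gcongr
    have h16 : (1 : ℝ) ≤ 16 * n ^ 3 := by
      have : (1 : ℝ) ≤ n ^ 3 := one_le_pow₀ (by linarith)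
      linarith
    refine (afterEstimate_time_le (Y := 16 * n ^ 3) hε hδ hδ1 hx hD ?_ (h2.trans ?_)).trans
      (ENNReal.ofReal_le_ofReal (timeBound_le hn2' hε hε2 hδ hδ1 h16))
    · have h3 : n / (a.reg 0 * x) ≤ 32 * (n : ℝ) ^ 3 := by
        refine le_trans ?_ hnD
        gcongr
        exact le_mul_of_one_le_right hD.le hx
      have h4 : Real.sqrt (n / a.reg 0) ≤ 32 * (n : ℝ) ^ 3 := by
        refine Real.sqrt_le_iff.2 ⟨by positivity, hnD.trans ?_⟩
        nlinarith
      linarith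
    · have : 4 * (n : ℝ) ^ 2 ≤ 32 * n ^ 3 := by nlinarith [sq_nonneg (n : ℝ)]
      have := mul_le_mul_of_nonneg_left this hK.le
      linarith
  rw [expect_eq_mean, mean_preprocessing]
  have hpt : ∀ a ∈ (estimateDegree.run G (State.init [(n : ℝ), ε, δ / 3])).support,
      mean (afterEstimate.run G (afterCall (State.init [(n : ℝ), ε, δ, x]) a))
        (fun σ => (σ.time : ℝ≥0∞)) ≤ ENNReal.ofReal (2 ^ 30 * (M * B)) +
          Qᶜ.indicator 1 a * ENNReal.ofReal (2 ^ 30 * (16 * n ^ 3 * B)) := by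
    intro a ha
    by_cases h : a ∈ Q
    · exact le_add_right (hgood a h)
    · rw [Set.indicator_of_mem (by exact h), Pi.one_apply, one_mul]
      exact le_add_left (hall a ha)
  refine (mean_mono hpt).trans ?_
  rw [mean_add, mean_const, mean_mul_const, ← toOuterMeasure_eq_mean]
  refine (add_le_add le_rfl (mul_le_mul_left hA _)).trans ?_
  rw [← ENNReal.ofReal_mul (by positivity), ← ENNReal.ofReal_add (by positivity) (by positivity)]
  refine ENNReal.ofReal_le_ofReal ?_
  have hcb : complexityBound G ε δ x = M * B := rfl
  rw [hcb]
  -- The n⁻⁴ in the failure probability outweighs the n³ of the worst case, leaving a bounded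
  -- multiple of B.
  have h1 : δ / 3 / n ^ 4 * (2 ^ 30 * (16 * (n : ℝ) ^ 3 * B)) =
      2 ^ 30 * 16 / 3 * (δ / n) * B := by field_simp
  have h2 : δ / n ≤ 1 := by rw [div_le_one (by linarith)]; linarith
  have h3 : 2 ^ 30 * 16 / 3 * (δ / n) * B ≤ 2 ^ 30 * 16 / 3 * 1 * B := by gcongr
  have h4 : B ≤ M * B := le_mul_of_one_le_left hB0 hM1
  rw [h1]
  linarith

end EdgeSampling

theorem mainTheorem2 :
    ∃ (A : EdgeSampling.Cmd) (C : ℝ), 0 < C ∧ EdgeSampling.EstimatesAverageDegree A ∧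
      ∀ (n : ℕ) [NeZero n] (G : AdjListGraph n) (ε δ x : ℝ), 0 < G.m →
        0 < ε → ε < 1 / 2 → 0 < δ → δ < 1 → 1 ≤ x →
        ENNReal.ofReal (1 - δ) ≤
          ((EdgeSampling.preprocessing A).run G
            (EdgeSampling.State.init [(n : ℝ), ε, δ, x])).toOuterMeasure
            {σ | EdgeSampling.Successful G ε δ C σ} ∧
        EdgeSampling.expect ((EdgeSampling.preprocessing A).run G
            (EdgeSampling.State.init [(n : ℝ), ε, δ, x])) EdgeSampling.State.queries ≤
          ENNReal.ofReal (C * EdgeSampling.complexityBound G ε δ x) ∧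
        EdgeSampling.expect ((EdgeSampling.preprocessing A).run G
            (EdgeSampling.State.init [(n : ℝ), ε, δ, x])) EdgeSampling.State.time ≤
          ENNReal.ofReal (C * EdgeSampling.complexityBound G ε δ x) := by
  -- The constant covers both the time bound, 2^30 · (1 + 16/3) in total, and the 70 steps per
  -- element of S when sampling an edge.
  refine ⟨EdgeSampling.estimateDegree, 2 ^ 35, by positivity,
    EdgeSampling.estimatesAverageDegree_estimateDegree, ?_⟩
  intro n _ G ε δ x hm hε hε2 hδ hδ1 hx
  have htime := EdgeSampling.preprocessing_time hm hε hε2 hδ hδ1 hx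
  refine ⟨EdgeSampling.ofReal_one_sub_le_toOuterMeasure hδ.le
    (EdgeSampling.preprocessing_prob hm hε hε2 hδ hδ1 hx (by norm_num)), ?_, htime⟩
  refine le_trans (EdgeSampling.mean_mono fun σ hσ => ?_) htime
  have := EdgeSampling.queries_le_time G _ _ σ hσ
  simp only [EdgeSampling.State.init] at this
  exact_mod_cast (by omega : σ.queries ≤ σ.time)
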